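/- Let $d\ge 2$ be an integer. Let $V_d$ be the vector space of $1$-forms $\omega=a\,\mathrm dx+b\,\mathrm dy+c\,\mathrm dz$ on $\mathbb C^3$ whose coefficients $a,b,c\in\mathbb C[x,y,z]$ are homogeneous of degree $d+1$ and satisfy $xa+yb+zc=0$. Let $\mathbf F(d)\subset\mathbb P(V_d)\cong\mathbb P_{\mathbb C}^{d^2+4d+2}$ be the set of foliations of degree $d$ on $\mathbb P^2_{\mathbb C}$, that is, the set of classes $[\omega]$ such that $a,b,c$ have no common factor; it carries the Zariski topology induced by $\mathbb P(V_d)$. The group $\mathrm{Aut}(\mathbb P^2_{\mathbb C})=\mathrm{PGL}_3(\mathbb C)$ acts on $\mathbf F(d)$ by pullback; for $\mathcal F\in\mathbf F(d)$ let $\mathcal O(\mathcal F)=\{\varphi^*\mathcal F\mid\varphi\in\mathrm{Aut}(\mathbb P^2_{\mathbb C})\}$ be its orbit, $\overline{\mathcal O(\mathcal F)}$ the closure of the orbit in $\mathbf F(d)$, and $\dim\mathcal O(\mathcal F)$ its dimension (as a subspace of $\mathbf F(d)$ for the Zariski topology). Let $\mathcal F_1^d,\mathcal F_2^d\in\mathbf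 F(d)$ be the foliations defined in the affine chart $z=1$ by the $1$-forms $$\omega_1^d=y^d\,\mathrm dx+x^d(x\,\mathrm dy-y\,\mathrm dx),\qquad \omega_2^d=x^d\,\mathrm dx+y^d(x\,\mathrm dy-y\,\mathrm dx).$$ Let $\mathcal F\in\mathbf F(d)$. If $\dim\mathcal O(\mathcal F)\le 7$, then $$\overline{\mathcal O(\mathcal F)}\subset\mathcal O(\mathcal F)\cup\mathcal O(\mathcal F_1^d)\cup\mathcal O(\mathcal F_2^d).$$ In particular, when $\dim\mathcal O(\mathcal F)=7$, the orbit $\mathcal O(\mathcal F)$ is closed in $\mathbf F(d)$ if and only if $\mathcal F_1^d\notin\overline{\mathcal O(\mathcal F)}$ and $\mathcal F_2^d\notin\overline{\mathcal O(\mathcal F)}$. -/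

import Mathlib

open scoped LinearAlgebra.Projectivization

noncomputable section

namespace PlaneFoliation

/-! ### The Zariski topology on a projective space over `ℂ` -/

section Zariski

variable {V : Type*} [AddCommGroup V] [Module ℂ V]

/-- The value at `v : V` of a polynomial `P` in the linear forms on `V`. -/
def evalForm (P : MvPolynomial (Module.Dual ℂ V) ℂ) (v : V) : ℂ :=
  MvPolynomial.eval (fun l : Module.Dual ℂ V => l v) P

theorem evalForm_smul {P : MvPolynomial (Module.Dual ℂ V) ℂ} {n : ℕ} (hP : P.IsHomogeneous n)
    (c : ℂ) (v : V) : evalForm P (c • v) = c ^ n * evalForm P v := by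
  have h : (fun l : Module.Dual ℂ V => l (c • v)) = c • fun l : Module.Dual ℂ V => l v := by
    funext l
    simp
  unfold evalForm
  rw [h]
  simp only [MvPolynomial.eval_eq, Finset.mul_sum]
  refine Finset.sum_congr rfl fun m hm => ?_
  have hdeg : ∑ i ∈ m.support, m i = n := by
    have := hP (MvPolynomial.mem_support_iff.mp hm)
    simpa [Finsupp.weight_apply, Finsupp.sum] using this
  simp only [Pi.smul_apply, smul_eq_mul, mul_pow, Finset.prod_mul_distrib,
    Finset.prod_pow_eq_pow_sum, hdeg]
  ring

/-- The common zeros in the projective space of `V` of a set `T` of polynomials. It is used only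
for homogeneous polynomials, whose vanishing does not depend on the representative. -/
def zeroLocus (T : Set (MvPolynomial (Module.Dual ℂ V) ℂ)) : Set (ℙ ℂ V) :=
  {p | ∀ P ∈ T, evalForm P p.rep = 0}

theorem mk_mem_zeroLocus {T : Set (MvPolynomial (Module.Dual ℂ V) ℂ)}
    (hT : ∀ P ∈ T, ∃ n : ℕ, P.IsHomogeneous n) (v : V) (hv : v ≠ 0) :
    Projectivization.mk ℂ v hv ∈ zeroLocus T ↔ ∀ P ∈ T, evalForm P v = 0 := by
  obtain ⟨a, ha⟩ := Projectivization.exists_smul_eq_mk_rep ℂ v hv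
  refine forall₂_congr fun P hP => ?_
  obtain ⟨n, hn⟩ := hT P hP
  rw [← ha, Units.smul_def, evalForm_smul hn]
  simp

/-- The Zariski topology on the projective space of `V`: the closed sets are the common zeros of
sets of homogeneous polynomials. -/
@[reducible]
def zariski (V : Type*) [AddCommGroup V] [Module ℂ V] : TopologicalSpace (ℙ ℂ V) :=
  TopologicalSpace.ofClosed
    {Z | ∃ T : Set (MvPolynomial (Module.Dual ℂ V) ℂ),
      (∀ P ∈ T, ∃ n : ℕ, P.IsHomogeneous n) ∧ Z = zeroLocus T}
    (by
      refine ⟨{1}, ?_, ?_⟩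
      · rintro P rfl
        exact ⟨0, MvPolynomial.isHomogeneous_one _ _⟩
      · ext p
        simp [zeroLocus, evalForm])
    (by
      intro A hA
      have hA' : ∀ Z : Set (ℙ ℂ V), ∃ T : Set (MvPolynomial (Module.Dual ℂ V) ℂ),
          Z ∈ A → (∀ P ∈ T, ∃ n : ℕ, P.IsHomogeneous n) ∧ Z = zeroLocus T := fun Z => by
        by_cases h : Z ∈ A
        · obtain ⟨T, hT⟩ := hA h
          exact ⟨T, fun _ => hT⟩
        · exact ⟨∅, fun h' => absurd h' h⟩
      choose T hT using hA'
      refine ⟨⋃ Z ∈ A, T Z, ?_, ?_⟩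
      · intro P hP
        simp only [Set.mem_iUnion] at hP
        obtain ⟨Z, hZA, hP⟩ := hP
        exact (hT Z hZA).1 P hP
      · ext p
        simp only [Set.mem_sInter, zeroLocus, Set.mem_iUnion, Set.mem_ofPred_eq]
        constructor
        · rintro h P ⟨Z, hZA, hP⟩
          have := h Z hZA
          rw [(hT Z hZA).2] at this
          exact this P hP
        · intro h Z hZA
          rw [(hT Z hZA).2]
          exact fun P hP => h P ⟨Z, hZA, hP⟩)
    (by
      rintro _ ⟨S, hS, rfl⟩ _ ⟨T, hT, rfl⟩
      refine ⟨{R | ∃ P ∈ S, ∃ Q ∈ T, R = P * Q}, ?_, ?_⟩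
      · rintro _ ⟨P, hP, Q, hQ, rfl⟩
        obtain ⟨m, hm⟩ := hS P hP
        obtain ⟨n, hn⟩ := hT Q hQ
        exact ⟨m + n, hm.mul hn⟩
      · ext p
        simp only [zeroLocus, Set.mem_union, Set.mem_ofPred_eq]
        constructor
        · rintro (h | h) _ ⟨P, hP, Q, hQ, rfl⟩
          · simp [evalForm, show MvPolynomial.eval _ P = 0 from h P hP]
          · simp [evalForm, show MvPolynomial.eval _ Q = 0 from h Q hQ]
        · intro h
          by_contra! hne
          obtain ⟨⟨P, hP, hP0⟩, Q, hQ, hQ0⟩ := hne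
          have := h _ ⟨P, hP, Q, hQ, rfl⟩
          rw [evalForm, map_mul] at this
          exact (mul_ne_zero hP0 hQ0) this)

end Zariski

/-! ### The space of foliations of degree `d` on the complex projective plane

The homogeneous coordinates `x, y, z` are `X 0, X 1, X 2`, and the `1`-form
`a dx + b dy + c dz` is the triple `![a, b, c]`. -/

open MvPolynomial

/-- The `1`-forms `a dx + b dy + c dz` whose coefficients are homogeneous of degree `d + 1` and
which satisfy the Euler condition `x a + y b + z c = 0`. -/
def OneForms (d : ℕ) : Submodule ℂ (Fin 3 → MvPolynomial (Fin 3) ℂ) where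
  carrier := {w | (∀ i, (w i).IsHomogeneous (d + 1)) ∧ ∑ i, X i * w i = 0}
  zero_mem' := ⟨fun _ => isHomogeneous_zero _ _ _, by simp⟩
  add_mem' := by
    rintro v w ⟨hv, hv'⟩ ⟨hw, hw'⟩
    refine ⟨fun i => (hv i).add (hw i), ?_⟩
    simp only [Pi.add_apply, mul_add, Finset.sum_add_distrib, hv', hw', add_zero]
  smul_mem' := by
    rintro c w ⟨hw, hw'⟩
    refine ⟨fun i => ?_, ?_⟩
    · exact (homogeneousSubmodule (Fin 3) ℂ (d + 1)).smul_mem c (hw i)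
    · simp only [Pi.smul_apply, mul_smul_comm, ← Finset.smul_sum, hw', smul_zero]

/-- The coefficients of `w` have no common factor. -/
def NoCommonFactor (w : Fin 3 → MvPolynomial (Fin 3) ℂ) : Prop :=
  ∀ g : MvPolynomial (Fin 3) ℂ, (∀ i, g ∣ w i) → IsUnit g

theorem NoCommonFactor.of_smul {w : Fin 3 → MvPolynomial (Fin 3) ℂ} {c : ℂ}
    (h : NoCommonFactor (c • w)) : NoCommonFactor w :=
  fun g hg => h g fun i => by
    rw [Pi.smul_apply, smul_eq_C_mul]
    exact (hg i).mul_left _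

/-- The set `F(d)` of foliations of degree `d` on the projective plane: the classes, up to a
nonzero constant, of the forms in `OneForms d` whose coefficients have no common factor. -/
def Foliation (d : ℕ) : Type :=
  {p : ℙ ℂ (OneForms d) // NoCommonFactor (p.rep : Fin 3 → MvPolynomial (Fin 3) ℂ)}

/-- `F(d)` carries the Zariski topology induced by the projective space that contains it. -/
instance Foliation.instTopologicalSpace (d : ℕ) : TopologicalSpace (Foliation d) :=
  (zariski (OneForms d)).induced Subtype.val

theorem NoCommonFactor.ne_zero {d : ℕ} {w : OneForms d}
    (h : NoCommonFactor (w : Fin 3 → MvPolynomial (Fin 3) ℂ)) : w ≠ 0 := by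
  rintro rfl
  exact not_isUnit_zero (h 0 fun i => by simp)

theorem noCommonFactor_rep_mk {d : ℕ} {w : OneForms d}
    (h : NoCommonFactor (w : Fin 3 → MvPolynomial (Fin 3) ℂ)) :
    NoCommonFactor
      ((Projectivization.mk ℂ w h.ne_zero).rep : Fin 3 → MvPolynomial (Fin 3) ℂ) := by
  obtain ⟨a, ha⟩ := Projectivization.exists_smul_eq_mk_rep ℂ w h.ne_zero
  refine NoCommonFactor.of_smul (c := ((a⁻¹ : ℂˣ) : ℂ)) ?_
  rw [← ha, Units.smul_def, Submodule.coe_smul, smul_smul]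
  simpa using h

/-- The foliation defined by a `1`-form. -/
def Foliation.ofForm {d : ℕ} (w : OneForms d)
    (h : NoCommonFactor (w : Fin 3 → MvPolynomial (Fin 3) ℂ)) : Foliation d :=
  ⟨Projectivization.mk ℂ w h.ne_zero, noCommonFactor_rep_mk h⟩

/-- A `1`-form that defines the foliation `F`. -/
def Foliation.form {d : ℕ} (F : Foliation d) : OneForms d := F.1.rep

/-! ### The action of the automorphisms of the projective plane -/

/-- The polynomial `f ∘ A`, for a `3 × 3` matrix `A`. -/
def subst (A : Matrix (Fin 3) (Fin 3) ℂ) :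
    MvPolynomial (Fin 3) ℂ →ₐ[ℂ] MvPolynomial (Fin 3) ℂ :=
  aeval fun i => ∑ j, C (A i j) * X j

/-- The pullback of a `1`-form by the linear map `A`; the coefficient of `dxⱼ` in `A^* w` is
`∑ i, A i j * (w i ∘ A)`. -/
def pullbackForm (A : Matrix (Fin 3) (Fin 3) ℂ) (w : Fin 3 → MvPolynomial (Fin 3) ℂ) :
    Fin 3 → MvPolynomial (Fin 3) ℂ :=
  fun j => ∑ i, C (A i j) * subst A (w i)

theorem isHomogeneous_subst (A : Matrix (Fin 3) (Fin 3) ℂ) {f : MvPolynomial (Fin 3) ℂ} {n : ℕ}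
    (hf : f.IsHomogeneous n) : (subst A f).IsHomogeneous n := by
  have := hf.aeval (fun i => ∑ j, C (A i j) * X j : Fin 3 → MvPolynomial (Fin 3) ℂ) (n := 1)
    (fun i => IsHomogeneous.sum _ _ _ fun j _ => by
      simpa using (isHomogeneous_C (Fin 3) (A i j)).mul (isHomogeneous_X ℂ j))
  simpa [subst] using this

theorem subst_subst (A B : Matrix (Fin 3) (Fin 3) ℂ) (f : MvPolynomial (Fin 3) ℂ) :
    subst B (subst A f) = subst (A * B) f := by
  have h : (subst B).comp (subst A) = subst (A * B) := by
    refine algHom_ext fun i => ?_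
    simp only [subst, AlgHom.comp_apply, aeval_X, map_sum, map_mul, algHom_C, Matrix.mul_apply,
      Finset.mul_sum, Finset.sum_mul, algebraMap_eq]
    rw [Finset.sum_comm]
    refine Finset.sum_congr rfl fun j _ => Finset.sum_congr rfl fun k _ => by ring
  exact DFunLike.congr_fun h f

theorem subst_one (f : MvPolynomial (Fin 3) ℂ) : subst 1 f = f := by
  have h : subst 1 = AlgHom.id ℂ (MvPolynomial (Fin 3) ℂ) := by
    refine algHom_ext fun i => ?_
    simp [subst, Matrix.one_apply]
  exact DFunLike.congr_fun h f

theorem pullbackForm_mem {d : ℕ} (A : Matrix (Fin 3) (Fin 3) ℂ)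
    {w : Fin 3 → MvPolynomial (Fin 3) ℂ} (hw : w ∈ OneForms d) :
    pullbackForm A w ∈ OneForms d := by
  obtain ⟨h1, h2⟩ := hw
  refine ⟨fun j => IsHomogeneous.sum _ _ _ fun i _ => ?_, ?_⟩
  · simpa using (isHomogeneous_C (Fin 3) (A i j)).mul (isHomogeneous_subst A (h1 i))
  · have h3 := congrArg (subst A) h2
    simp only [map_sum, map_mul, map_zero] at h3
    rw [← h3]
    simp only [pullbackForm, Finset.mul_sum]
    rw [Finset.sum_comm]
    refine Finset.sum_congr rfl fun i _ => ?_
    simp only [subst, aeval_X, Finset.sum_mul]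
    exact Finset.sum_congr rfl fun j _ => by ring

theorem pullbackForm_pullbackForm (A B : Matrix (Fin 3) (Fin 3) ℂ)
    (w : Fin 3 → MvPolynomial (Fin 3) ℂ) :
    pullbackForm B (pullbackForm A w) = pullbackForm (A * B) w := by
  funext j
  simp only [pullbackForm, map_sum, map_mul, subst_subst, Matrix.mul_apply, Finset.mul_sum,
    Finset.sum_mul]
  rw [Finset.sum_comm]
  refine Finset.sum_congr rfl fun i _ => Finset.sum_congr rfl fun k _ => ?_
  simp only [subst, algHom_C, algebraMap_eq]
  ring

theorem pullbackForm_one (w : Fin 3 → MvPolynomial (Fin 3) ℂ) : pullbackForm 1 w = w := by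
  funext j
  simp [pullbackForm, subst_one, Matrix.one_apply]

theorem NoCommonFactor.pullbackForm {w : Fin 3 → MvPolynomial (Fin 3) ℂ}
    (h : NoCommonFactor w) (A : GL (Fin 3) ℂ) : NoCommonFactor (pullbackForm A.1 w) := by
  intro g hg
  have hw : PlaneFoliation.pullbackForm A.2 (PlaneFoliation.pullbackForm A.1 w) = w := by
    rw [pullbackForm_pullbackForm, A.3, pullbackForm_one]
  have hu : IsUnit (subst A.2 g) := h _ fun i => by
    rw [← hw]
    exact Finset.dvd_sum fun j _ => (map_dvd (subst A.2) (hg j)).mul_left _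
  have := hu.map (subst A.1)
  rwa [subst_subst, A.4, subst_one] at this

/-- The foliation `φ^* F`, where `φ` is the automorphism of the projective plane induced by
`A : GL (Fin 3) ℂ`. -/
def Foliation.pullback {d : ℕ} (A : GL (Fin 3) ℂ) (F : Foliation d) : Foliation d :=
  Foliation.ofForm ⟨pullbackForm A.1 F.form.1, pullbackForm_mem A.1 F.form.2⟩
    (NoCommonFactor.pullbackForm F.2 A)

/-- The orbit `O(F)` under the action of the automorphism group of the projective plane, all of
whose elements are induced by invertible matrices. -/
def orbit {d : ℕ} (F : Foliation d) : Set (Foliation d) :=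
  Set.range fun A : GL (Fin 3) ℂ => F.pullback A

/-! ### The foliations `F₁` and `F₂` of degree `d` -/

/-- The homogenization
`(y^d z - x^d y) dx + x^(d+1) dy - x y^d dz` of `y^d dx + x^d (x dy - y dx)`. -/
def form₁ (d : ℕ) : Fin 3 → MvPolynomial (Fin 3) ℂ :=
  ![X 1 ^ d * X 2 - X 0 ^ d * X 1, X 0 ^ (d + 1), -(X 0 * X 1 ^ d)]

/-- The homogenization
`(x^d z - y^(d+1)) dx + x y^d dy - x^(d+1) dz` of `x^d dx + y^d (x dy - y dx)`. -/
def form₂ (d : ℕ) : Fin 3 → MvPolynomial (Fin 3) ℂ :=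
  ![X 0 ^ d * X 2 - X 1 ^ (d + 1), X 0 * X 1 ^ d, -X 0 ^ (d + 1)]

theorem isHomogeneous_X_pow_mul_X (i j : Fin 3) (d : ℕ) :
    (X i ^ d * X j : MvPolynomial (Fin 3) ℂ).IsHomogeneous (d + 1) := by
  simpa using ((isHomogeneous_X ℂ i).pow d).mul (isHomogeneous_X ℂ j)

theorem form₁_mem (d : ℕ) : form₁ d ∈ OneForms d := by
  refine ⟨fun i => ?_, ?_⟩
  · fin_cases i
    · exact (isHomogeneous_X_pow_mul_X 1 2 d).sub (isHomogeneous_X_pow_mul_X 0 1 d)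
    · simpa [form₁] using (isHomogeneous_X ℂ (0 : Fin 3)).pow (d + 1)
    · simpa [form₁, mul_comm] using (isHomogeneous_X_pow_mul_X 1 0 d).neg
  · simp only [Fin.sum_univ_three, form₁, Matrix.cons_val_zero, Matrix.cons_val_one,
      Matrix.cons_val]
    ring

theorem form₂_mem (d : ℕ) : form₂ d ∈ OneForms d := by
  refine ⟨fun i => ?_, ?_⟩
  · fin_cases i
    · simpa [form₂, pow_succ] using
        (isHomogeneous_X_pow_mul_X 0 2 d).sub (isHomogeneous_X_pow_mul_X 1 1 d)
    · simpa [form₂, mul_comm] using isHomogeneous_X_pow_mul_X 1 0 d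
    · simpa [form₂] using ((isHomogeneous_X ℂ (0 : Fin 3)).pow (d + 1)).neg
  · simp only [Fin.sum_univ_three, form₂, Matrix.cons_val_zero, Matrix.cons_val_one,
      Matrix.cons_val]
    ring

theorem isUnit_of_dvd_X_pow {g f : MvPolynomial (Fin 3) ℂ} {n : ℕ} (hg : g ∣ X 0 ^ n)
    (hgf : g ∣ f) (v : Fin 3 → ℂ) (hv : v 0 = 0) (hf : eval v f ≠ 0) : IsUnit g := by
  obtain ⟨k, -, hk⟩ := (dvd_prime_pow (MvPolynomial.X_prime (R := ℂ) (i := (0 : Fin 3))) n).1 hg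
  rcases Nat.eq_zero_or_pos k with rfl | hpos
  · exact associated_one_iff_isUnit.1 (by simpa using hk)
  · exfalso
    obtain ⟨q, rfl⟩ := ((dvd_pow_self _ hpos.ne').trans hk.symm.dvd).trans hgf
    simp [hv] at hf

theorem form₁_noCommonFactor (d : ℕ) : NoCommonFactor (form₁ d) := fun g hg =>
  isUnit_of_dvd_X_pow (hg 1) (hg 0) ![0, 1, 2] rfl (by
    rcases d with _ | d <;> simp [form₁]; norm_num)

theorem form₂_noCommonFactor (d : ℕ) : NoCommonFactor (form₂ d) := fun g hg =>
  isUnit_of_dvd_X_pow (show g ∣ X 0 ^ (d + 1) from (dvd_neg.1 (by simpa [form₂] using hg 2))) (hg 0) ![0, 1, 0] rfl (by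
    simp [form₂])

/-- The foliation `F₁` of degree `d`, defined in the affine chart `z = 1` by
`y^d dx + x^d (x dy - y dx)`. -/
def F₁ (d : ℕ) : Foliation d := Foliation.ofForm ⟨form₁ d, form₁_mem d⟩ (form₁_noCommonFactor d)

/-- The foliation `F₂` of degree `d`, defined in the affine chart `z = 1` by
`x^d dx + y^d (x dy - y dx)`. -/
def F₂ (d : ℕ) : Foliation d := Foliation.ofForm ⟨form₂ d, form₂_mem d⟩ (form₂_noCommonFactor d)

end PlaneFoliation

end

/-!
A foliation `G` in the closure of `orbit F` but not in `orbit F` lies on an orbit whose cone has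
strictly smaller dimension. If `orbit F` has dimension at most seven, this forces the stabilizer of
`G` to have dimension at least two, and the foliations of degree at least two with such a stabilizer
are exactly those of the orbits of `F₁ d` and `F₂ d`.

*Infinitesimal stabilizers.* Everything is expressed through the Lie algebra `isotropy w` of the
matrices whose linear vector field annihilates the form `w`. As scalar matrices multiply a form by
nonzero constants (`lieForm_one`), it is the Lie algebra of the stabilizer of the foliation in the
projective linear group.

*Classification* (`isStandard_of_isotropy`). Let `isotropy w` have dimension at least two. It contains
the Jordan components of its elements (`isotropy_jordan`). If all its elements were semisimple, it
would be a torus of dimension two, and then a coordinate would divide `w`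
(`not_torus_le_isotropy`). So it contains a nonzero nilpotent `N`, and since `ad N` is nilpotent, an
element outside the line of `N` that normalizes it (`exists_mem_isotropy_commutator_eq_smul`). If
`N ^ 2 ≠ 0`, either there is also a nilpotent element of square zero, or `w` is invariant under the
two-dimensional group that fixes a point of a conic, and then `w` vanishes on the conic
(`not_affine_le_isotropy`). If `N ^ 2 = 0`, then `w = p (x dy - y dx) + q (x dz - z dx)` with `p` and
`q` polynomials in `x` and `y` (`exists_eq_pencilForm`), and the second element of the isotropy
algebra leaves only the two standard forms, up to coordinates.

*Dimensions.* The cone over the orbit of `F` is parametrized by `A ↦ A^* w`, with comorphism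
`orbitMap w`, where `w` is a form of `F`; its ideal is the kernel of `orbitMap w`, and its dimension
is `9 - dim (isotropy w)`. It is not larger because the functions in the image of `orbitMap w` are
annihilated by the vector fields `A ↦ M * A` with `M` in `isotropy w` (`card_add_card_le_of_isotropy`);
it is not smaller because the orbit map is immersive at the identity on a complement of `isotropy w`
(`exists_algebraicIndependent_restrictMat`). By Chevalley's theorem an orbit contains a nonempty open
subset of its closure, so the cone over a boundary orbit has a strictly larger ideal
(`exists_mem_ker_orbitMap_of_mem_closure`), hence a strictly smaller dimension
(`algebraicIndependent_option_of_lt`).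

*Krull dimensions.* The topological dimension of `orbit F` is at most `8 - dim (isotropy w)`: a chain
of irreducible closed subsets gives a chain of prime ideals of cones
(`exists_algebraicIndependent_of_LTSeries`). When `isotropy w` vanishes it is at least eight: the
images of a flag of linear spaces of matrices through the identity have closures that form a chain of
length eight (`le_topologicalKrullDim_orbit`). Thus an orbit of dimension at most seven has a nonzero
isotropy algebra and a cone of dimension at most eight, and a boundary orbit has a cone of dimension
at most seven, which leaves an isotropy algebra of dimension at least two
(`exists_mem_isotropy_of_mem_closure`).

Finally the orbits of `F₁ d` and `F₂ d` have dimension at most six (`topologicalKrullDim_orbit_F₁_le`,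
`topologicalKrullDim_orbit_F₂_le`), so they are distinct from an orbit of dimension seven; therefore
such an orbit is closed if and only if its closure contains neither `F₁ d` nor `F₂ d`.
-/

namespace PlaneFoliation

open MvPolynomial

/-! ### The Lie derivative of a form along a linear vector field -/

/-- The derivation of `ℂ[x, y, z]` given by the linear vector field `v ↦ M v`. -/
noncomputable def linDeriv (M : Matrix (Fin 3) (Fin 3) ℂ) :
    Derivation ℂ (MvPolynomial (Fin 3) ℂ) (MvPolynomial (Fin 3) ℂ) :=
  mkDerivation ℂ fun i => ∑ j, C (M i j) * X j

@[simp]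
theorem linDeriv_X (M : Matrix (Fin 3) (Fin 3) ℂ) (i : Fin 3) :
    linDeriv M (X i) = ∑ j, C (M i j) * X j :=
  mkDerivation_X _ _ _

theorem linDeriv_C_mul (M : Matrix (Fin 3) (Fin 3) ℂ) (c : ℂ) (f : MvPolynomial (Fin 3) ℂ) :
    linDeriv M (C c * f) = C c * linDeriv M f := by
  simp [Derivation.leibniz]

theorem linDeriv_mul (M : Matrix (Fin 3) (Fin 3) ℂ) (f g : MvPolynomial (Fin 3) ℂ) :
    linDeriv M (f * g) = linDeriv M f * g + f * linDeriv M g := by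
  simp [Derivation.leibniz]; ring

theorem linDeriv_apply (M : Matrix (Fin 3) (Fin 3) ℂ) (f : MvPolynomial (Fin 3) ℂ) :
    linDeriv M f = ∑ i, (∑ j, C (M i j) * X j) * pderiv i f := by
  have h : linDeriv M = (∑ j, C (M 0 j) * X j : MvPolynomial (Fin 3) ℂ) • pderiv 0 +
      (∑ j, C (M 1 j) * X j : MvPolynomial (Fin 3) ℂ) • pderiv 1 +
      (∑ j, C (M 2 j) * X j : MvPolynomial (Fin 3) ℂ) • pderiv 2 := by
    refine derivation_ext fun i => ?_
    fin_cases i <;> simp [pderiv_X]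
  rw [h, Fin.sum_univ_three (f := fun i => (∑ j, C (M i j) * X j) * pderiv i f)]
  simp only [Derivation.add_apply, Derivation.smul_apply, smul_eq_mul]

theorem linDeriv_add (M N : Matrix (Fin 3) (Fin 3) ℂ) (f : MvPolynomial (Fin 3) ℂ) :
    linDeriv (M + N) f = linDeriv M f + linDeriv N f := by
  simp only [linDeriv_apply, Matrix.add_apply, C_add, add_mul, Finset.sum_add_distrib]

theorem linDeriv_smul (c : ℂ) (M : Matrix (Fin 3) (Fin 3) ℂ) (f : MvPolynomial (Fin 3) ℂ) :
    linDeriv (c • M) f = C c * linDeriv M f := by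
  simp only [linDeriv_apply, Matrix.smul_apply, smul_eq_mul, C_mul, Finset.mul_sum, Finset.sum_mul,
    mul_assoc]

theorem linDeriv_one {f : MvPolynomial (Fin 3) ℂ} {n : ℕ} (hf : f.IsHomogeneous n) :
    linDeriv 1 f = C (n : ℂ) * f := by
  have := hf.sum_X_mul_pderiv
  rw [linDeriv_apply]
  simpa [Matrix.one_apply, nsmul_eq_mul] using this

theorem linDeriv_linDeriv (M N : Matrix (Fin 3) (Fin 3) ℂ) (f : MvPolynomial (Fin 3) ℂ) :
    linDeriv M (linDeriv N f) - linDeriv N (linDeriv M f) = linDeriv (N * M - M * N) f := by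
  have h : ⁅linDeriv M, linDeriv N⁆ = linDeriv (N * M - M * N) := by
    refine derivation_ext fun i => ?_
    simp only [Derivation.commutator_apply, linDeriv_X, map_add, linDeriv_C_mul,
      Matrix.sub_apply, Matrix.mul_apply, Fin.sum_univ_three, C_sub, C_mul]
    ring
  rw [← h, Derivation.commutator_apply]

/-- If `M A = A M'`, the linear map `A` carries the vector field `M'` to the vector field `M`. -/
theorem subst_linDeriv {A M M' : Matrix (Fin 3) (Fin 3) ℂ} (h : M * A = A * M')
    (f : MvPolynomial (Fin 3) ℂ) : subst A (linDeriv M f) = linDeriv M' (subst A f) := by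
  induction f using MvPolynomial.induction_on with
  | C a => simp [subst]
  | add p q hp hq => simp only [map_add, hp, hq]
  | mul_X p i hp =>
    have hX : subst A (linDeriv M (X i)) = linDeriv M' (subst A (X i)) := by
      have h' : ∀ k, ∑ j, M i j * A j k = ∑ j, A i j * M' j k := fun k => by
        simpa [Matrix.mul_apply] using congrFun (congrFun h i) k
      have hC : ∀ k, (∑ j, C (M i j) * C (A j k) : MvPolynomial (Fin 3) ℂ) =
          ∑ j, C (A i j) * C (M' j k) := fun k => by
        simpa only [map_sum, C_mul] using congrArg (C (σ := Fin 3)) (h' k)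
      have e0 := hC 0
      have e1 := hC 1
      have e2 := hC 2
      simp only [Fin.sum_univ_three] at e0 e1 e2
      simp only [linDeriv_X, map_add, map_mul, subst, aeval_X, algHom_C, algebraMap_eq,
        linDeriv_C_mul, Fin.sum_univ_three]
      linear_combination (X 0) * e0 + (X 1) * e1 + X 2 * e2
    rw [linDeriv_mul, map_add, map_mul, map_mul, map_mul, linDeriv_mul, hp, hX]

/-- The Lie derivative of the form `∑ w i dxᵢ` along the linear vector field `v ↦ M v`. The second
summand is the coefficient of `dxⱼ` in `∑ w i d(M x)ᵢ`. -/
noncomputable def lieForm (M : Matrix (Fin 3) (Fin 3) ℂ) (w : Fin 3 → MvPolynomial (Fin 3) ℂ) :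
    Fin 3 → MvPolynomial (Fin 3) ℂ :=
  fun j => linDeriv M (w j) + ∑ i, C (M i j) * w i

theorem lieForm_add (M N : Matrix (Fin 3) (Fin 3) ℂ) (w : Fin 3 → MvPolynomial (Fin 3) ℂ) :
    lieForm (M + N) w = lieForm M w + lieForm N w := by
  funext j
  simp only [lieForm, Pi.add_apply, linDeriv_add, Matrix.add_apply, C_add, add_mul,
    Finset.sum_add_distrib]
  ring

theorem lieForm_smul (c : ℂ) (M : Matrix (Fin 3) (Fin 3) ℂ)
    (w : Fin 3 → MvPolynomial (Fin 3) ℂ) : lieForm (c • M) w = c • lieForm M w := by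
  funext j
  simp only [lieForm, Pi.smul_apply, smul_eq_C_mul, linDeriv_smul, Matrix.smul_apply, smul_eq_mul,
    C_mul, mul_add, Finset.mul_sum, mul_assoc]

theorem lieForm_zero_left (w : Fin 3 → MvPolynomial (Fin 3) ℂ) : lieForm 0 w = 0 := by
  simpa using lieForm_smul 0 0 w

theorem lieForm_add_right (M : Matrix (Fin 3) (Fin 3) ℂ)
    (v w : Fin 3 → MvPolynomial (Fin 3) ℂ) : lieForm M (v + w) = lieForm M v + lieForm M w := by
  funext j
  simp only [lieForm, Pi.add_apply, map_add, mul_add, Finset.sum_add_distrib]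
  ring

theorem lieForm_smul_right (c : ℂ) (M : Matrix (Fin 3) (Fin 3) ℂ)
    (w : Fin 3 → MvPolynomial (Fin 3) ℂ) : lieForm M (c • w) = c • lieForm M w := by
  funext j
  simp only [lieForm, Pi.smul_apply, smul_eq_C_mul, linDeriv_C_mul, mul_add, Finset.mul_sum]
  congr 1
  exact Finset.sum_congr rfl fun i _ => by ring

theorem lieForm_zero_right (M : Matrix (Fin 3) (Fin 3) ℂ) : lieForm M 0 = 0 := by
  simpa using lieForm_smul_right 0 M 0

theorem lieForm_one {d : ℕ} {w : Fin 3 → MvPolynomial (Fin 3) ℂ} (hw : w ∈ OneForms d) :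
    lieForm 1 w = ((d : ℂ) + 2) • w := by
  funext j
  simp only [lieForm, linDeriv_one (hw.1 j), Pi.smul_apply, smul_eq_C_mul, Matrix.one_apply]
  simp only [eq_comm (b := j), apply_ite C, C_1, C_0, ite_mul, one_mul, zero_mul,
    Finset.sum_ite_eq, Finset.mem_univ, if_true, Nat.cast_add, Nat.cast_one, C_add]
  have : (C 2 : MvPolynomial (Fin 3) ℂ) = C 1 + C 1 := by rw [← C_add]; norm_num
  rw [this, C_1]
  ring

theorem lieForm_lieForm (M N : Matrix (Fin 3) (Fin 3) ℂ)
    (w : Fin 3 → MvPolynomial (Fin 3) ℂ) :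
    lieForm M (lieForm N w) - lieForm N (lieForm M w) = lieForm (N * M - M * N) w := by
  funext j
  have h := linDeriv_linDeriv M N (w j)
  simp only [lieForm, Pi.sub_apply, ← h, map_add, linDeriv_C_mul, Matrix.sub_apply,
    Matrix.mul_apply, Fin.sum_univ_three, C_sub, C_mul]
  ring

theorem pullbackForm_lieForm {A M M' : Matrix (Fin 3) (Fin 3) ℂ} (h : M * A = A * M')
    (w : Fin 3 → MvPolynomial (Fin 3) ℂ) :
    pullbackForm A (lieForm M w) = lieForm M' (pullbackForm A w) := by
  funext j
  have hC : ∀ i, (∑ k, C (M i k) * C (A k j) : MvPolynomial (Fin 3) ℂ) =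
      ∑ k, C (A i k) * C (M' k j) := fun i => by
    have : ∑ k, M i k * A k j = ∑ k, A i k * M' k j := by
      simpa [Matrix.mul_apply] using congrFun (congrFun h i) j
    simpa only [map_sum, C_mul] using congrArg (C (σ := Fin 3)) this
  have e0 := hC 0
  have e1 := hC 1
  have e2 := hC 2
  simp only [Fin.sum_univ_three] at e0 e1 e2
  simp only [pullbackForm, lieForm, map_add, map_mul, subst_linDeriv h, Fin.sum_univ_three,
    linDeriv_C_mul]
  have hs : ∀ c : ℂ, subst A (C c) = C c := fun c => by simp [subst]
  simp only [hs]
  linear_combination subst A (w 0) * e0 + subst A (w 1) * e1 + subst A (w 2) * e2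

/-- The isotropy algebra of the form `w`: the matrices `M` such that the Lie derivative of `w` along
the vector field `v ↦ M v` vanishes. The form is not allowed to be multiplied by a constant, which
amounts to a normalization of `M` modulo the scalar matrices. -/
noncomputable def isotropy (w : Fin 3 → MvPolynomial (Fin 3) ℂ) :
    Submodule ℂ (Matrix (Fin 3) (Fin 3) ℂ) where
  carrier := {M | lieForm M w = 0}
  zero_mem' := lieForm_zero_left w
  add_mem' := fun {M N} hM hN => by
    simp only [Set.mem_ofPred_eq] at *
    rw [lieForm_add, hM, hN, add_zero]
  smul_mem' := fun c M hM => by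
    simp only [Set.mem_ofPred_eq] at *
    rw [lieForm_smul, hM, smul_zero]

theorem mem_isotropy {w : Fin 3 → MvPolynomial (Fin 3) ℂ} {M : Matrix (Fin 3) (Fin 3) ℂ} :
    M ∈ isotropy w ↔ lieForm M w = 0 := Iff.rfl

theorem commutator_mem_isotropy {w : Fin 3 → MvPolynomial (Fin 3) ℂ}
    {M N : Matrix (Fin 3) (Fin 3) ℂ} (hM : M ∈ isotropy w) (hN : N ∈ isotropy w) :
    M * N - N * M ∈ isotropy w := by
  rw [mem_isotropy] at *
  rw [← lieForm_lieForm, hM, hN, lieForm_zero_right, lieForm_zero_right, sub_zero]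

theorem pullbackForm_zero (A : Matrix (Fin 3) (Fin 3) ℂ) : pullbackForm A 0 = 0 := by
  funext j
  simp [pullbackForm]

theorem mem_isotropy_pullbackForm {A M M' : Matrix (Fin 3) (Fin 3) ℂ} (h : M * A = A * M')
    {w : Fin 3 → MvPolynomial (Fin 3) ℂ} (hM : M ∈ isotropy w) :
    M' ∈ isotropy (pullbackForm A w) := by
  rw [mem_isotropy] at *
  rw [← pullbackForm_lieForm h, hM, pullbackForm_zero]

/-! ### Jordan decomposition in the isotropy algebra -/

/-- A product of elements annihilated by powers of a derivation is annihilated by a power of it. The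
exponent `k + l`, though not optimal, makes the induction direct. -/
theorem Derivation.exists_iterate_mul_eq_zero {R A : Type*} [CommRing R] [CommRing A] [Algebra R A]
    (D : Derivation R A A) (n : ℕ) : ∀ (k l : ℕ) (f g : A), k + l = n → D^[k] f = 0 →
      D^[l] g = 0 → D^[n] (f * g) = 0 := by
  induction n with
  | zero =>
    intro k l f g hkl hf _
    obtain rfl : k = 0 := by omega
    simp_all
  | succ n ih =>
    intro k l f g hkl hf hg
    have hz : ∀ m, D^[m] 0 = 0 := fun m => Function.iterate_fixed (map_zero D) m
    have hadd : ∀ m (a b : A), D^[m] (a + b) = D^[m] a + D^[m] b := fun m a b => by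
      induction m generalizing a b with
      | zero => rfl
      | succ m ihm => simp only [Function.iterate_succ_apply, map_add, ihm]
    rcases k with _ | k
    · simp only [Function.iterate_zero, id] at hf
      rw [hf, zero_mul, hz]
    rcases l with _ | l
    · simp only [Function.iterate_zero, id] at hg
      rw [hg, mul_zero, hz]
    rw [Function.iterate_succ_apply, D.leibniz, hadd, smul_eq_mul, smul_eq_mul,
      ih (k + 1) l f (D g) (by omega) hf hg, mul_comm,
      ih k (l + 1) (D f) g (by omega) hf hg, add_zero]

/-- A nilpotent matrix acts locally nilpotently on polynomials. -/
theorem exists_linDeriv_iterate_eq_zero {N : Matrix (Fin 3) (Fin 3) ℂ} (hN : IsNilpotent N)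
    (f : MvPolynomial (Fin 3) ℂ) : ∃ k, (linDeriv N)^[k] f = 0 := by
  have hz : ∀ m, (linDeriv N)^[m] 0 = 0 := fun m => Function.iterate_fixed (map_zero _) m
  have hadd : ∀ m a b, (linDeriv N)^[m] (a + b) = (linDeriv N)^[m] a + (linDeriv N)^[m] b :=
    fun m a b => by
      induction m generalizing a b with
      | zero => rfl
      | succ m ihm => simp only [Function.iterate_succ_apply, map_add, ihm]
  induction f using MvPolynomial.induction_on with
  | C a => exact ⟨1, by simp⟩
  | add p q hp hq =>
    obtain ⟨k, hk⟩ := hp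
    obtain ⟨l, hl⟩ := hq
    refine ⟨k + l, ?_⟩
    rw [hadd, Function.iterate_add_apply _ k l q, hl, hz, add_comm k l,
      Function.iterate_add_apply, hk, hz, add_zero]
  | mul_X p i hp =>
    obtain ⟨k, hk⟩ := hp
    obtain ⟨n, hn⟩ := hN
    have hX : ∀ m, (linDeriv N)^[m] (X i) = ∑ j, C ((N ^ m) i j) * X j := fun m => by
      induction m with
      | zero => simp [Matrix.one_apply]
      | succ m ih =>
        rw [Function.iterate_succ_apply', ih]
        simp only [map_add, linDeriv_C_mul, linDeriv_X, pow_succ, Matrix.mul_apply,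
          Fin.sum_univ_three, C_mul]
        ring
    exact ⟨k + n, Derivation.exists_iterate_mul_eq_zero _ _ k n _ _ rfl hk (by simp [hX, hn])⟩

/-- The Lie derivative along `M`, as a linear endomorphism of the space of forms. -/
noncomputable def lieEnd (M : Matrix (Fin 3) (Fin 3) ℂ) :
    Module.End ℂ (Fin 3 → MvPolynomial (Fin 3) ℂ) where
  toFun := lieForm M
  map_add' := lieForm_add_right M
  map_smul' c := lieForm_smul_right c M

theorem lieEnd_apply (M : Matrix (Fin 3) (Fin 3) ℂ) (w : Fin 3 → MvPolynomial (Fin 3) ℂ) :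
    lieEnd M w = lieForm M w := rfl

theorem commute_lieEnd {M N : Matrix (Fin 3) (Fin 3) ℂ} (h : Commute M N) :
    Commute (lieEnd M) (lieEnd N) := by
  refine LinearMap.ext fun w => sub_eq_zero.1 ?_
  simp only [Module.End.mul_apply, lieEnd_apply]
  rw [lieForm_lieForm, h.eq, sub_self, lieForm_zero_left]

/-- A vector annihilated by powers of two commuting endomorphisms is annihilated by a power of their
sum. -/
theorem add_pow_apply_eq_zero {R V : Type*} [CommRing R] [AddCommGroup V] [Module R V]
    {f g : Module.End R V} (h : Commute f g) (n : ℕ) :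
    ∀ (k l : ℕ) (v : V), k + l = n → (f ^ k) v = 0 → (g ^ l) v = 0 → ((f + g) ^ n) v = 0 := by
  induction n with
  | zero =>
    intro k l v hkl hf _
    obtain rfl : k = 0 := by omega
    simpa using hf
  | succ n ih =>
    intro k l v hkl hf hg
    rcases k with _ | k
    · simp only [pow_zero, Module.End.one_apply] at hf
      rw [hf, map_zero]
    rcases l with _ | l
    · simp only [pow_zero, Module.End.one_apply] at hg
      rw [hg, map_zero]
    have hfg : (f ^ (k + 1)) (g v) = 0 := by
      rw [← Module.End.mul_apply, (h.pow_left (k + 1)).eq, Module.End.mul_apply, hf, map_zero]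
    have hgf : (g ^ (l + 1)) (f v) = 0 := by
      rw [← Module.End.mul_apply, ← (h.pow_right (l + 1)).eq, Module.End.mul_apply, hg, map_zero]
    rw [pow_succ, Module.End.mul_apply, LinearMap.add_apply, map_add,
      ih k (l + 1) (f v) (by omega) (by rwa [← Module.End.mul_apply, ← pow_succ]) hgf,
      ih (k + 1) l (g v) (by omega) hfg (by rwa [← Module.End.mul_apply, ← pow_succ]), add_zero]

/-- A nilpotent matrix acts locally nilpotently on forms. -/
theorem exists_lieEnd_pow_eq_zero {N : Matrix (Fin 3) (Fin 3) ℂ} (hN : IsNilpotent N)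
    (w : Fin 3 → MvPolynomial (Fin 3) ℂ) : ∃ k, (lieEnd N ^ k) w = 0 := by
  -- the Lie derivative is the sum of the derivation of the coefficients and of the action on the
  -- differentials, which commute
  let f : Module.End ℂ (Fin 3 → MvPolynomial (Fin 3) ℂ) :=
    LinearMap.pi fun j => (linDeriv N).toLinearMap ∘ₗ LinearMap.proj j
  let g : Module.End ℂ (Fin 3 → MvPolynomial (Fin 3) ℂ) :=
    LinearMap.pi fun j => ∑ i, N i j • LinearMap.proj i
  have hf : ∀ k v j, (f ^ k) v j = (linDeriv N)^[k] (v j) := fun k v j => by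
    induction k generalizing v with
    | zero => rfl
    | succ k ih => rw [pow_succ, Module.End.mul_apply, ih, Function.iterate_succ_apply]; rfl
  have hg1 : ∀ v j, g v j = ∑ i, N i j • v i := fun v j => by simp [g]
  have hg : ∀ k v j, (g ^ k) v j = ∑ i, (N ^ k) i j • v i := fun k v j => by
    induction k generalizing v with
    | zero => simp [Matrix.one_apply]
    | succ k ih =>
      rw [pow_succ, Module.End.mul_apply, ih, pow_succ']
      simp only [hg1, Matrix.mul_apply, Fin.sum_univ_three, add_smul, smul_add, smul_smul]
      simp only [mul_comm]
      abel
  have hfg : Commute f g := by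
    refine LinearMap.ext fun v => funext fun j => ?_
    have h1 : ∀ v j, f v j = linDeriv N (v j) := fun v j => rfl
    simp only [Module.End.mul_apply, h1, hg1, map_sum, Derivation.map_smul]
  have hL : lieEnd N = f + g := by
    refine LinearMap.ext fun v => funext fun j => ?_
    simp only [LinearMap.add_apply, Pi.add_apply, hg1, smul_eq_C_mul]
    rfl
  obtain ⟨n, hn⟩ := id hN
  choose k hk using fun j => exists_linDeriv_iterate_eq_zero hN (w j)
  refine ⟨_, hL ▸ add_pow_apply_eq_zero hfg _ (k 0 + k 1 + k 2) n w rfl (funext fun j => ?_)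
    (funext fun j => ?_)⟩
  · have hz : ∀ m, (linDeriv N)^[m] 0 = 0 := fun m => Function.iterate_fixed (map_zero _) m
    have : ∀ m, k j ≤ m → (linDeriv N)^[m] (w j) = 0 := fun m hm => by
      obtain ⟨l, rfl⟩ := Nat.exists_eq_add_of_le hm
      rw [add_comm, Function.iterate_add_apply, hk, hz]
    rw [hf, this _ (by fin_cases j <;> simp <;> omega)]
    rfl
  · rw [hg, hn]
    simp

theorem X_mul_pderiv_coeff {σ : Type*} (i : σ) (m : σ →₀ ℕ) (f : MvPolynomial σ ℂ) :
    coeff m (X i * pderiv i f) = m i * coeff m f := by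
  classical
  induction f using MvPolynomial.induction_on' with
  | monomial u a =>
    rw [X_mul_pderiv_monomial, ← Nat.cast_smul_eq_nsmul ℂ, coeff_smul, coeff_monomial]
    split_ifs with h
    · simp [h]
    · simp
  | add p q hp hq => rw [map_add, mul_add, coeff_add, hp, hq, coeff_add, mul_add]

theorem coeff_linDeriv_diagonal (t : Fin 3 → ℂ) (m : Fin 3 →₀ ℕ)
    (f : MvPolynomial (Fin 3) ℂ) :
    coeff m (linDeriv (Matrix.diagonal t) f) = (∑ i, t i * m i) * coeff m f := by
  have h : linDeriv (Matrix.diagonal t) f = ∑ i, C (t i) * (X i * pderiv i f) := by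
    rw [linDeriv_apply]
    refine Finset.sum_congr rfl fun i _ => ?_
    rw [Finset.sum_eq_single i]
    · rw [Matrix.diagonal_apply_eq, mul_assoc]
    · intro j _ hj
      rw [Matrix.diagonal_apply_ne _ hj.symm, C_0, zero_mul]
    · simp
  rw [h, coeff_sum, Finset.sum_mul]
  exact Finset.sum_congr rfl fun i _ => by rw [coeff_C_mul, X_mul_pderiv_coeff, mul_assoc]

/-- A diagonal matrix acts on the monomial forms by scalars. -/
theorem coeff_lieForm_diagonal (t : Fin 3 → ℂ) (m : Fin 3 →₀ ℕ) (j : Fin 3)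
    (w : Fin 3 → MvPolynomial (Fin 3) ℂ) :
    coeff m (lieForm (Matrix.diagonal t) w j) = (∑ i, t i * m i + t j) * coeff m (w j) := by
  have h : ∑ i, C (Matrix.diagonal t i j) * w i = C (t j) * w j := by
    rw [Finset.sum_eq_single j]
    · rw [Matrix.diagonal_apply_eq]
    · intro i _ hi
      rw [Matrix.diagonal_apply_ne _ hi, C_0, zero_mul]
    · simp
  rw [lieForm, h, coeff_add, coeff_linDeriv_diagonal, add_mul, coeff_C_mul]

/-- The Lie derivative along a diagonal matrix is diagonalizable, so its kernel contains its
generalized kernel. -/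
theorem lieForm_diagonal_eq_zero_of_pow {t : Fin 3 → ℂ} {k : ℕ}
    {w : Fin 3 → MvPolynomial (Fin 3) ℂ} (h : (lieEnd (Matrix.diagonal t) ^ k) w = 0) :
    lieForm (Matrix.diagonal t) w = 0 := by
  have hk : ∀ k m j, coeff m ((lieEnd (Matrix.diagonal t) ^ k) w j) =
      (∑ i, t i * m i + t j) ^ k * coeff m (w j) := fun k m j => by
    induction k with
    | zero => simp
    | succ k ih =>
      rw [pow_succ', Module.End.mul_apply, lieEnd_apply, coeff_lieForm_diagonal, ih]
      ring
  funext j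
  ext m
  have := hk k m j
  rw [h, Pi.zero_apply, coeff_zero, eq_comm, mul_eq_zero] at this
  rw [coeff_lieForm_diagonal, Pi.zero_apply, coeff_zero]
  rcases this with h | h
  · rw [eq_zero_of_pow_eq_zero h, zero_mul]
  · rw [h, mul_zero]

theorem pullbackForm_injective (A : GL (Fin 3) ℂ) : Function.Injective (pullbackForm A.1) :=
  Function.LeftInverse.injective (g := pullbackForm A.2) fun w => by
    rw [pullbackForm_pullbackForm, A.3, pullbackForm_one]

/-- Commuting semisimple matrices are simultaneously diagonalizable. -/
theorem exists_common_diagonalization {ι : Type*} (f : ι → Matrix (Fin 3) (Fin 3) ℂ)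
    (hc : ∀ i j, Commute (f i) (f j))
    (hs : ∀ i, Module.End.IsSemisimple (Matrix.toLinAlgEquiv' (f i))) :
    ∃ A : GL (Fin 3) ℂ, ∀ i, ∃ t : Fin 3 → ℂ, f i * A.1 = A.1 * Matrix.diagonal t := by
  have htop := Module.End.iSup_iInf_maxGenEigenspace_eq_top_of_iSup_maxGenEigenspace_eq_top_of_commute
    (fun i => Matrix.toLinAlgEquiv' (f i)) (fun i j _ => (hc i j).map _)
    (fun i => Module.End.iSup_maxGenEigenspace_eq_top _)
  simp only [(hs _).isFinitelySemisimple.maxGenEigenspace_eq_eigenspace] at htop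
  rw [Submodule.iSup_eq_span] at htop
  let b := Module.Basis.ofSpan htop.ge
  have hcard : Fintype.card (Fin 3) = Nat.card
      ((linearIndepOn_empty ℂ id).extend
        (Set.empty_subset (⋃ χ : ι → ℂ, ((⨅ i,
          Module.End.eigenspace (Matrix.toLinAlgEquiv' (f i)) (χ i) :
          Submodule ℂ (Fin 3 → ℂ)) : Set (Fin 3 → ℂ))))) := by
    rw [← Module.finrank_eq_nat_card_basis b]
    simp
  have : Finite ((linearIndepOn_empty ℂ id).extend
        (Set.empty_subset (⋃ χ : ι → ℂ, ((⨅ i,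
          Module.End.eigenspace (Matrix.toLinAlgEquiv' (f i)) (χ i) :
          Submodule ℂ (Fin 3 → ℂ)) : Set (Fin 3 → ℂ))))) := Nat.finite_of_card_ne_zero (by
    rw [← hcard]; simp)
  let e := Finite.equivFinOfCardEq (hcard.symm.trans (Fintype.card_fin 3))
  let b' := b.reindex e
  have hb' : ∀ j, ∃ χ : ι → ℂ, ∀ i, (f i).mulVec (b' j) = χ i • b' j := fun j => by
    have hj : b' j ∈ Set.range b := by
      rw [Module.Basis.reindex_apply]
      exact Set.mem_range_self _
    have := Module.Basis.ofSpan_subset htop.ge hj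
    simp only [Set.mem_iUnion, SetLike.mem_coe, Submodule.mem_iInf, Module.End.mem_eigenspace_iff,
      Matrix.toLinAlgEquiv'_apply] at this
    exact this
  choose χ hχ using hb'
  have hinv := (Pi.basisFun ℂ (Fin 3)).invertibleToMatrix b'
  refine ⟨⟨(Pi.basisFun ℂ (Fin 3)).toMatrix b', ⅟ _, mul_invOf_self _, invOf_mul_self _⟩,
    fun i => ⟨fun j => χ j i, ?_⟩⟩
  ext k j
  have := congrFun (hχ j i) k
  rw [Matrix.mul_diagonal]
  simp only [Matrix.mul_apply, Module.Basis.toMatrix_apply, Pi.basisFun_repr]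
  simpa [Matrix.mulVec, dotProduct, mul_comm] using this

/-- Jordan decomposition of a matrix. -/
theorem exists_jordan_decomposition (M : Matrix (Fin 3) (Fin 3) ℂ) :
    ∃ N S : Matrix (Fin 3) (Fin 3) ℂ, IsNilpotent N ∧
      Module.End.IsSemisimple (Matrix.toLinAlgEquiv' S) ∧ Commute N S ∧ M = N + S := by
  obtain ⟨n, hn, s, hs, hnil, hss, hM⟩ :=
    Module.End.exists_isNilpotent_isSemisimple (f := Matrix.toLinAlgEquiv' M)
  refine ⟨Matrix.toLinAlgEquiv'.symm n, Matrix.toLinAlgEquiv'.symm s, hnil.map _, by simpa, ?_, ?_⟩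
  · have h : Commute n s :=
      Algebra.commute_of_mem_adjoin_singleton_of_commute hs
        (Algebra.commute_of_mem_adjoin_self hn).symm
    exact h.map _
  · rw [← map_add, ← hM, AlgEquiv.symm_apply_apply]

/-- The isotropy algebra contains the semisimple and nilpotent parts of its elements: the Lie
derivatives along these two parts are the Jordan components of the Lie derivative. -/
theorem isotropy_jordan {w : Fin 3 → MvPolynomial (Fin 3) ℂ} {N S : Matrix (Fin 3) (Fin 3) ℂ}
    (hN : IsNilpotent N) (hS : Module.End.IsSemisimple (Matrix.toLinAlgEquiv' S)) (hc : Commute N S)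
    (h : N + S ∈ isotropy w) : S ∈ isotropy w ∧ N ∈ isotropy w := by
  suffices hSw : S ∈ isotropy w from
    ⟨hSw, by simpa using (isotropy w).sub_mem h hSw⟩
  have h0 : lieEnd S w = - lieEnd N w := by
    rw [mem_isotropy, lieForm_add] at h
    exact eq_neg_of_add_eq_zero_right h
  have hpow : ∀ k, (lieEnd S ^ k) w = (-1 : ℂ) ^ k • (lieEnd N ^ k) w := fun k => by
    induction k with
    | zero => simp
    | succ k ih =>
      rw [pow_succ', Module.End.mul_apply, ih, map_smul, ← Module.End.mul_apply,
        ((commute_lieEnd hc).symm.pow_right k).eq, Module.End.mul_apply, h0, map_neg,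
        ← Module.End.mul_apply, ← pow_succ, pow_succ (-1 : ℂ)]
      simp
  -- in coordinates where `S` is diagonal, a power of its Lie derivative annihilates the form
  obtain ⟨k, hk⟩ := exists_lieEnd_pow_eq_zero hN w
  obtain ⟨A, hA⟩ := exists_common_diagonalization (fun _ : Unit => S) (fun _ _ => Commute.refl _)
    (fun _ => hS)
  obtain ⟨t, ht⟩ := hA ()
  have hpull : ∀ k, pullbackForm A.1 ((lieEnd S ^ k) w) =
      (lieEnd (Matrix.diagonal t) ^ k) (pullbackForm A.1 w) := fun k => by
    induction k with
    | zero => rfl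
    | succ k ih =>
      rw [pow_succ', Module.End.mul_apply, lieEnd_apply, pullbackForm_lieForm ht, ih, pow_succ']
      rfl
  refine pullbackForm_injective A ?_
  rw [pullbackForm_lieForm ht, pullbackForm_zero]
  refine lieForm_diagonal_eq_zero_of_pow (k := k) ?_
  rw [← hpull, hpow, hk, smul_zero, pullbackForm_zero]

/-! ### Nilpotent elements of the isotropy algebra -/

theorem X_dvd_of_forall_coeff {i : Fin 3} {f : MvPolynomial (Fin 3) ℂ}
    (h : ∀ m, coeff m f ≠ 0 → m i ≠ 0) : X i ∣ f := by
  rw [f.as_sum]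
  refine Finset.dvd_sum fun m hm => ?_
  have := h m (mem_support_iff.1 hm)
  refine ⟨monomial (m - Finsupp.single i 1) (coeff m f), ?_⟩
  rw [X, monomial_mul, one_mul, add_tsub_cancel_of_le]
  exact Finsupp.single_le_iff.2 (Nat.one_le_iff_ne_zero.2 this)

theorem NoCommonFactor.not_forall_X_dvd {w : Fin 3 → MvPolynomial (Fin 3) ℂ}
    (h : NoCommonFactor w) (i : Fin 3) : ¬ ∀ j, X i ∣ w j :=
  fun hi => (X_prime (R := ℂ) (i := i)).not_isUnit (h _ hi)

theorem NoCommonFactor.ne_zero' {w : Fin 3 → MvPolynomial (Fin 3) ℂ}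
    (h : NoCommonFactor w) : w ≠ 0 := by
  rintro rfl
  exact h.not_forall_X_dvd 0 fun j => dvd_zero _

theorem smul_one_mem_isotropy {d : ℕ} {w : Fin 3 → MvPolynomial (Fin 3) ℂ} (hw : w ∈ OneForms d)
    (h0 : w ≠ 0) {c : ℂ} (h : c • (1 : Matrix (Fin 3) (Fin 3) ℂ) ∈ isotropy w) : c = 0 := by
  rw [mem_isotropy, lieForm_smul, lieForm_one hw, smul_smul, smul_eq_zero_iff_left h0,
    mul_eq_zero] at h
  refine h.resolve_right ?_
  exact_mod_cast (Nat.succ_ne_zero (d + 1))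

/-- A foliation of degree at least two is not invariant under a two-dimensional torus. The weights
of the torus and the degree determine the monomial `x^m xⱼ` for each term `x^m dxⱼ` that occurs in
the form; its degree `d + 2` is greater than three, so some `xᵢ` divides it twice, and then `xᵢ`
divides all the coefficients. -/
theorem not_torus_le_isotropy {d : ℕ} (hd : 2 ≤ d) {w : Fin 3 → MvPolynomial (Fin 3) ℂ}
    (hw : w ∈ OneForms d) (hn : NoCommonFactor w) {s t : Fin 3 → ℂ} (hs0 : s ≠ 0)
    (hst : ∀ c : ℂ, t ≠ c • s) (hs : Matrix.diagonal s ∈ isotropy w)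
    (ht : Matrix.diagonal t ∈ isotropy w) : False := by
  -- scalar matrices do not preserve the form, so the weights are independent of the degree
  have hind : LinearIndependent ℂ ![s, t, 1] := by
    rw [Fintype.linearIndependent_iff]
    intro g hg
    simp only [Fin.sum_univ_three, Matrix.cons_val_zero, Matrix.cons_val_one,
      Matrix.cons_val] at hg
    have h2 : g 2 = 0 := by
      have : Matrix.diagonal (g 0 • s + g 1 • t + g 2 • 1) = 0 := by rw [hg]; simp
      refine smul_one_mem_isotropy hw hn.ne_zero' ?_
      have h3 : g 2 • (1 : Matrix (Fin 3) (Fin 3) ℂ) =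
          -(g 0 • Matrix.diagonal s + g 1 • Matrix.diagonal t) := by
        rw [eq_neg_iff_add_eq_zero, ← this]
        ext i j
        rcases eq_or_ne i j with rfl | hij
        · simp; ring
        · simp [hij]
      rw [h3]
      exact (isotropy w).neg_mem ((isotropy w).add_mem ((isotropy w).smul_mem _ hs)
        ((isotropy w).smul_mem _ ht))
    rw [h2, zero_smul, add_zero] at hg
    have h1 : g 1 = 0 := by
      by_contra h1
      refine hst (-(g 0 / g 1)) ?_
      funext i
      have := congrFun hg i
      simp only [Pi.add_apply, Pi.smul_apply, smul_eq_mul, Pi.zero_apply] at this ⊢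
      field_simp
      linear_combination this
    rw [h1, zero_smul, add_zero] at hg
    have h0 := (smul_eq_zero.1 hg).resolve_right hs0
    intro i
    fin_cases i <;> assumption
  have hinj := Matrix.mulVec_injective_of_isUnit
    ((Matrix.linearIndependent_rows_iff_isUnit (A := Matrix.of ![s, t, 1])).1 hind)
  have hwt : ∀ m j, coeff m (w j) ≠ 0 →
      Matrix.mulVec (Matrix.of ![s, t, 1]) (fun i => (m i : ℂ) + (Pi.single j 1 : Fin 3 → ℂ) i) =
        ![0, 0, (d : ℂ) + 2] := by
    intro m j hm
    have hdiag : ∀ r : Fin 3 → ℂ, Matrix.diagonal r ∈ isotropy w →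
        ∑ i, r i * ((m i : ℂ) + (Pi.single j 1 : Fin 3 → ℂ) i) = 0 := fun r hr => by
      have := coeff_lieForm_diagonal r m j w
      rw [mem_isotropy.1 hr, Pi.zero_apply, coeff_zero, eq_comm, mul_eq_zero] at this
      rw [← this.resolve_right hm]
      simp [mul_add, Finset.sum_add_distrib, Pi.single_apply]
    have hdeg : ∑ i, m i = d + 1 := by
      have := hw.1 j hm
      simpa [Finsupp.weight_apply, Finsupp.sum_fintype] using this
    funext i
    fin_cases i
    · simpa [Matrix.mulVec, dotProduct] using hdiag s hs
    · simpa [Matrix.mulVec, dotProduct] using hdiag t ht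
    · simp only [Matrix.mulVec, dotProduct]
      have : (∑ i, (m i : ℂ)) = d + 1 := by exact_mod_cast hdeg
      simp [Finset.sum_add_distrib, this, Pi.single_apply]
      ring
  obtain ⟨j, hj⟩ := Function.ne_iff.1 hn.ne_zero'
  obtain ⟨m, hm⟩ := ne_zero_iff.1 hj
  have hdeg : ∑ i, m i = d + 1 := by
    have := hw.1 j hm
    simpa [Finsupp.weight_apply, Finsupp.sum_fintype] using this
  obtain ⟨i, hi⟩ : ∃ i, 2 ≤ m i + (Pi.single j 1 : Fin 3 → ℕ) i := by
    by_contra! h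
    have h1 : ∑ i, (m i + (Pi.single j 1 : Fin 3 → ℕ) i) ≤ ∑ i : Fin 3, 1 :=
      Finset.sum_le_sum fun i _ => Nat.lt_succ_iff.1 (h i)
    rw [Finset.sum_add_distrib, hdeg] at h1
    simp [Pi.single_apply] at h1
    omega
  refine hn.not_forall_X_dvd i fun j' => X_dvd_of_forall_coeff fun m' hm' h0 => ?_
  have := congrFun (hinj ((hwt m j hm).trans (hwt m' j' hm').symm)) i
  have h2 : m i + (Pi.single j 1 : Fin 3 → ℕ) i = m' i + (Pi.single j' 1 : Fin 3 → ℕ) i := by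
    have hcast : ∀ k, (Pi.single k 1 : Fin 3 → ℂ) i = ((Pi.single k 1 : Fin 3 → ℕ) i : ℂ) :=
      fun k => by simp [Pi.single_apply]
    simp only [hcast] at this
    exact_mod_cast this
  rw [h2, h0] at hi
  simp only [Pi.single_apply] at hi
  split_ifs at hi <;> omega

/-- The adjoint action of a semisimple matrix is semisimple. -/
theorem isSemisimple_commutator {S : Matrix (Fin 3) (Fin 3) ℂ}
    (hS : Module.End.IsSemisimple (Matrix.toLinAlgEquiv' S)) :
    Module.End.IsSemisimple (LinearMap.mulLeft ℂ S - LinearMap.mulRight ℂ S) := by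
  have hsq := hS.minpoly_squarefree
  have h0 : Polynomial.aeval S (minpoly ℂ (Matrix.toLinAlgEquiv' S)) = 0 := by
    apply Matrix.toLinAlgEquiv'.injective
    rw [← Polynomial.aeval_algHom_apply, minpoly.aeval, map_zero]
  have hL : ∀ p : Polynomial ℂ, Polynomial.aeval (LinearMap.mulLeft ℂ S) p =
      LinearMap.mulLeft ℂ (Polynomial.aeval S p) := fun p => by
    induction p using Polynomial.induction_on' with
    | add p q hp hq => ext; simp [hp, hq, add_mul]
    | monomial n a =>
      refine LinearMap.ext fun U => ?_
      simp [Polynomial.aeval_monomial, LinearMap.pow_mulLeft, Algebra.algebraMap_eq_smul_one]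
  have hR : ∀ p : Polynomial ℂ, Polynomial.aeval (LinearMap.mulRight ℂ S) p =
      LinearMap.mulRight ℂ (Polynomial.aeval S p) := fun p => by
    induction p using Polynomial.induction_on' with
    | add p q hp hq => ext; simp [hp, hq, mul_add]
    | monomial n a =>
      refine LinearMap.ext fun U => ?_
      simp [Polynomial.aeval_monomial, LinearMap.pow_mulRight, Algebra.algebraMap_eq_smul_one]
  refine Module.End.IsSemisimple.sub_of_commute (LinearMap.commute_mulLeft_right S S) ?_ ?_
  · exact Module.End.isSemisimple_of_squarefree_aeval_eq_zero hsq (by rw [hL, h0]; ext; simp)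
  · exact Module.End.isSemisimple_of_squarefree_aeval_eq_zero hsq (by rw [hR, h0]; ext; simp)

/-- An eigenvector of `ad S` with a nonzero eigenvalue is nilpotent, since its powers are
eigenvectors for the multiples of that eigenvalue. -/
theorem isNilpotent_of_commutator_eq_smul {S T : Matrix (Fin 3) (Fin 3) ℂ} {c : ℂ} (hc : c ≠ 0)
    (h : S * T - T * S = c • T) : IsNilpotent T := by
  by_contra hT
  have hpow : ∀ k : ℕ, S * T ^ k - T ^ k * S = (k * c) • T ^ k := fun k => by
    induction k with
    | zero => simp
    | succ k ih =>
      have : S * T ^ (k + 1) - T ^ (k + 1) * S =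
          (S * T ^ k - T ^ k * S) * T + T ^ k * (S * T - T * S) := by
        rw [pow_succ]; noncomm_ring
      rw [this, ih, h, smul_mul_assoc, mul_smul_comm, ← pow_succ, ← add_smul]
      push_cast
      ring_nf
  refine Set.infinite_of_injective_forall_mem (f := fun k : ℕ => (k : ℂ) * c) (fun a b hab => ?_)
    (fun k => ?_)
    (Module.End.finite_hasEigenvalue (LinearMap.mulLeft ℂ S - LinearMap.mulRight ℂ S))
  · simpa [hc] using hab
  · refine Module.End.hasEigenvalue_of_hasEigenvector (x := T ^ k) ⟨?_, fun h0 => hT ⟨k, h0⟩⟩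
    rw [Module.End.mem_eigenspace_iff]
    exact hpow k

/-- A semisimple endomorphism vanishes on an invariant subspace where it has no nonzero
eigenvalue. -/
theorem apply_eq_zero_of_isSemisimple {V : Type*} [AddCommGroup V] [Module ℂ V]
    [FiniteDimensional ℂ V] {f : Module.End ℂ V} (hf : f.IsSemisimple) {p : Submodule ℂ V}
    (hp : ∀ v ∈ p, f v ∈ p) (h : ∀ v ∈ p, v ≠ 0 → ∀ c : ℂ, f v = c • v → c = 0) {v : V}
    (hv : v ∈ p) : f v = 0 := by
  have h0 := (hf.restrict (p := p) hp).eq_zero_iff_forall_eigenvalue.2 fun c hc => by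
    obtain ⟨u, hu⟩ := hc.exists_hasEigenvector
    exact h u.1 u.2 (fun h0 => hu.2 (Subtype.ext h0)) c (congrArg Subtype.val hu.apply_eq_smul)
  exact congrArg Subtype.val (LinearMap.congr_fun h0 ⟨v, hv⟩)

/-- If all elements of the isotropy algebra were semisimple, they would commute, because their adjoint
actions would be semisimple without nonzero eigenvalues; then the algebra would be a torus. Here and
below, the hypothesis `hdim` says that the isotropy algebra has dimension at least two. -/
theorem exists_isNilpotent_mem_isotropy {d : ℕ} (hd : 2 ≤ d)
    {w : Fin 3 → MvPolynomial (Fin 3) ℂ} (hw : w ∈ OneForms d) (hn : NoCommonFactor w)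
    (hdim : ∀ N : Matrix (Fin 3) (Fin 3) ℂ, ∃ T ∈ isotropy w, ∀ c : ℂ, T ≠ c • N) :
    ∃ N ∈ isotropy w, N ≠ 0 ∧ IsNilpotent N := by
  by_contra! h
  have hss : ∀ S ∈ isotropy w, Module.End.IsSemisimple (Matrix.toLinAlgEquiv' S) := by
    intro M hM
    obtain ⟨N, S, hN, hS, hc, rfl⟩ := exists_jordan_decomposition M
    have hN0 : N = 0 := by
      by_contra h0
      exact h N (isotropy_jordan hN hS hc hM).2 h0 hN
    simpa [hN0] using hS
  have hcomm : ∀ S ∈ isotropy w, ∀ T ∈ isotropy w, Commute S T := by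
    intro S hS T hT
    have := apply_eq_zero_of_isSemisimple (isSemisimple_commutator (hss S hS)) (p := isotropy w)
      (fun U hU => commutator_mem_isotropy hS hU)
      (fun U hU hU0 c hc => by_contra fun hc0 =>
        h U hU hU0 (isNilpotent_of_commutator_eq_smul hc0 hc)) hT
    exact sub_eq_zero.1 this
  obtain ⟨S, hS, hS0⟩ := hdim 0
  obtain ⟨T, hT, hTS⟩ := hdim S
  obtain ⟨A, hA⟩ := exists_common_diagonalization ![S, T]
    (by
      intro i j
      fin_cases i <;> fin_cases j
      exacts [hcomm S hS S hS, hcomm S hS T hT, hcomm T hT S hS, hcomm T hT T hT])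
    (by
      intro i
      fin_cases i
      exacts [hss S hS, hss T hT])
  obtain ⟨s, hs⟩ := hA 0
  obtain ⟨t, ht⟩ := hA 1
  simp only [Matrix.cons_val_zero, Matrix.cons_val_one] at hs ht
  have hcancel : ∀ M N : Matrix (Fin 3) (Fin 3) ℂ, M * A.1 = N * A.1 → M = N := fun M N h => by
    have := congrArg (· * A.2) h
    simpa [mul_assoc] using this
  refine not_torus_le_isotropy hd (pullbackForm_mem A.1 hw) (hn.pullbackForm A) (s := s) (t := t)
    ?_ ?_ (mem_isotropy_pullbackForm hs hS) (mem_isotropy_pullbackForm ht hT)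
  · rintro rfl
    refine hS0 0 (hcancel _ _ ?_)
    rw [hs]
    simp
  · rintro c rfl
    refine hTS c (hcancel _ _ ?_)
    rw [ht, smul_mul_assoc, hs]
    ext i j
    simp [Matrix.mul_diagonal]

/-- The normalizer of a nilpotent element `N` of the isotropy algebra is not reduced to `N`, because
`ad N` acts nilpotently on the quotient by `N`. -/
theorem exists_mem_isotropy_commutator_eq_smul {w : Fin 3 → MvPolynomial (Fin 3) ℂ}
    (hdim : ∀ N : Matrix (Fin 3) (Fin 3) ℂ, ∃ T ∈ isotropy w, ∀ c : ℂ, T ≠ c • N)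
    {N : Matrix (Fin 3) (Fin 3) ℂ} (hN : N ∈ isotropy w) (hnil : IsNilpotent N) :
    ∃ M ∈ isotropy w, (∀ c : ℂ, M ≠ c • N) ∧ ∃ c : ℂ, N * M - M * N = c • N := by
  obtain ⟨T, hT, hTN⟩ := hdim N
  have hnil' : IsNilpotent (LinearMap.mulLeft ℂ N - LinearMap.mulRight ℂ N) := by
    refine (LinearMap.commute_mulLeft_right N N).isNilpotent_sub ?_ ?_
    · exact (LinearMap.isNilpotent_mulLeft_iff ℂ N).2 hnil
    · exact (LinearMap.isNilpotent_mulRight_iff ℂ N).2 hnil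
  obtain ⟨n, hn⟩ := hnil'
  set f := LinearMap.mulLeft ℂ N - LinearMap.mulRight ℂ N with hf
  have hmem : ∀ k, (f ^ k) T ∈ isotropy w := fun k => by
    induction k with
    | zero => exact hT
    | succ k ih =>
      rw [pow_succ', Module.End.mul_apply]
      exact commutator_mem_isotropy hN ih
  -- the last iterate of `ad N` on `T` that is not on the line of `N` normalizes this line
  have hex : ∃ k, ∃ c : ℂ, (f ^ k) T = c • N := ⟨n, 0, by rw [hn]; simp⟩
  classical
  have h0 : Nat.find hex ≠ 0 := fun h => by
    obtain ⟨c, hc⟩ := Nat.find_spec hex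
    rw [h] at hc
    exact hTN c hc
  obtain ⟨k, hk⟩ := Nat.exists_eq_succ_of_ne_zero h0
  refine ⟨(f ^ k) T, hmem k, fun c hc => Nat.find_min hex (m := k) (by omega) ⟨c, hc⟩, ?_⟩
  obtain ⟨c, hc⟩ := Nat.find_spec hex
  refine ⟨c, ?_⟩
  rw [← hc, hk, pow_succ', Module.End.mul_apply]
  rfl

/-! ### Forms invariant under a regular nilpotent matrix -/

theorem eval_smul_of_isHomogeneous {σ : Type*} {f : MvPolynomial σ ℂ} {n : ℕ}
    (hf : f.IsHomogeneous n) (c : ℂ) (v : σ → ℂ) : eval (c • v) f = c ^ n * eval v f := by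
  simp only [MvPolynomial.eval_eq, Finset.mul_sum]
  refine Finset.sum_congr rfl fun m hm => ?_
  have hdeg : ∑ i ∈ m.support, m i = n := by
    have := hf (mem_support_iff.mp hm)
    simpa [Finsupp.weight_apply, Finsupp.sum] using this
  simp only [Pi.smul_apply, smul_eq_mul, mul_pow, Finset.prod_mul_distrib,
    Finset.prod_pow_eq_pow_sum, hdeg]
  ring

/-- A form without common factor does not vanish identically on the conic `y² = 2xz` minus the line
`x = 0`: otherwise an irreducible factor of the equation of the conic would divide all the
coefficients, by the Nullstellensatz. -/
theorem NoCommonFactor.exists_eval_conic_ne_zero {w : Fin 3 → MvPolynomial (Fin 3) ℂ}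
    (hn : NoCommonFactor w) :
    ∃ (v : Fin 3 → ℂ) (j : Fin 3), v 0 ≠ 0 ∧ v 1 ^ 2 = 2 * v 0 * v 2 ∧ eval v (w j) ≠ 0 := by
  by_contra! h
  let Q : MvPolynomial (Fin 3) ℂ := X 1 ^ 2 - C 2 * X 0 * X 2
  have hQ : ∀ v : Fin 3 → ℂ, eval v Q = v 1 ^ 2 - 2 * v 0 * v 2 := fun v => by simp [Q]
  have hQ0 : Q ≠ 0 := fun h0 => by simpa [h0] using hQ ![0, 1, 0]
  have hQu : ¬ IsUnit Q := fun hu => by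
    have := (hu.map (eval (0 : Fin 3 → ℂ))).ne_zero
    rw [hQ] at this
    simp at this
  obtain ⟨p, hp, hpQ⟩ := WfDvdMonoid.exists_irreducible_factor hQu hQ0
  have hp' := hp.prime
  have hpX : ¬ p ∣ X 0 := fun hpX => by
    have hass := hp.associated_of_dvd (X_prime (R := ℂ) (i := (0 : Fin 3))).irreducible hpX
    obtain ⟨q, hq⟩ := hass.symm.dvd.trans hpQ
    simpa [hq] using hQ ![0, 1, 0]
  refine hp.not_isUnit (hn p fun j => ?_)
  have hrad : X 0 * w j ∈ (Ideal.span {Q}).radical := by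
    rw [← vanishingIdeal_zeroLocus_eq_radical (K := ℂ)]
    intro v hv
    have hv0 : eval v Q = 0 := hv Q (Ideal.subset_span rfl)
    rw [hQ] at hv0
    simp only [map_mul, aeval_X]
    rcases eq_or_ne (v 0) 0 with h0 | h0
    · rw [h0, zero_mul]
    · have : aeval v (w j) = eval v (w j) := by simp
      rw [this, h v j h0 (by linear_combination hv0), mul_zero]
  obtain ⟨n, hn⟩ := hrad
  have := (hp'.dvd_or_dvd (hp'.dvd_of_dvd_pow (hpQ.trans (Ideal.mem_span_singleton.1 hn))))
  exact this.resolve_left hpX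

/-- A foliation of degree at least two is not invariant under the two-dimensional group generated by
a regular unipotent matrix and a torus that normalizes it. This group acts on the conic `y² = 2xz`;
the form vanishes at the point `(1, 0, 0)`, which the torus fixes, because of its weight, hence along
the whole conic by invariance under the unipotent elements. -/
theorem not_affine_le_isotropy {d : ℕ} (hd : 2 ≤ d) {w : Fin 3 → MvPolynomial (Fin 3) ℂ}
    (hw : w ∈ OneForms d) (hn : NoCommonFactor w)
    (hN : !![0, 0, 0; 1, 0, 0; 0, 1, 0] ∈ isotropy w) {s c : ℂ} (hc : c ≠ 0)
    (hS : Matrix.diagonal ![s, s - c, s - 2 * c] ∈ isotropy w) : False := by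
  have hdeg : ∀ j m, coeff m (w j) ≠ 0 → m 0 + m 1 + m 2 = d + 1 := fun j m hm => by
    have := hw.1 j hm
    simpa [Finsupp.weight_apply, Finsupp.sum_fintype, Fin.sum_univ_three] using this
  have hwt : ∀ j m, coeff m (w j) ≠ 0 →
      s * (d + 2) = c * ((m 1 + 2 * m 2 + j : ℕ) : ℂ) := fun j m hm => by
    have := coeff_lieForm_diagonal ![s, s - c, s - 2 * c] m j w
    rw [mem_isotropy.1 hS, Pi.zero_apply, coeff_zero, eq_comm, mul_eq_zero] at this
    have h1 := this.resolve_right hm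
    have h2 : ((m 0 + m 1 + m 2 : ℕ) : ℂ) = ((d + 1 : ℕ) : ℂ) := by rw [hdeg j m hm]
    simp only [Fin.sum_univ_three, Matrix.cons_val_zero, Matrix.cons_val_one,
      Matrix.cons_val] at h1
    push_cast at h2 ⊢
    fin_cases j <;> simp at h1 ⊢ <;> linear_combination h1 - s * h2
  -- all terms of the form have the same weight, and one of them does not involve `x`
  have hwt3 : ∀ j m, coeff m (w j) ≠ 0 → 3 ≤ m 1 + 2 * m 2 + (j : ℕ) := by
    have h0 := hn.not_forall_X_dvd 0
    push Not at h0
    obtain ⟨j₀, hj₀⟩ := h0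
    obtain ⟨m₀, hm₀, h0⟩ : ∃ m, coeff m (w j₀) ≠ 0 ∧ m 0 = 0 := by
      by_contra! h
      exact hj₀ (X_dvd_of_forall_coeff h)
    intro j m hm
    have h1 : m 1 + 2 * m 2 + (j : ℕ) = m₀ 1 + 2 * m₀ 2 + (j₀ : ℕ) := by
      have := (hwt j m hm).symm.trans (hwt j₀ m₀ hm₀)
      exact_mod_cast mul_left_cancel₀ hc this
    have h2 := hdeg j₀ m₀ hm₀
    omega
  have h100 : ∀ j, eval ![1, 0, 0] (w j) = 0 := fun j => by
    rw [MvPolynomial.eval_eq']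
    refine Finset.sum_eq_zero fun m hm => ?_
    have := hwt3 j m (mem_support_iff.1 hm)
    simp only [Fin.prod_univ_three, Matrix.cons_val_zero, Matrix.cons_val_one, Matrix.cons_val]
    have : m 1 ≠ 0 ∨ m 2 ≠ 0 := by omega
    rcases this with h | h <;> simp [h]
  -- restriction of polynomials to the orbit of `(1, 0, 0)` under the one-parameter group of `N`
  let φ : MvPolynomial (Fin 3) ℂ →ₐ[ℂ] Polynomial ℂ :=
    aeval ![1, Polynomial.X, Polynomial.C (1 / 2) * Polynomial.X ^ 2]
  have hφ : ∀ t f, (φ f).eval t = eval ![1, t, 1 / 2 * t ^ 2] f := fun t f => by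
    have : (Polynomial.evalRingHom t).comp φ.toRingHom = eval ![1, t, 1 / 2 * t ^ 2] := by
      refine ringHom_ext (fun r => by simp [φ]) fun i => ?_
      fin_cases i <;> simp [φ]
    exact RingHom.congr_fun this f
  have hder : ∀ f, Polynomial.derivative (φ f) =
      φ (linDeriv !![0, 0, 0; 1, 0, 0; 0, 1, 0] f) := fun f => by
    induction f using MvPolynomial.induction_on with
    | C a => simp [φ]
    | add p q hp hq => simp only [map_add, hp, hq]
    | mul_X p i hp =>
      have hX : Polynomial.derivative (φ (X i)) =
          φ (linDeriv !![0, 0, 0; 1, 0, 0; 0, 1, 0] (X i)) := by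
        have e : (Polynomial.C (2⁻¹ : ℂ)) * 2 = 1 := by
          rw [← Polynomial.C_ofNat, ← Polynomial.C_mul]
          norm_num
        fin_cases i
        · simp [φ, Fin.sum_univ_three]
        · simp [φ, Fin.sum_univ_three]
        · simp [φ, Fin.sum_univ_three]
          linear_combination Polynomial.X * e
      rw [linDeriv_mul, map_mul, Polynomial.derivative_mul, hp, hX, map_add, map_mul, map_mul]
  -- along this orbit the invariance of the form is a linear differential equation
  have hzero : ∀ f : Polynomial ℂ, Polynomial.derivative f = 0 → f.eval 0 = 0 → f = 0 :=
    fun f h1 h2 => by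
      rw [Polynomial.eq_C_of_derivative_eq_zero h1] at h2 ⊢
      rw [Polynomial.eval_C] at h2
      rw [h2, Polynomial.C_0]
  have hinit : ∀ j, (φ (w j)).eval 0 = 0 := fun j => by
    rw [hφ]
    simpa using h100 j
  have hL : ∀ j, linDeriv !![0, 0, 0; 1, 0, 0; 0, 1, 0] (w j) +
      ∑ i, C ((!![0, 0, 0; 1, 0, 0; 0, 1, 0] : Matrix (Fin 3) (Fin 3) ℂ) i j) * w i = 0 :=
    fun j => congrFun (mem_isotropy.1 hN) j
  have h2 : φ (w 2) = 0 := hzero _ (by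
    have := hL 2
    simp [Fin.sum_univ_three] at this
    rw [hder, this, map_zero]) (hinit 2)
  have h1 : φ (w 1) = 0 := hzero _ (by
    have := hL 1
    simp [Fin.sum_univ_three] at this
    rw [hder, eq_neg_of_add_eq_zero_left this, map_neg, h2, neg_zero]) (hinit 1)
  have h0 : φ (w 0) = 0 := hzero _ (by
    have := hL 0
    simp [Fin.sum_univ_three] at this
    rw [hder, eq_neg_of_add_eq_zero_left this, map_neg, h1, neg_zero]) (hinit 0)
  obtain ⟨v, j, hv0, hv, hj⟩ := hn.exists_eval_conic_ne_zero
  refine hj ?_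
  have hvt : v = v 0 • ![1, v 1 / v 0, 1 / 2 * (v 1 / v 0) ^ 2] := by
    funext i
    fin_cases i
    · simp
    · simp; field_simp
    · simp; field_simp; linear_combination -hv
  have hj0 : φ (w j) = 0 := by fin_cases j <;> assumption
  rw [hvt, eval_smul_of_isHomogeneous (hw.1 j), ← hφ, hj0, Polynomial.eval_zero, mul_zero]

theorem pow_three_eq_zero_of_isNilpotent {N : Matrix (Fin 3) (Fin 3) ℂ} (h : IsNilpotent N) :
    N ^ 3 = 0 := by
  have h1 : IsNilpotent (Matrix.toLinAlgEquiv' N) := h.map _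
  have h2 := LinearMap.aeval_self_charpoly (Matrix.toLinAlgEquiv' N)
  rw [(LinearMap.isNilpotent_iff_charpoly _).1 h1] at h2
  apply Matrix.toLinAlgEquiv'.injective
  simpa using h2

theorem exists_GL_of_forall_mulVec {A : Matrix (Fin 3) (Fin 3) ℂ}
    (h : ∀ v, A.mulVec v = 0 → v = 0) : ∃ B : GL (Fin 3) ℂ, B.1 = A := by
  have : IsUnit A := by
    rw [← Matrix.mulVec_injective_iff_isUnit]
    intro v v' hv
    refine sub_eq_zero.1 (h _ ?_)
    rw [Matrix.mulVec_sub]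
    exact sub_eq_zero.2 hv
  exact ⟨this.unit, this.unit_spec⟩

/-- The Jordan form of a regular nilpotent matrix, in a basis `v, N v, N² v`. -/
theorem exists_conj_of_sq_ne_zero {N : Matrix (Fin 3) (Fin 3) ℂ} (h3 : N ^ 3 = 0)
    (h2 : N ^ 2 ≠ 0) : ∃ A : GL (Fin 3) ℂ, N * A.1 = A.1 * !![0, 0, 0; 1, 0, 0; 0, 1, 0] := by
  obtain ⟨v, hv⟩ : ∃ v, (N ^ 2).mulVec v ≠ 0 := by
    by_contra! h
    exact h2 (Matrix.ext_of_mulVec_single fun i => by rw [h, Matrix.zero_mulVec])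
  have h3v : ∀ u, N.mulVec (N.mulVec (N.mulVec u)) = 0 := fun u => by
    rw [Matrix.mulVec_mulVec, Matrix.mulVec_mulVec, ← pow_three', h3, Matrix.zero_mulVec]
  rw [pow_two, ← Matrix.mulVec_mulVec] at hv
  let A : Matrix (Fin 3) (Fin 3) ℂ :=
    Matrix.of fun i j => ![v, N.mulVec v, N.mulVec (N.mulVec v)] j i
  have hA : ∀ u, A.mulVec u = u 0 • v + u 1 • N.mulVec v + u 2 • N.mulVec (N.mulVec v) := fun u => by
    funext i
    simp [A, Matrix.mulVec, dotProduct, Fin.sum_univ_three]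
    ring
  obtain ⟨B, hB⟩ := exists_GL_of_forall_mulVec (A := A) fun u hu => by
    rw [hA] at hu
    have e0 := congrArg (fun x => N.mulVec (N.mulVec x)) hu
    simp only [Matrix.mulVec_add, Matrix.mulVec_smul, h3v, Matrix.mulVec_zero, smul_zero,
      add_zero] at e0
    have u0 := (smul_eq_zero.1 e0).resolve_right hv
    rw [u0, zero_smul, zero_add] at hu
    have e1 := congrArg N.mulVec hu
    simp only [Matrix.mulVec_add, Matrix.mulVec_smul, h3v, Matrix.mulVec_zero, smul_zero,
      add_zero] at e1
    have u1 := (smul_eq_zero.1 e1).resolve_right hv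
    rw [u1, zero_smul, zero_add] at hu
    have u2 := (smul_eq_zero.1 hu).resolve_right hv
    funext i
    fin_cases i <;> assumption
  refine ⟨B, ?_⟩
  rw [hB]
  ext i j
  have e : ∀ u : Fin 3 → ℂ, ∑ k, N i k * u k = N.mulVec u i := fun u => rfl
  rw [Matrix.mul_apply, e (fun k => A k j)]
  fin_cases j
  · simp [A, Matrix.mul_apply, Fin.sum_univ_three]
  · simp [A, Matrix.mul_apply, Fin.sum_univ_three]
  · have := congrFun (h3v v) i
    simpa [A, Matrix.mul_apply, Fin.sum_univ_three] using this

/-- The Jordan form of a nilpotent matrix of rank one, in a basis `v, x, N v` with `N x = 0`. -/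
theorem exists_conj_of_sq_eq_zero {N : Matrix (Fin 3) (Fin 3) ℂ} (h2 : N ^ 2 = 0)
    (h1 : N ≠ 0) : ∃ A : GL (Fin 3) ℂ, N * A.1 = A.1 * !![0, 0, 0; 0, 0, 0; 1, 0, 0] := by
  obtain ⟨v, hv⟩ : ∃ v, N.mulVec v ≠ 0 := by
    by_contra! h
    exact h1 (Matrix.ext_of_mulVec_single fun i => by rw [h, Matrix.zero_mulVec])
  have h2v : ∀ u, N.mulVec (N.mulVec u) = 0 := fun u => by
    rw [Matrix.mulVec_mulVec, ← pow_two, h2, Matrix.zero_mulVec]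
  -- the kernel of `N` has dimension two since it contains the image
  obtain ⟨x, hx, hxv⟩ : ∃ x, N.mulVec x = 0 ∧ x ∉ Submodule.span ℂ {N.mulVec v} := by
    by_contra! h
    have hle : LinearMap.ker (Matrix.toLin' N) ≤ Submodule.span ℂ {N.mulVec v} := fun x hx =>
      h x (by simpa using hx)
    have hr : LinearMap.range (Matrix.toLin' N) ≤ LinearMap.ker (Matrix.toLin' N) := by
      rintro _ ⟨x, rfl⟩
      simpa using h2v x
    have e1 := (Matrix.toLin' N).finrank_range_add_finrank_ker
    have e2 := Submodule.finrank_mono hle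
    have e3 := Submodule.finrank_mono hr
    have e4 := finrank_span_singleton (K := ℂ) hv
    simp only [Module.finrank_fin_fun] at e1
    omega
  let A : Matrix (Fin 3) (Fin 3) ℂ := Matrix.of fun i j => ![v, x, N.mulVec v] j i
  have hA : ∀ u, A.mulVec u = u 0 • v + u 1 • x + u 2 • N.mulVec v := fun u => by
    funext i
    simp [A, Matrix.mulVec, dotProduct, Fin.sum_univ_three]
    ring
  obtain ⟨B, hB⟩ := exists_GL_of_forall_mulVec (A := A) fun u hu => by
    rw [hA] at hu
    have e0 := congrArg N.mulVec hu
    simp only [Matrix.mulVec_add, Matrix.mulVec_smul, h2v, hx, Matrix.mulVec_zero, smul_zero,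
      add_zero] at e0
    have u0 := (smul_eq_zero.1 e0).resolve_right hv
    rw [u0, zero_smul, zero_add] at hu
    have u1 : u 1 = 0 := by
      by_contra h
      refine hxv (Submodule.mem_span_singleton.2 ⟨-(u 2 / u 1), ?_⟩)
      funext i
      have := congrFun hu i
      simp only [Pi.add_apply, Pi.smul_apply, smul_eq_mul, Pi.zero_apply] at this ⊢
      field_simp
      linear_combination -this
    rw [u1, zero_smul, zero_add] at hu
    have u2 := (smul_eq_zero.1 hu).resolve_right hv
    funext i
    fin_cases i <;> assumption
  refine ⟨B, ?_⟩
  rw [hB]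
  ext i j
  have e : ∀ u : Fin 3 → ℂ, ∑ k, N i k * u k = N.mulVec u i := fun u => rfl
  rw [Matrix.mul_apply, e (fun k => A k j)]
  fin_cases j
  · simp [A, Matrix.mul_apply, Fin.sum_univ_three]
  · have := congrFun hx i
    simpa [A, Matrix.mul_apply, Fin.sum_univ_three] using this
  · have := congrFun (h2v v) i
    simpa [A, Matrix.mul_apply, Fin.sum_univ_three] using this

/-! ### Forms invariant under a nilpotent matrix of rank one -/

/-- The form `w` is a pullback of `form₁ d` or `form₂ d` by a linear automorphism. -/
def IsStandard (d : ℕ) (w : Fin 3 → MvPolynomial (Fin 3) ℂ) : Prop :=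
  ∃ A : GL (Fin 3) ℂ, pullbackForm A.1 (form₁ d) = w ∨ pullbackForm A.1 (form₂ d) = w

theorem IsStandard.of_pullbackForm {d : ℕ} {w : Fin 3 → MvPolynomial (Fin 3) ℂ}
    {B : GL (Fin 3) ℂ} (h : IsStandard d (pullbackForm B.1 w)) : IsStandard d w := by
  obtain ⟨A, hA⟩ := h
  refine ⟨A * B⁻¹, hA.imp (fun h => ?_) fun h => ?_⟩ <;>
  · rw [Units.val_mul, ← pullbackForm_pullbackForm, h, pullbackForm_pullbackForm, Units.mul_inv,
      pullbackForm_one]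

/-- A homogeneous polynomial of positive degree does not divide all the coefficients. -/
theorem NoCommonFactor.not_forall_dvd {w : Fin 3 → MvPolynomial (Fin 3) ℂ} {n : ℕ} (hn0 : n ≠ 0)
    (h : NoCommonFactor w) {g : MvPolynomial (Fin 3) ℂ} (hg : g.IsHomogeneous n) :
    ¬ ∀ j, g ∣ w j := fun hd => by
  have h1 := ((h g hd).map (eval (0 : Fin 3 → ℂ))).ne_zero
  have h2 := eval_smul_of_isHomogeneous hg 0 (0 : Fin 3 → ℂ)
  rw [zero_smul, zero_pow hn0, zero_mul] at h2
  exact h1 h2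

/-- The form `p (x dy - y dx) + q (x dz - z dx)`. -/
noncomputable def pencilForm (p q : MvPolynomial (Fin 3) ℂ) : Fin 3 → MvPolynomial (Fin 3) ℂ :=
  ![-(X 1 * p) - X 2 * q, X 0 * p, X 0 * q]

theorem dvd_pencilForm {g p q : MvPolynomial (Fin 3) ℂ} (hp : g ∣ p) (hq : g ∣ q) (j : Fin 3) :
    g ∣ pencilForm p q j := by
  fin_cases j
  · exact dvd_sub ((hp.mul_left _).neg_right) (hq.mul_left _)
  · exact hp.mul_left _
  · exact hq.mul_left _

theorem isHomogeneous_of_X_mul {i : Fin 3} {f : MvPolynomial (Fin 3) ℂ} {n : ℕ}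
    (h : (X i * f).IsHomogeneous (n + 1)) : f.IsHomogeneous n := by
  intro m hm
  have h1 : coeff (Finsupp.single i 1 + m) (X i * f) ≠ 0 := by rwa [coeff_X_mul]
  have := h h1
  rw [map_add] at this
  simp only [Finsupp.weight_apply, Finsupp.sum_fintype, implies_true,
    Pi.one_apply, smul_eq_mul, mul_one, Fin.sum_univ_three] at this ⊢
  have hs : (Finsupp.single i 1 : Fin 3 →₀ ℕ) 0 + (Finsupp.single i 1 : Fin 3 →₀ ℕ) 1 +
      (Finsupp.single i 1 : Fin 3 →₀ ℕ) 2 = 1 := by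
    fin_cases i <;> simp
  omega

theorem linDeriv_single_two_zero (f : MvPolynomial (Fin 3) ℂ) :
    linDeriv !![0, 0, 0; 0, 0, 0; 1, 0, 0] f = X 0 * pderiv 2 f := by
  rw [linDeriv_apply, Fin.sum_univ_three (f := fun i =>
    (∑ j, C ((!![0, 0, 0; 0, 0, 0; 1, 0, 0] : Matrix (Fin 3) (Fin 3) ℂ) i j) * X j) * pderiv i f)]
  simp [Fin.sum_univ_three]

/-- The forms invariant under `z ↦ z + t x` are the forms `p (x dy - y dx) + q (x dz - z dx)` with
`p` and `q` independent of `z`. -/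
theorem exists_eq_pencilForm {d : ℕ} {w : Fin 3 → MvPolynomial (Fin 3) ℂ} (hw : w ∈ OneForms d)
    (hN : !![0, 0, 0; 0, 0, 0; 1, 0, 0] ∈ isotropy w) :
    ∃ p q : MvPolynomial (Fin 3) ℂ, p.IsHomogeneous d ∧ q.IsHomogeneous d ∧ pderiv 2 p = 0 ∧
      pderiv 2 q = 0 ∧ w = pencilForm p q := by
  have hX0 : (X 0 : MvPolynomial (Fin 3) ℂ) ≠ 0 := X_ne_zero 0
  have hL : ∀ j, X 0 * pderiv 2 (w j) +
      ∑ i, C ((!![0, 0, 0; 0, 0, 0; 1, 0, 0] : Matrix (Fin 3) (Fin 3) ℂ) i j) * w i = 0 :=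
    fun j => by
      rw [← linDeriv_single_two_zero]
      exact congrFun (mem_isotropy.1 hN) j
  have h0 := hL 0
  have h1 := hL 1
  have h2 := hL 2
  simp [Fin.sum_univ_three] at h0 h1 h2
  have he := hw.2
  rw [Fin.sum_univ_three (f := fun i => X i * w i)] at he
  have hw2 : w 2 = X 0 * -pderiv 2 (w 0) := by linear_combination h0
  have hdvd : X 0 ∣ w 1 := by
    have : (X 0 : MvPolynomial (Fin 3) ℂ) ∣ X 1 * w 1 :=
      ⟨-w 0 + X 2 * pderiv 2 (w 0), by linear_combination he - X 2 * hw2⟩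
    refine ((X_prime (R := ℂ) (i := (0 : Fin 3))).dvd_or_dvd this).resolve_left fun h => ?_
    obtain ⟨g, hg⟩ := h
    simpa using congrArg (eval ![0, 1, 0]) hg
  obtain ⟨p, hp⟩ := hdvd
  have hpd : pderiv 2 p = 0 := by
    rw [hp, pderiv_mul, pderiv_X_of_ne (by decide), zero_mul, zero_add] at h1
    exact (mul_eq_zero.1 h1).resolve_left hX0
  have hqd : pderiv 2 (-pderiv 2 (w 0)) = 0 := by
    rw [hw2, pderiv_mul, pderiv_X_of_ne (by decide), zero_mul, zero_add] at h2
    exact (mul_eq_zero.1 h2).resolve_left hX0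
  refine ⟨p, -pderiv 2 (w 0), isHomogeneous_of_X_mul (i := 0) (hp ▸ hw.1 1),
    isHomogeneous_of_X_mul (i := 0) (hw2 ▸ hw.1 2), hpd, hqd, funext fun j => ?_⟩
  fin_cases j
  · refine mul_left_cancel₀ hX0 ?_
    simp only [pencilForm, Fin.zero_eta, Matrix.cons_val_zero]
    linear_combination he - X 1 * hp - X 2 * hw2
  · exact hp
  · exact hw2

theorem linDeriv_of_pderiv_two_eq_zero {M : Matrix (Fin 3) (Fin 3) ℂ} (h01 : M 0 1 = 0)
    (h02 : M 0 2 = 0) (h12 : M 1 2 = 0) {f : MvPolynomial (Fin 3) ℂ} (hf : pderiv 2 f = 0) :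
    linDeriv M f = C (M 0 0) * (X 0 * pderiv 0 f) + C (M 1 0) * (X 0 * pderiv 1 f) +
      C (M 1 1) * (X 1 * pderiv 1 f) := by
  rw [linDeriv_apply,
    Fin.sum_univ_three (f := fun i => (∑ j, C (M i j) * X j) * pderiv i f), hf]
  simp only [Fin.sum_univ_three, h01, h02, h12, C_0]
  ring

/-- The equations expressing that a lower triangular matrix preserves the form
`p (x dy - y dx) + q (x dz - z dx)`. -/
theorem linDeriv_of_mem_isotropy_pencilForm {M : Matrix (Fin 3) (Fin 3) ℂ} (h01 : M 0 1 = 0)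
    (h02 : M 0 2 = 0) (h12 : M 1 2 = 0) {p q : MvPolynomial (Fin 3) ℂ}
    (hM : M ∈ isotropy (pencilForm p q)) :
    linDeriv M p + C (M 0 0 + M 1 1) * p + C (M 2 1) * q = 0 ∧
      linDeriv M q + C (M 0 0 + M 2 2) * q = 0 := by
  have hX0 : (X 0 : MvPolynomial (Fin 3) ℂ) ≠ 0 := X_ne_zero 0
  have hX : linDeriv M (X 0) = C (M 0 0) * X 0 := by simp [Fin.sum_univ_three, h01, h02]
  constructor
  · have h1 : linDeriv M (X 0 * p) + ∑ i, C (M i 1) * pencilForm p q i = 0 :=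
      congrFun (mem_isotropy.1 hM) 1
    simp only [Fin.sum_univ_three, h01, linDeriv_mul, hX, pencilForm, Matrix.cons_val_zero,
      Matrix.cons_val_one, Matrix.cons_val, C_0, zero_mul] at h1
    refine mul_left_cancel₀ hX0 ?_
    rw [C_add]
    linear_combination h1
  · have h1 : linDeriv M (X 0 * q) + ∑ i, C (M i 2) * pencilForm p q i = 0 :=
      congrFun (mem_isotropy.1 hM) 2
    simp only [Fin.sum_univ_three, h02, h12, linDeriv_mul, hX, pencilForm, Matrix.cons_val_zero,
      Matrix.cons_val_one, Matrix.cons_val, C_0, zero_mul] at h1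
    refine mul_left_cancel₀ hX0 ?_
    rw [C_add]
    linear_combination h1

theorem support_of_pderiv_two_eq_zero {d : ℕ} {f : MvPolynomial (Fin 3) ℂ}
    (hf : f.IsHomogeneous d) (h2 : pderiv 2 f = 0) {m : Fin 3 →₀ ℕ} (hm : coeff m f ≠ 0) :
    m 2 = 0 ∧ m 0 + m 1 = d := by
  have h0 : m 2 = 0 := by
    have := X_mul_pderiv_coeff 2 m f
    rw [h2, mul_zero, coeff_zero, eq_comm, mul_eq_zero] at this
    exact_mod_cast this.resolve_right hm
  have h1 := hf hm
  simp [Finsupp.weight_apply, Finsupp.sum_fintype, Fin.sum_univ_three, h0] at h1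
  exact ⟨h0, h1⟩

theorem eq_monomial_of_support {d : ℕ} {f : MvPolynomial (Fin 3) ℂ}
    (h : ∀ m, coeff m f ≠ 0 → m 2 = 0 ∧ m 0 + m 1 = d)
    (h' : ∀ m n, coeff m f ≠ 0 → coeff n f ≠ 0 → m 0 = n 0) :
    ∃ i ≤ d, ∃ c : ℂ, f = C c * (X 0 ^ i * X 1 ^ (d - i)) := by
  rcases eq_or_ne f 0 with rfl | hf
  · exact ⟨0, Nat.zero_le d, 0, by simp⟩
  obtain ⟨m, hm⟩ := ne_zero_iff.1 hf
  have hms := h m hm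
  refine ⟨m 0, by omega, coeff m f, ?_⟩
  have h1 : f = monomial m (coeff m f) := by
    ext n
    rw [coeff_monomial]
    split_ifs with hmn
    · rw [hmn]
    · by_contra hn
      refine hmn (Finsupp.ext fun k => ?_)
      have e1 := h' m n hm hn
      have e2 := h n hn
      fin_cases k <;> simp <;> omega
  conv_lhs => rw [h1, monomial_eq]
  rw [Finsupp.prod_fintype _ _ (fun _ => pow_zero _), Fin.prod_univ_three, hms.1, pow_zero, mul_one,
    show d - m 0 = m 1 by omega]

theorem isHomogeneous_X_pow_mul_X_pow {d i : ℕ} (hi : i ≤ d) :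
    (X 0 ^ i * X 1 ^ (d - i) : MvPolynomial (Fin 3) ℂ).IsHomogeneous d := by
  have := ((isHomogeneous_X ℂ (0 : Fin 3)).pow i).mul ((isHomogeneous_X ℂ (1 : Fin 3)).pow (d - i))
  simpa [Nat.add_sub_cancel' hi] using this

/-- These forms are pullbacks of `form₁ d`. -/
theorem isStandard_pencilForm_left {d : ℕ} {a b c : ℂ} (hb : b ≠ 0) (hc : c ≠ 0) :
    IsStandard d (pencilForm (C a * X 1 ^ d + C b * X 0 ^ d) (C c * X 1 ^ d)) := by
  let A : Matrix (Fin 3) (Fin 3) ℂ := !![1, 0, 0; 0, b, 0; 0, -(a / b ^ d), -(c / b ^ d)]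
  have hA : IsUnit A := by
    rw [Matrix.isUnit_iff_isUnit_det, Matrix.det_fin_three]
    simp [A, hb, hc]
  have ha' : (C (a / b ^ d) : MvPolynomial (Fin 3) ℂ) * C b ^ d = C a := by
    rw [← C_pow, ← C_mul, div_mul_cancel₀ _ (pow_ne_zero d hb)]
  have hc' : (C (c / b ^ d) : MvPolynomial (Fin 3) ℂ) * C b ^ d = C c := by
    rw [← C_pow, ← C_mul, div_mul_cancel₀ _ (pow_ne_zero d hb)]
  refine ⟨hA.unit, Or.inl (funext fun j => ?_)⟩
  rw [hA.unit_spec]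
  have h0 : subst A (X 0) = X 0 := by simp [subst, A, Fin.sum_univ_three]
  have h1 : subst A (X 1) = C b * X 1 := by simp [subst, A, Fin.sum_univ_three]
  have h2 : subst A (X 2) = -(C (a / b ^ d) * X 1) - C (c / b ^ d) * X 2 := by
    simp [subst, A, Fin.sum_univ_three]
    ring
  fin_cases j <;> simp only [pullbackForm, Fin.sum_univ_three, form₁, pencilForm, Fin.zero_eta,
    Fin.mk_one, Fin.reduceFinMk, Matrix.cons_val_zero, Matrix.cons_val_one, Matrix.cons_val, map_sub,
    map_mul, map_pow, map_neg, h0, h1, h2] <;> simp [A]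
  · linear_combination -(X 1 * X 1 ^ d) * ha' - (X 2 * X 1 ^ d) * hc'
  · linear_combination X 0 * X 1 ^ d * ha'
  · linear_combination X 0 * X 1 ^ d * hc'

/-- These forms are pullbacks of `form₂ d`. -/
theorem isStandard_pencilForm_right {d : ℕ} {a b c : ℂ} (hb : b ≠ 0) (hc : c ≠ 0) :
    IsStandard d (pencilForm (C a * X 0 ^ d + C b * X 1 ^ d) (C c * X 0 ^ d)) := by
  let A : Matrix (Fin 3) (Fin 3) ℂ :=
    !![b, 0, 0; 0, 1, 0; 0, -(a / b ^ (d + 1)), -(c / b ^ (d + 1))]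
  have hA : IsUnit A := by
    rw [Matrix.isUnit_iff_isUnit_det, Matrix.det_fin_three]
    simp [A, hb, hc]
  have ha' : (C (a / b ^ (d + 1)) : MvPolynomial (Fin 3) ℂ) * C b ^ (d + 1) = C a := by
    rw [← C_pow, ← C_mul, div_mul_cancel₀ _ (pow_ne_zero _ hb)]
  have hc' : (C (c / b ^ (d + 1)) : MvPolynomial (Fin 3) ℂ) * C b ^ (d + 1) = C c := by
    rw [← C_pow, ← C_mul, div_mul_cancel₀ _ (pow_ne_zero _ hb)]
  refine ⟨hA.unit, Or.inr (funext fun j => ?_)⟩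
  rw [hA.unit_spec]
  have h0 : subst A (X 0) = C b * X 0 := by simp [subst, A, Fin.sum_univ_three]
  have h1 : subst A (X 1) = X 1 := by simp [subst, A, Fin.sum_univ_three]
  have h2 : subst A (X 2) = -(C (a / b ^ (d + 1)) * X 1) - C (c / b ^ (d + 1)) * X 2 := by
    simp [subst, A, Fin.sum_univ_three]
    ring
  fin_cases j <;> simp only [pullbackForm, Fin.sum_univ_three, form₂, pencilForm, Fin.zero_eta,
    Fin.mk_one, Fin.reduceFinMk, Matrix.cons_val_zero, Matrix.cons_val_one, Matrix.cons_val, map_sub,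
    map_mul, map_pow, map_neg, h0, h1, h2] <;> simp [A]
  · linear_combination -(X 1 * X 0 ^ d) * ha' - (X 2 * X 0 ^ d) * hc'
  · linear_combination X 0 * X 0 ^ d * ha'
  · linear_combination X 0 * X 0 ^ d * hc'

/-- If the form `p (x dy - y dx) + q (x dz - z dx)` is preserved by a lower triangular matrix that
acts on `x` and `y` by distinct eigenvalues, then `q` is a monomial and `p` is the sum of a multiple
of `q` and of a monomial; these monomials are `x^d` and `y^d` in some order, since there is no common
factor. -/
theorem isStandard_of_diagonal {d : ℕ} (hd : 2 ≤ d) {p q : MvPolynomial (Fin 3) ℂ}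
    (hp : p.IsHomogeneous d) (hq : q.IsHomogeneous d) (hp2 : pderiv 2 p = 0)
    (hq2 : pderiv 2 q = 0) (hn : NoCommonFactor (pencilForm p q))
    {M : Matrix (Fin 3) (Fin 3) ℂ} (h01 : M 0 1 = 0) (h02 : M 0 2 = 0) (h12 : M 1 2 = 0)
    (h10 : M 1 0 = 0) (h : M 0 0 ≠ M 1 1) (hM : M ∈ isotropy (pencilForm p q)) :
    IsStandard d (pencilForm p q) := by
  obtain ⟨hMp, hMq⟩ := linDeriv_of_mem_isotropy_pencilForm h01 h02 h12 hM
  rw [linDeriv_of_pderiv_two_eq_zero h01 h02 h12 hp2, h10, C_0, zero_mul, add_zero] at hMp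
  rw [linDeriv_of_pderiv_two_eq_zero h01 h02 h12 hq2, h10, C_0, zero_mul, add_zero] at hMq
  have hcp : ∀ m, (M 0 0 * m 0 + M 1 1 * m 1 + (M 0 0 + M 1 1)) * coeff m p +
      M 2 1 * coeff m q = 0 := fun m => by
    have := congrArg (coeff m) hMp
    simp only [coeff_add, coeff_C_mul, X_mul_pderiv_coeff, coeff_zero] at this
    linear_combination this
  have hcq : ∀ m, (M 0 0 * m 0 + M 1 1 * m 1 + (M 0 0 + M 2 2)) * coeff m q = 0 := fun m => by
    have := congrArg (coeff m) hMq
    simp only [coeff_add, coeff_C_mul, X_mul_pderiv_coeff, coeff_zero] at this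
    linear_combination this
  -- distinct monomials have distinct weights
  have hwt : ∀ m n : Fin 3 →₀ ℕ, m 0 + m 1 = d → n 0 + n 1 = d → ∀ c : ℂ,
      M 0 0 * m 0 + M 1 1 * m 1 + c = 0 → M 0 0 * n 0 + M 1 1 * n 1 + c = 0 → m 0 = n 0 := by
    intro m n hm hn c h1 h2
    have hm' : (m 0 : ℂ) + m 1 = d := by exact_mod_cast hm
    have hn' : (n 0 : ℂ) + n 1 = d := by exact_mod_cast hn
    have : (M 0 0 - M 1 1) * ((m 0 : ℂ) - n 0) = 0 := by
      linear_combination h1 - h2 - M 1 1 * (hm' - hn')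
    exact_mod_cast sub_eq_zero.1 ((mul_eq_zero.1 this).resolve_left (sub_ne_zero.2 h))
  have hsp := fun m => support_of_pderiv_two_eq_zero (m := m) hp hp2
  have hsq := fun m => support_of_pderiv_two_eq_zero (m := m) hq hq2
  obtain ⟨i, hi, c, rfl⟩ := eq_monomial_of_support hsq fun m n hm hn =>
    hwt m n (hsq m hm).2 (hsq n hn).2 _ ((mul_eq_zero.1 (hcq m)).resolve_right hm)
      ((mul_eq_zero.1 (hcq n)).resolve_right hn)
  set m₀ : Fin 3 →₀ ℕ := Finsupp.single 0 i + Finsupp.single 1 (d - i) with hm₀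
  have hmono : (X 0 ^ i * X 1 ^ (d - i) : MvPolynomial (Fin 3) ℂ) = monomial m₀ 1 := by
    rw [X_pow_eq_monomial, X_pow_eq_monomial, monomial_mul, one_mul]
  obtain ⟨k, hk, b, hb⟩ : ∃ k ≤ d, ∃ b : ℂ, p - C (coeff m₀ p) * (X 0 ^ i * X 1 ^ (d - i)) =
      C b * (X 0 ^ k * X 1 ^ (d - k)) := by
    have hs : ∀ m, coeff m (p - C (coeff m₀ p) * (X 0 ^ i * X 1 ^ (d - i))) ≠ 0 →
        coeff m p ≠ 0 ∧ m ≠ m₀ := fun m hm => by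
      rw [hmono, coeff_sub, coeff_C_mul, coeff_monomial] at hm
      split_ifs at hm with hmm
      · rw [hmm] at hm
        simp at hm
      · exact ⟨by simpa using hm, fun h => hmm h.symm⟩
    have hs' : ∀ m, coeff m p ≠ 0 → m ≠ m₀ →
        M 0 0 * m 0 + M 1 1 * m 1 + (M 0 0 + M 1 1) = 0 := fun m hm hmm => by
      have := hcp m
      rw [hmono, coeff_C_mul, coeff_monomial, if_neg hmm.symm, mul_zero, mul_zero, add_zero] at this
      exact (mul_eq_zero.1 this).resolve_right hm
    refine eq_monomial_of_support (fun m hm => hsp m (hs m hm).1) fun m n hm hn => ?_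
    exact hwt m n (hsp m (hs m hm).1).2 (hsp n (hs n hn).1).2 _ (hs' m (hs m hm).1 (hs m hm).2)
      (hs' n (hs n hn).1 (hs n hn).2)
  obtain ⟨a, rfl⟩ : ∃ a, p = C a * (X 0 ^ i * X 1 ^ (d - i)) + C b * (X 0 ^ k * X 1 ^ (d - k)) :=
    ⟨coeff m₀ p, by rw [← hb]; ring⟩
  have hc0 : c ≠ 0 := by
    rintro rfl
    exact hn.not_forall_dvd (by omega : d ≠ 0) hp (dvd_pencilForm dvd_rfl (by simp))
  have hb0 : b ≠ 0 := by
    rintro rfl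
    exact hn.not_forall_dvd (by omega : d ≠ 0) (isHomogeneous_X_pow_mul_X_pow hi)
      (dvd_pencilForm (by simp) (by simp))
  have hik : i ≠ k := by
    rintro rfl
    exact hn.not_forall_dvd (by omega : d ≠ 0) (isHomogeneous_X_pow_mul_X_pow hi)
      (dvd_pencilForm (dvd_add (by simp) (by simp)) (by simp))
  have hX0 : i = 0 ∨ k = 0 := by
    by_contra! hne
    refine hn.not_forall_X_dvd 0 (dvd_pencilForm (dvd_add ?_ ?_) ?_) <;>
    · refine (Dvd.dvd.mul_right (dvd_pow_self _ ?_) _).mul_left _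
      omega
  have hX1 : i = d ∨ k = d := by
    by_contra! hne
    refine hn.not_forall_X_dvd 1 (dvd_pencilForm (dvd_add ?_ ?_) ?_) <;>
    · refine (Dvd.dvd.mul_left (dvd_pow_self _ ?_) _).mul_left _
      omega
  rcases hX0 with rfl | rfl
  · obtain rfl : k = d := by omega
    simpa using isStandard_pencilForm_left (d := k) (a := a) hb0 hc0
  · obtain rfl : i = d := by omega
    simpa using isStandard_pencilForm_right (d := i) (a := a) hb0 hc0

/-! ### Forms with an isotropy algebra of dimension at least two -/

theorem X_zero_dvd_of_coeff_eq_zero {f : MvPolynomial (Fin 3) ℂ} {d : ℕ}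
    (h : ∀ m, coeff m f ≠ 0 → m 2 = 0 ∧ m 0 + m 1 = d) (h0 : coeff (Finsupp.single 1 d) f = 0) :
    X 0 ∣ f := by
  refine X_dvd_of_forall_coeff fun m hm hm0 => ?_
  obtain ⟨h2, h1⟩ := h m hm
  refine hm ?_
  have : m = Finsupp.single 1 d := by
    ext k
    fin_cases k
    · simpa using hm0
    · simp; omega
    · simpa using h2
  rw [this, h0]

/-- The classification when the isotropy algebra contains the nilpotent matrix `E₃₁` and a lower
triangular matrix that is not a multiple of it. -/
theorem isStandard_of_sq_eq_zero {d : ℕ} (hd : 2 ≤ d) {w : Fin 3 → MvPolynomial (Fin 3) ℂ}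
    (hw : w ∈ OneForms d) (hn : NoCommonFactor w)
    (hN : !![0, 0, 0; 0, 0, 0; 1, 0, 0] ∈ isotropy w) {M : Matrix (Fin 3) (Fin 3) ℂ}
    (hM : M ∈ isotropy w) (h01 : M 0 1 = 0) (h02 : M 0 2 = 0) (h12 : M 1 2 = 0)
    (hMN : ∀ c : ℂ, M ≠ c • !![0, 0, 0; 0, 0, 0; 1, 0, 0]) : IsStandard d w := by
  rcases eq_or_ne (M 0 0) (M 1 1) with h | h
  · -- if the eigenvalues on `x` and `y` coincide, the Euler relation reduces the action on `p` and `q`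
    -- to `x ∂/∂y` plus scalars, and this forces a common factor
    exfalso
    obtain ⟨p, q, hp, hq, hp2, hq2, rfl⟩ := exists_eq_pencilForm hw hN
    obtain ⟨hMp, hMq⟩ := linDeriv_of_mem_isotropy_pencilForm h01 h02 h12 hM
    rw [linDeriv_of_pderiv_two_eq_zero h01 h02 h12 hp2, ← h] at hMp
    rw [linDeriv_of_pderiv_two_eq_zero h01 h02 h12 hq2, ← h] at hMq
    have hEp := hp.sum_X_mul_pderiv
    have hEq := hq.sum_X_mul_pderiv
    rw [Fin.sum_univ_three (f := fun i => X i * pderiv i _), hp2, mul_zero, add_zero,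
      nsmul_eq_mul] at hEp
    rw [Fin.sum_univ_three (f := fun i => X i * pderiv i _), hq2, mul_zero, add_zero,
      nsmul_eq_mul] at hEq
    have hd0 : d ≠ 0 := by omega
    have hq0 : q ≠ 0 := by
      rintro rfl
      exact hn.not_forall_dvd hd0 hp (dvd_pencilForm dvd_rfl (dvd_zero _))
    have hCd : (C (d : ℂ) : MvPolynomial (Fin 3) ℂ) = d := by simp
    have hp1 : C (M 1 0) * (X 0 * pderiv 1 p) + C (M 0 0 * ((d : ℂ) + 2)) * p +
        C (M 2 1) * q = 0 := by
      have h2 : (C (M 0 0 * ((d : ℂ) + 2)) : MvPolynomial (Fin 3) ℂ) =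
          C (M 0 0) * (d : MvPolynomial (Fin 3) ℂ) + C (M 0 0 + M 0 0) := by
        rw [← hCd, ← C_mul, ← C_add]; ring_nf
      rw [h2]
      linear_combination hMp - C (M 0 0) * hEp
    have hq1 : C (M 1 0) * (X 0 * pderiv 1 q) + C (M 0 0 * ((d : ℂ) + 1) + M 2 2) * q = 0 := by
      have h2 : (C (M 0 0 * ((d : ℂ) + 1) + M 2 2) : MvPolynomial (Fin 3) ℂ) =
          C (M 0 0) * (d : MvPolynomial (Fin 3) ℂ) + C (M 0 0 + M 2 2) := by
        rw [← hCd, ← C_mul, ← C_add]; ring_nf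
      rw [h2]
      linear_combination hMq - C (M 0 0) * hEq
    rcases eq_or_ne (M 1 0) 0 with h10 | h10
    · rw [h10, C_0, zero_mul, zero_add] at hp1 hq1
      have e1 : M 0 0 * (d + 1) + M 2 2 = 0 := C_eq_zero.1 ((mul_eq_zero.1 hq1).resolve_right hq0)
      have e2 : M 0 0 = 0 := by
        by_contra h0
        have hne : M 0 0 * (d + 2) ≠ 0 :=
          mul_ne_zero h0 (by exact_mod_cast Nat.succ_ne_zero (d + 1))
        refine hn.not_forall_dvd hd0 hq
          (dvd_pencilForm ⟨C (-M 2 1 / (M 0 0 * ((d : ℂ) + 2))), ?_⟩ dvd_rfl)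
        have h3 : (C (M 0 0 * ((d : ℂ) + 2)) : MvPolynomial (Fin 3) ℂ) ≠ 0 := C_ne_zero.2 hne
        refine mul_left_cancel₀ h3 ?_
        have h4 : (C (M 0 0 * ((d : ℂ) + 2)) * C (-M 2 1 / (M 0 0 * ((d : ℂ) + 2))) :
            MvPolynomial (Fin 3) ℂ) = -C (M 2 1) := by
          rw [← C_mul, mul_div_cancel₀ _ hne, C_neg]
        linear_combination hp1 - q * h4
      rw [e2, zero_mul, C_0, zero_mul, zero_add] at hp1
      have e3 : M 2 1 = 0 := by simpa using (mul_eq_zero.1 hp1).resolve_right hq0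
      refine hMN (M 2 0) ?_
      rw [e2, zero_mul, zero_add] at e1
      have e4 : M 1 1 = 0 := h ▸ e2
      ext i j
      fin_cases i <;> fin_cases j <;> simp [h01, h02, h10, h12, e1, e2, e3, e4]
    · have hsp := fun m => support_of_pderiv_two_eq_zero (m := m) hp hp2
      have hsq := fun m => support_of_pderiv_two_eq_zero (m := m) hq hq2
      have hcoeff0 : ∀ (g : MvPolynomial (Fin 3) ℂ) (n : ℕ),
          coeff (Finsupp.single 1 n) (X 0 * g) = 0 := fun g n => by
        rw [coeff_X_mul', if_neg]
        simp
      have hcoeff1 : ∀ (g : MvPolynomial (Fin 3) ℂ) (n : ℕ),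
          coeff (Finsupp.single 0 1 + Finsupp.single 1 (n + 1)) (X 1 * (X 0 * pderiv 1 g)) =
            (n + 1) * coeff (Finsupp.single 1 (n + 1)) g := fun g n => by
        rw [mul_left_comm, coeff_X_mul, X_mul_pderiv_coeff]
        simp
      have hcoeff2 : ∀ (g : MvPolynomial (Fin 3) ℂ) (n : ℕ),
          coeff (Finsupp.single 0 1 + Finsupp.single 1 (n + 1)) (X 1 * g) =
            coeff (Finsupp.single 0 1 + Finsupp.single 1 n) g := fun g n => by
        rw [show (Finsupp.single 0 1 + Finsupp.single 1 (n + 1) : Fin 3 →₀ ℕ) =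
          Finsupp.single 1 1 + (Finsupp.single 0 1 + Finsupp.single 1 n) by
            rw [add_comm n 1, Finsupp.single_add]; abel, coeff_X_mul]
      obtain ⟨e, rfl⟩ : ∃ e, d = e + 2 := ⟨d - 2, by omega⟩
      -- if the scalar that acts on `q` vanishes, then `q` is a multiple of a power of `x`
      have hker : M 0 0 * ((e + 2 : ℕ) + 1) + M 2 2 = 0 → ∀ m : Fin 3 →₀ ℕ, m 1 ≠ 0 →
          coeff m q = 0 := fun h0 m hm => by
        rw [h0, C_0, zero_mul, add_zero, mul_eq_zero, mul_eq_zero] at hq1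
        have hq1' := (hq1.resolve_left (by simpa using h10)).resolve_left (X_ne_zero 0)
        have := X_mul_pderiv_coeff 1 m q
        rw [hq1', mul_zero, coeff_zero, eq_comm, mul_eq_zero] at this
        exact this.resolve_left (by exact_mod_cast hm)
      have hqy : coeff (Finsupp.single 1 (e + 2)) q = 0 := by
        by_contra hne
        have h0 := congrArg (coeff (Finsupp.single 1 (e + 2))) hq1
        rw [coeff_add, coeff_C_mul, coeff_C_mul, hcoeff0, mul_zero, zero_add, coeff_zero,
          mul_eq_zero] at h0
        exact hne (hker (h0.resolve_right hne) _ (by simp))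
      -- otherwise the coefficients of `y^d` and of `x y^(d-1)` in the two equations show that both
      -- scalars vanish while `q` involves `y`
      have hpy : coeff (Finsupp.single 1 (e + 2)) p = 0 := by
        by_contra hne
        have h0 := congrArg (coeff (Finsupp.single 1 (e + 2))) hp1
        rw [coeff_add, coeff_add, coeff_C_mul, coeff_C_mul, coeff_C_mul, hcoeff0, hqy, mul_zero,
          mul_zero, zero_add, add_zero, coeff_zero, mul_eq_zero] at h0
        rw [h0.resolve_right hne, C_0, zero_mul, add_zero] at hp1
        have h1 := congrArg (fun g => coeff (Finsupp.single 0 1 + Finsupp.single 1 (e + 2))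
          (X 1 * g)) hp1
        simp only [mul_add, mul_left_comm (X 1 : MvPolynomial (Fin 3) ℂ) (C _), coeff_add,
          coeff_C_mul, hcoeff1, hcoeff2, mul_zero, coeff_zero] at h1
        have hq' : coeff (Finsupp.single 0 1 + Finsupp.single 1 (e + 1)) q ≠ 0 := fun h2 => by
          rw [h2, mul_zero, add_zero, mul_eq_zero, mul_eq_zero] at h1
          refine hne ((h1.resolve_left h10).resolve_left ?_)
          exact Nat.cast_add_one_ne_zero (R := ℂ) (e + 1)
        have h2 := congrArg (fun g => coeff (Finsupp.single 0 1 + Finsupp.single 1 (e + 2))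
          (X 1 * g)) hq1
        simp only [mul_add, mul_left_comm (X 1 : MvPolynomial (Fin 3) ℂ) (C _), coeff_add,
          coeff_C_mul, hcoeff1, hcoeff2, mul_zero, coeff_zero, hqy, zero_add] at h2
        have h3 := (mul_eq_zero.1 h2).resolve_right hq'
        exact hq' (hker (by linear_combination h3) _ (by simp))
      exact hn.not_forall_X_dvd 0 (dvd_pencilForm (X_zero_dvd_of_coeff_eq_zero hsp hpy)
        (X_zero_dvd_of_coeff_eq_zero hsq hqy))
  · -- a unipotent change of the coordinate `y` diagonalizes the action on `x` and `y`
    let s := M 1 0 / (M 0 0 - M 1 1)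
    have hs : M 1 0 + s * M 1 1 = s * M 0 0 := by
      have := sub_ne_zero.2 h
      simp only [s]
      field_simp
      ring
    let A : Matrix (Fin 3) (Fin 3) ℂ := !![1, 0, 0; s, 1, 0; 0, 0, 1]
    have hA : IsUnit A := by
      rw [Matrix.isUnit_iff_isUnit_det, Matrix.det_fin_three]
      simp [A]
    let M' : Matrix (Fin 3) (Fin 3) ℂ :=
      !![M 0 0, 0, 0; 0, M 1 1, 0; M 2 0 + s * M 2 1, M 2 1, M 2 2]
    have hMA : M * A = A * M' := by
      ext i j
      fin_cases i <;> fin_cases j <;>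
        simp [A, M', Matrix.mul_apply, Fin.sum_univ_three, h01, h02, h12]
      · linear_combination hs
      · ring
    have hNA : !![0, 0, 0; 0, 0, 0; 1, 0, 0] * A = A * !![0, 0, 0; 0, 0, 0; 1, 0, 0] := by
      ext i j
      fin_cases i <;> fin_cases j <;> simp [A, Matrix.mul_apply, Fin.sum_univ_three]
    have hw' := pullbackForm_mem A hw
    have hn' := hn.pullbackForm hA.unit
    have hN' := mem_isotropy_pullbackForm hNA hN
    have hM' := mem_isotropy_pullbackForm hMA hM
    refine IsStandard.of_pullbackForm (B := hA.unit) ?_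
    rw [hA.unit_spec] at hn' ⊢
    obtain ⟨p, q, hp, hq, hp2, hq2, he⟩ := exists_eq_pencilForm hw' hN'
    rw [he] at hn' hM' ⊢
    exact isStandard_of_diagonal hd hp hq hp2 hq2 hn' (M := M') rfl rfl rfl rfl h hM'

/-- The condition on the dimension of the isotropy algebra is invariant under pullback. -/
theorem exists_mem_isotropy_pullbackForm {w : Fin 3 → MvPolynomial (Fin 3) ℂ}
    (hdim : ∀ N : Matrix (Fin 3) (Fin 3) ℂ, ∃ T ∈ isotropy w, ∀ c : ℂ, T ≠ c • N)
    (A : GL (Fin 3) ℂ) (N : Matrix (Fin 3) (Fin 3) ℂ) :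
    ∃ T ∈ isotropy (pullbackForm A.1 w), ∀ c : ℂ, T ≠ c • N := by
  obtain ⟨T, hT, hTN⟩ := hdim (A.1 * N * A.2)
  refine ⟨A.2 * T * A.1, mem_isotropy_pullbackForm ?_ hT, fun c hc => hTN c ?_⟩
  · rw [mul_assoc, ← mul_assoc, A.3, one_mul]
  · have : T = A.1 * (A.2 * T * A.1) * A.2 := by
      rw [mul_assoc A.2, ← mul_assoc, A.3, one_mul, mul_assoc, A.3, mul_one]
    rw [this, hc, mul_smul_comm, smul_mul_assoc]

theorem isStandard_of_mem_isotropy_of_sq_eq_zero {d : ℕ} (hd : 2 ≤ d)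
    {w : Fin 3 → MvPolynomial (Fin 3) ℂ} (hw : w ∈ OneForms d) (hn : NoCommonFactor w)
    (hdim : ∀ N : Matrix (Fin 3) (Fin 3) ℂ, ∃ T ∈ isotropy w, ∀ c : ℂ, T ≠ c • N)
    {N : Matrix (Fin 3) (Fin 3) ℂ} (hN : N ∈ isotropy w) (hN0 : N ≠ 0) (hN2 : N ^ 2 = 0) :
    IsStandard d w := by
  obtain ⟨A, hA⟩ := exists_conj_of_sq_eq_zero hN2 hN0
  refine IsStandard.of_pullbackForm (B := A) ?_
  have hN' := mem_isotropy_pullbackForm hA hN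
  obtain ⟨M, hM, hMN, c, hc⟩ := exists_mem_isotropy_commutator_eq_smul
    (exists_mem_isotropy_pullbackForm hdim A) hN' ⟨2, by
      rw [pow_two]
      ext i j
      fin_cases i <;> fin_cases j <;> simp [Matrix.mul_apply, Fin.sum_univ_three]⟩
  have he := fun i j => congrFun (congrFun hc i) j
  have e1 := he 2 1
  have e2 := he 2 2
  have e3 := he 1 0
  simp only [Matrix.sub_apply, Matrix.mul_apply, Fin.sum_univ_three, Matrix.smul_apply]
    at e1 e2 e3
  simp at e1 e2 e3
  exact isStandard_of_sq_eq_zero hd (pullbackForm_mem A.1 hw) (hn.pullbackForm A) hN' hM e1 e2 e3 hMN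

/-- A form of degree at least two without common factor whose isotropy algebra has dimension at least
two is, up to a linear change of coordinates, one of the two standard forms. -/
theorem isStandard_of_isotropy {d : ℕ} (hd : 2 ≤ d) {w : Fin 3 → MvPolynomial (Fin 3) ℂ}
    (hw : w ∈ OneForms d) (hn : NoCommonFactor w)
    (hdim : ∀ N : Matrix (Fin 3) (Fin 3) ℂ, ∃ T ∈ isotropy w, ∀ c : ℂ, T ≠ c • N) :
    IsStandard d w := by
  obtain ⟨N, hN, hN0, hnil⟩ := exists_isNilpotent_mem_isotropy hd hw hn hdim
  have hN3 := pow_three_eq_zero_of_isNilpotent hnil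
  by_cases hN2 : N ^ 2 = 0
  · exact isStandard_of_mem_isotropy_of_sq_eq_zero hd hw hn hdim hN hN0 hN2
  obtain ⟨A, hA⟩ := exists_conj_of_sq_ne_zero hN3 hN2
  refine IsStandard.of_pullbackForm (B := A) ?_
  have hN' := mem_isotropy_pullbackForm hA hN
  have hw' := pullbackForm_mem A.1 hw
  have hn' := hn.pullbackForm A
  have hdim' := exists_mem_isotropy_pullbackForm hdim A
  set w' := pullbackForm A.1 w
  set E : Matrix (Fin 3) (Fin 3) ℂ := !![0, 0, 0; 1, 0, 0; 0, 1, 0] with hE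
  obtain ⟨M, hM, hMN, c, hc⟩ := exists_mem_isotropy_commutator_eq_smul hdim' hN' ⟨3, by
      rw [pow_three]
      ext i j
      fin_cases i <;> fin_cases j <;> simp [hE, Matrix.mul_apply, Fin.sum_univ_three]⟩
  have he := fun i j => congrFun (congrFun hc i) j
  have e01 := he 0 0
  have e02 := he 0 1
  have e12 := he 1 1
  have e11 := he 1 0
  have e21 := he 2 0
  have e22 := he 2 1
  simp only [Matrix.sub_apply, Matrix.mul_apply, Fin.sum_univ_three, Matrix.smul_apply]
    at e01 e02 e12 e11 e21 e22
  simp [hE] at e01 e02 e12 e11 e21 e22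
  have h12 : M 1 2 = 0 := by rw [e01] at e12; simpa using e12
  -- outside the diagonal, the element `M - M₁₀ E` of the isotropy algebra has only its lower left
  -- entry
  let S : Matrix (Fin 3) (Fin 3) ℂ :=
    !![M 0 0, 0, 0; 0, M 0 0 - c, 0; M 2 0, 0, M 0 0 - 2 * c]
  have hSM : S = M - M 1 0 • E := by
    ext i j
    fin_cases i <;> fin_cases j <;> simp [S, hE, e01, e02, h12]
    · linear_combination e11
    · linear_combination e21
    · linear_combination e11 + e22
  have hS : S ∈ isotropy w' := by
    rw [hSM]
    exact (isotropy w').sub_mem hM ((isotropy w').smul_mem _ hN')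
  rcases eq_or_ne c 0 with rfl | hc0
  · -- `S` is the sum of a scalar matrix and of a multiple of `E ^ 2`
    have hdec : S = M 2 0 • E ^ 2 + M 0 0 • 1 := by
      rw [pow_two]
      ext i j
      fin_cases i <;> fin_cases j <;> simp [S, hE]
    have hnil2 : (M 2 0 • E ^ 2) ^ 2 = 0 := by
      rw [pow_two, pow_two]
      ext i j
      fin_cases i <;> fin_cases j <;> simp [hE, Matrix.mul_apply, Fin.sum_univ_three]
    have hj := isotropy_jordan (w := w') (N := M 2 0 • E ^ 2) (S := M 0 0 • 1) ⟨2, hnil2⟩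
      (by
        rw [map_smul, map_one]
        exact Module.End.IsSemisimple_smul _ Module.End.isSemisimple_id)
      ((Commute.one_right _).smul_right _) (hdec ▸ hS)
    have h00 := smul_one_mem_isotropy hw' hn'.ne_zero' hj.1
    refine isStandard_of_mem_isotropy_of_sq_eq_zero hd hw' hn' hdim' hj.2 (fun h0 => ?_) hnil2
    refine hMN (M 1 0) ?_
    have hS0 : S = 0 := by rw [hdec, h0, h00, zero_smul, add_zero]
    exact sub_eq_zero.1 (hSM.symm.trans hS0)
  · -- a unipotent matrix commuting with `E` conjugates `S` to a diagonal matrix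
    exfalso
    let B : Matrix (Fin 3) (Fin 3) ℂ := !![1, 0, 0; 0, 1, 0; M 2 0 / (2 * c), 0, 1]
    have hB : IsUnit B := by
      rw [Matrix.isUnit_iff_isUnit_det, Matrix.det_fin_three]
      simp [B]
    have hSB : S * B = B * Matrix.diagonal ![M 0 0, M 0 0 - c, M 0 0 - 2 * c] := by
      ext i j
      fin_cases i <;> fin_cases j <;>
        simp [S, B, Matrix.mul_apply, Fin.sum_univ_three, Matrix.diagonal]
      field_simp
      ring
    have hEB : E * B = B * E := by
      ext i j
      fin_cases i <;> fin_cases j <;> simp [hE, B, Matrix.mul_apply, Fin.sum_univ_three]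
    have hn'' := hn'.pullbackForm hB.unit
    rw [hB.unit_spec] at hn''
    exact not_affine_le_isotropy hd (pullbackForm_mem B hw') hn''
      (mem_isotropy_pullbackForm hEB hN') hc0 (mem_isotropy_pullbackForm hSB hS)

/-! ### The orbit map in coordinates -/

open TensorProduct in
/-- The substitution of the generic linear map: `xᵢ` is sent to `∑ xⱼ ⊗ Aᵢⱼ`, where the `Aᵢⱼ` are the
coordinates on the space of matrices. -/
noncomputable def genericSubst : MvPolynomial (Fin 3) ℂ →ₐ[ℂ]
    MvPolynomial (Fin 3) ℂ ⊗[ℂ] MvPolynomial (Fin 3 × Fin 3) ℂ :=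
  aeval fun i => ∑ j, X j ⊗ₜ X (i, j)

open TensorProduct in
/-- The coefficient of `dxⱼ` in the pullback of `w` by the generic linear map. -/
noncomputable def genericPullback (w : Fin 3 → MvPolynomial (Fin 3) ℂ) (j : Fin 3) :
    MvPolynomial (Fin 3) ℂ ⊗[ℂ] MvPolynomial (Fin 3 × Fin 3) ℂ :=
  ∑ i, (1 ⊗ₜ X (i, j)) * genericSubst (w i)

/-- The derivation of the ring of polynomial functions on matrices given by the vector field
`A ↦ M * A`. -/
noncomputable def matDeriv (M : Matrix (Fin 3) (Fin 3) ℂ) :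
    Derivation ℂ (MvPolynomial (Fin 3 × Fin 3) ℂ) (MvPolynomial (Fin 3 × Fin 3) ℂ) :=
  mkDerivation ℂ fun p => ∑ k, C (M p.1 k) * X (k, p.2)

@[simp]
theorem matDeriv_X (M : Matrix (Fin 3) (Fin 3) ℂ) (p : Fin 3 × Fin 3) :
    matDeriv M (X p) = ∑ k, C (M p.1 k) * X (k, p.2) :=
  mkDerivation_X _ _ _

open TensorProduct in
theorem lTensor_derivation_mul {R A B : Type*} [CommRing R] [CommRing A] [CommRing B] [Algebra R A]
    [Algebra R B] (D : Derivation R B B) (s t : A ⊗[R] B) :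
    LinearMap.lTensor A (D : B →ₗ[R] B) (s * t) =
      LinearMap.lTensor A (D : B →ₗ[R] B) s * t + s * LinearMap.lTensor A (D : B →ₗ[R] B) t := by
  induction s using TensorProduct.induction_on with
  | zero => simp
  | add x y hx hy => simp only [add_mul, map_add, hx, hy]; ring
  | tmul a b =>
    induction t using TensorProduct.induction_on with
    | zero => simp
    | add x y hx hy => simp only [mul_add, map_add, hx, hy]; ring
    | tmul a' b' =>
      simp only [Algebra.TensorProduct.tmul_mul_tmul, LinearMap.lTensor_tmul, Derivation.coeFn_coe,
        Derivation.leibniz, smul_eq_mul, TensorProduct.tmul_add]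
      rw [add_comm, mul_comm b' (D b)]

/-- The derivative of `f ∘ A` along the vector field `A ↦ M * A` is `linDeriv M f ∘ A`. -/
theorem lTensor_matDeriv_genericSubst (M : Matrix (Fin 3) (Fin 3) ℂ)
    (f : MvPolynomial (Fin 3) ℂ) :
    LinearMap.lTensor (MvPolynomial (Fin 3) ℂ) (matDeriv M).toLinearMap (genericSubst f) =
      genericSubst (linDeriv M f) := by
  induction f using MvPolynomial.induction_on with
  | C a =>
    simp [genericSubst, Algebra.TensorProduct.algebraMap_apply]
  | add p q hp hq => simp only [map_add, hp, hq]
  | mul_X p i hp =>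
    have hX : LinearMap.lTensor (MvPolynomial (Fin 3) ℂ) (matDeriv M).toLinearMap
        (genericSubst (X i)) = genericSubst (linDeriv M (X i)) := by
      simp only [genericSubst, aeval_X, linDeriv_X, map_sum, LinearMap.lTensor_tmul,
        Derivation.coeFn_coe, matDeriv_X, TensorProduct.tmul_sum, map_mul, Finset.mul_sum]
      rw [Finset.sum_comm]
      refine Finset.sum_congr rfl fun j _ => Finset.sum_congr rfl fun k _ => ?_
      rw [algHom_C, C_mul', ← Algebra.smul_def, TensorProduct.tmul_smul]
    rw [map_mul, lTensor_derivation_mul, hp, hX, linDeriv_mul, map_add, map_mul, map_mul]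

theorem lTensor_matDeriv_genericPullback (M : Matrix (Fin 3) (Fin 3) ℂ)
    (w : Fin 3 → MvPolynomial (Fin 3) ℂ) (j : Fin 3) :
    LinearMap.lTensor (MvPolynomial (Fin 3) ℂ) (matDeriv M).toLinearMap (genericPullback w j) =
      genericPullback (lieForm M w) j := by
  have hC : ∀ (i k : Fin 3) (f : MvPolynomial (Fin 3) ℂ), genericSubst (C (M i k) * f) =
      M i k • genericSubst f := fun i k f => by
    rw [C_mul', map_smul]
  simp only [genericPullback, map_sum, lTensor_derivation_mul, lTensor_matDeriv_genericSubst,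
    LinearMap.lTensor_tmul, Derivation.coeFn_coe, matDeriv_X, lieForm, map_add, hC, mul_add,
    Finset.sum_add_distrib]
  rw [add_comm]
  congr 1
  simp only [TensorProduct.tmul_sum, Finset.sum_mul, Finset.mul_sum, C_mul',
    TensorProduct.tmul_smul, smul_mul_assoc, mul_smul_comm]
  rw [Finset.sum_comm]

/-- The generic pullback specializes to the pullback by each matrix. -/
theorem map_aeval_genericPullback (A : Matrix (Fin 3) (Fin 3) ℂ)
    (w : Fin 3 → MvPolynomial (Fin 3) ℂ) (j : Fin 3) :
    Algebra.TensorProduct.rid ℂ ℂ (MvPolynomial (Fin 3) ℂ)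
      (Algebra.TensorProduct.map (AlgHom.id ℂ (MvPolynomial (Fin 3) ℂ))
        (aeval fun p : Fin 3 × Fin 3 => A p.1 p.2) (genericPullback w j)) =
      pullbackForm A w j := by
  have h : ((Algebra.TensorProduct.rid ℂ ℂ (MvPolynomial (Fin 3) ℂ)).toAlgHom.comp
      (Algebra.TensorProduct.map (AlgHom.id ℂ (MvPolynomial (Fin 3) ℂ))
        (aeval fun p : Fin 3 × Fin 3 => A p.1 p.2))).comp genericSubst = subst A := by
    refine algHom_ext fun i => ?_
    simp [genericSubst, subst, C_mul']
  have h' : ∀ f, Algebra.TensorProduct.rid ℂ ℂ (MvPolynomial (Fin 3) ℂ)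
      (Algebra.TensorProduct.map (AlgHom.id ℂ (MvPolynomial (Fin 3) ℂ))
        (aeval fun p : Fin 3 × Fin 3 => A p.1 p.2) (genericSubst f)) = subst A f :=
    fun f => DFunLike.congr_fun h f
  simp only [genericPullback, pullbackForm, map_sum, map_mul, h']
  refine Finset.sum_congr rfl fun i _ => ?_
  simp [C_mul']

/-- The polynomial function `A ↦ μ (A^* w)` on the space of matrices, for a linear form `μ`. -/
noncomputable def orbitPoly (w : Fin 3 → MvPolynomial (Fin 3) ℂ)
    (μ : (Fin 3 → MvPolynomial (Fin 3) ℂ) →ₗ[ℂ] ℂ) : MvPolynomial (Fin 3 × Fin 3) ℂ :=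
  ∑ j, TensorProduct.lid ℂ (MvPolynomial (Fin 3 × Fin 3) ℂ)
    (LinearMap.rTensor _ (μ ∘ₗ LinearMap.single ℂ _ j) (genericPullback w j))

theorem eval_orbitPoly (A : Matrix (Fin 3) (Fin 3) ℂ) (w : Fin 3 → MvPolynomial (Fin 3) ℂ)
    (μ : (Fin 3 → MvPolynomial (Fin 3) ℂ) →ₗ[ℂ] ℂ) :
    eval (fun p => A p.1 p.2) (orbitPoly w μ) = μ (pullbackForm A w) := by
  have h : ∀ (ν : MvPolynomial (Fin 3) ℂ →ₗ[ℂ] ℂ) s,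
      eval (fun p : Fin 3 × Fin 3 => A p.1 p.2)
        (TensorProduct.lid ℂ (MvPolynomial (Fin 3 × Fin 3) ℂ) (LinearMap.rTensor _ ν s)) =
      ν (Algebra.TensorProduct.rid ℂ ℂ (MvPolynomial (Fin 3) ℂ)
        (Algebra.TensorProduct.map (AlgHom.id ℂ (MvPolynomial (Fin 3) ℂ))
        (aeval fun p : Fin 3 × Fin 3 => A p.1 p.2) s)) := fun ν s => by
    induction s using TensorProduct.induction_on with
    | zero => simp
    | add x y hx hy => simp only [map_add, hx, hy]
    | tmul a b => simp [smul_eval, mul_comm, aeval_eq_eval]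
  simp only [orbitPoly, map_sum, h, map_aeval_genericPullback, LinearMap.comp_apply]
  rw [← map_sum]
  congr 1
  exact LinearMap.sum_single_apply _ _

/-- The differential of the orbit map is given by the Lie derivative. -/
theorem matDeriv_orbitPoly (M : Matrix (Fin 3) (Fin 3) ℂ) (w : Fin 3 → MvPolynomial (Fin 3) ℂ)
    (μ : (Fin 3 → MvPolynomial (Fin 3) ℂ) →ₗ[ℂ] ℂ) :
    matDeriv M (orbitPoly w μ) = orbitPoly (lieForm M w) μ := by
  have h : ∀ (ν : MvPolynomial (Fin 3) ℂ →ₗ[ℂ] ℂ) s,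
      matDeriv M
        (TensorProduct.lid ℂ (MvPolynomial (Fin 3 × Fin 3) ℂ) (LinearMap.rTensor _ ν s)) =
      TensorProduct.lid ℂ (MvPolynomial (Fin 3 × Fin 3) ℂ) (LinearMap.rTensor _ ν
        (LinearMap.lTensor (MvPolynomial (Fin 3) ℂ) (matDeriv M).toLinearMap s)) := fun ν s => by
    induction s using TensorProduct.induction_on with
    | zero => simp
    | add x y hx hy => simp only [map_add, hx, hy]
    | tmul a b => simp
  simp only [orbitPoly, map_sum, h, lTensor_matDeriv_genericPullback]

/-- The functions `A ↦ μ (A^* w)` span a finite-dimensional space. -/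
theorem exists_finite_orbitPoly_mem_span (w : Fin 3 → MvPolynomial (Fin 3) ℂ) :
    ∃ s : Set (MvPolynomial (Fin 3 × Fin 3) ℂ), s.Finite ∧
      ∀ μ, orbitPoly w μ ∈ Submodule.span ℂ s := by
  have h : ∀ t, ∃ s : Set (MvPolynomial (Fin 3 × Fin 3) ℂ), s.Finite ∧
      ∀ ν : MvPolynomial (Fin 3) ℂ →ₗ[ℂ] ℂ, TensorProduct.lid ℂ _ (LinearMap.rTensor _ ν t) ∈
        Submodule.span ℂ s := fun t => by
    induction t using TensorProduct.induction_on with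
    | zero => exact ⟨∅, Set.finite_empty, by simp⟩
    | add x y hx hy =>
      obtain ⟨s, hs, h1⟩ := hx
      obtain ⟨s', hs', h2⟩ := hy
      refine ⟨s ∪ s', hs.union hs', fun ν => ?_⟩
      rw [map_add, map_add]
      exact add_mem (Submodule.span_mono Set.subset_union_left (h1 ν))
        (Submodule.span_mono Set.subset_union_right (h2 ν))
    | tmul a b =>
      refine ⟨{b}, Set.finite_singleton b, fun ν => ?_⟩
      simpa using Submodule.smul_mem _ _ (Submodule.mem_span_singleton_self b)
  choose s hs h using h
  refine ⟨⋃ j, s (genericPullback w j), Set.finite_iUnion fun j => hs _, fun μ => ?_⟩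
  exact Submodule.sum_mem _ fun j _ => Submodule.span_mono (Set.subset_iUnion_of_subset j le_rfl)
    (h _ _)

/-! ### Derivations and algebraic independence -/

/-- A derivation that vanishes on a subalgebra vanishes on the elements algebraic over it. -/
theorem Derivation.apply_eq_zero_of_isAlgebraic {A : Type*} [CommRing A] [IsDomain A] [Algebra ℂ A]
    (D : Derivation ℂ A A) {S : Subalgebra ℂ A} (hS : ∀ a ∈ S, D a = 0) {x : A}
    (hx : IsAlgebraic S x) : D x = 0 := by
  have hD : ∀ p : Polynomial S, D (Polynomial.aeval x p) =
      Polynomial.aeval x (Polynomial.derivative p) * D x := fun p => by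
    induction p using Polynomial.induction_on' with
    | add p q hp hq => simp only [map_add, hp, hq, add_mul]
    | monomial n a =>
      rw [Polynomial.derivative_monomial, Polynomial.aeval_monomial, Polynomial.aeval_monomial,
        Derivation.leibniz, Derivation.leibniz_pow]
      have : D (algebraMap S A a) = 0 := hS _ a.2
      rw [this, smul_zero, add_zero]
      simp only [smul_eq_mul, nsmul_eq_mul, map_mul, map_natCast]
      ring
  -- if `D x ≠ 0`, the derivatives of the polynomials that vanish at `x` vanish at `x` too
  by_contra h0
  have key : ∀ n : ℕ, ∀ p : Polynomial S, p.natDegree ≤ n → Polynomial.aeval x p = 0 → p = 0 := by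
    intro n
    induction n with
    | zero =>
      intro p hp hpx
      rw [Polynomial.eq_C_of_natDegree_le_zero hp, Polynomial.aeval_C] at hpx
      have h1 : p.coeff 0 = 0 := Subtype.ext hpx
      rw [Polynomial.eq_C_of_natDegree_le_zero hp, h1, Polynomial.C_0]
    | succ n ih =>
      intro p hp hpx
      have h1 := hD p
      rw [hpx, map_zero, eq_comm, mul_eq_zero] at h1
      have h2 := ih _ ((Polynomial.natDegree_derivative_le p).trans (by omega))
        (h1.resolve_right h0)
      refine ih p ?_ hpx
      have : CharZero S := charZero_of_injective_algebraMap (algebraMap ℂ S).injective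
      rw [Polynomial.derivative_eq_zero.1 h2]
      exact Nat.zero_le _
  obtain ⟨p, hp, hpx⟩ := hx
  exact hp (key _ p le_rfl hpx)

/-- Algebraically independent polynomials annihilated by `r` independent derivations number at most
`r` less than the variables: a derivation is determined by its values on a transcendence basis, so
`r` independent ones need `r` further elements in a basis that extends the given polynomials. -/
theorem card_add_card_le_of_derivation {σ ι κ : Type} [Fintype σ] [Fintype ι] [Fintype κ]
    {D : κ → Derivation ℂ (MvPolynomial σ ℂ) (MvPolynomial σ ℂ)}
    (hD : LinearIndependent (MvPolynomial σ ℂ) D) {x : ι → MvPolynomial σ ℂ}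
    (hx : AlgebraicIndependent ℂ x) (h : ∀ k i, D k (x i) = 0) :
    Fintype.card ι + Fintype.card κ ≤ Fintype.card σ := by
  classical
  let s := Set.range x
  have htop : Algebra.adjoin ℂ (s ∪ Set.range (X : σ → MvPolynomial σ ℂ)) = ⊤ := by
    rw [eq_top_iff, ← adjoin_range_X]
    exact Algebra.adjoin_mono Set.subset_union_right
  have hfull : Algebra.IsAlgebraic
      (Algebra.adjoin ℂ (s ∪ Set.range (X : σ → MvPolynomial σ ℂ))) (MvPolynomial σ ℂ) :=
    ⟨fun a => isAlgebraic_algebraMap (R := Algebra.adjoin ℂ (s ∪ Set.range X))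
      (⟨a, htop ▸ Algebra.mem_top⟩ : Algebra.adjoin ℂ (s ∪ Set.range X))⟩
  obtain ⟨u, hsu, hut, hu⟩ := exists_isTranscendenceBasis_between s
    (s ∪ Set.range (X : σ → MvPolynomial σ ℂ)) Set.subset_union_left hx.coe_range
  have hcard := hu.cardinalMk_eq (IsTranscendenceBasis.mvPolynomial σ ℂ)
  have hufin : u.Finite := by
    rw [← Set.finite_coe_iff, ← Cardinal.lt_aleph0_iff_finite, hcard]
    exact Cardinal.lt_aleph0_of_finite σ
  have : Fintype u := hufin.fintype
  have hsfin : Fintype s := Fintype.ofFinite _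
  have hvfin : Fintype (u \ s : Set (MvPolynomial σ ℂ)) := (hufin.subset Set.sdiff_subset).fintype
  have hcard' : Fintype.card u = Fintype.card σ := by
    simpa using hcard
  have hcs : Fintype.card s = Fintype.card ι :=
    Set.card_range_of_injective hx.injective
  have hsplit : Fintype.card s + Fintype.card (u \ s : Set (MvPolynomial σ ℂ)) =
      Fintype.card u := by
    rw [← Set.toFinset_card, ← Set.toFinset_card, ← Set.toFinset_card, Set.toFinset_sdiff,
      add_comm, Finset.card_sdiff_add_card_eq_card (Set.toFinset_subset_toFinset.2 hsu)]
  let ev : Derivation ℂ (MvPolynomial σ ℂ) (MvPolynomial σ ℂ) →ₗ[MvPolynomial σ ℂ]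
      ((u \ s : Set (MvPolynomial σ ℂ)) → MvPolynomial σ ℂ) :=
    { toFun := fun E z => E z
      map_add' := fun _ _ => rfl
      map_smul' := fun _ _ => rfl }
  have hli : LinearIndependent (MvPolynomial σ ℂ) (ev ∘ D) := by
    rw [Fintype.linearIndependent_iff] at hD ⊢
    intro c hc
    refine hD c ?_
    have hE : ∀ z ∈ u, (∑ k, c k • D k) z = 0 := fun z hz => by
      by_cases hzs : z ∈ s
      · obtain ⟨i, rfl⟩ := hzs
        rw [← Derivation.coeFnAddMonoidHom_apply, map_sum]
        simp [h]
      · have h1 := congrFun hc ⟨z, hz, hzs⟩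
        simp only [Function.comp_apply, ← map_smul, ← map_sum] at h1
        exact h1
    have hE' : ∀ a ∈ Algebra.adjoin ℂ (Set.range (Subtype.val : u → MvPolynomial σ ℂ)),
        (∑ k, c k • D k) a = 0 := fun a ha => by
      induction ha using Algebra.adjoin_induction with
      | mem a ha =>
        obtain ⟨z, rfl⟩ := ha
        exact hE _ z.2
      | algebraMap r => exact Derivation.map_algebraMap _ _
      | add a b _ _ ha hb => rw [map_add, ha, hb, add_zero]
      | mul a b _ _ ha hb => rw [Derivation.leibniz, ha, hb, smul_zero, smul_zero, add_zero]
    ext1 i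
    exact Derivation.apply_eq_zero_of_isAlgebraic _ hE' (hu.isAlgebraic.isAlgebraic _)
  have := hli.fintype_card_le_finrank
  rw [Module.finrank_fintype_fun_eq_card] at this
  omega

/-- The chain rule. -/
theorem pderiv_aeval {σ ι : Type*} [Fintype ι] (y : ι → MvPolynomial σ ℂ) (j : σ)
    (p : MvPolynomial ι ℂ) :
    pderiv j (aeval y p) = ∑ i, aeval y (pderiv i p) * pderiv j (y i) := by
  classical
  induction p using MvPolynomial.induction_on with
  | C a => simp
  | add p q hp hq => simp only [map_add, hp, hq, add_mul, Finset.sum_add_distrib]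
  | mul_X p k hp =>
    simp only [map_mul, aeval_X, Derivation.leibniz, hp, smul_eq_mul, map_add, pderiv_X, add_mul,
      Finset.sum_add_distrib, Pi.single_apply, apply_ite (aeval y), mul_ite, ite_mul, map_zero,
      mul_zero, zero_mul, mul_one, Finset.mul_sum]
    rw [Finset.sum_ite_eq Finset.univ k]
    simp [mul_assoc]

theorem totalDegree_pderiv_le {σ : Type*} (i : σ) (p : MvPolynomial σ ℂ) {n : ℕ}
    (hp : p.totalDegree ≤ n + 1) : (pderiv i p).totalDegree ≤ n := by
  classical
  refine Finset.sup_le fun m hm => ?_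
  rw [mem_support_iff, coeff_pderiv] at hm
  have h1 := (le_totalDegree (mem_support_iff.2 (left_ne_zero_of_mul hm))).trans hp
  rw [Finsupp.sum_add_index' (fun _ => rfl) (fun _ _ _ => rfl), Finsupp.sum_single_index rfl] at h1
  omega

/-- The Jacobian criterion, at a point where the Jacobian matrix is the identity. -/
theorem algebraicIndependent_of_pderiv {ι : Type*} [Fintype ι] [DecidableEq ι]
    {y : ι → MvPolynomial ι ℂ} (t : ι → ℂ)
    (h : ∀ i j, eval t (pderiv j (y i)) = if i = j then 1 else 0) :
    AlgebraicIndependent ℂ y := by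
  have hdet : (Matrix.of fun i j => pderiv j (y i)).det ≠ 0 := fun h0 => by
    have := congrArg (eval t) h0
    rw [RingHom.map_det, map_zero] at this
    have h1 : (eval t).mapMatrix (Matrix.of fun i j => pderiv j (y i)) = 1 := by
      ext i j
      simp [h, Matrix.one_apply]
    rw [h1, Matrix.det_one] at this
    exact one_ne_zero this
  have key : ∀ n : ℕ, ∀ p : MvPolynomial ι ℂ, p.totalDegree ≤ n → aeval y p = 0 → p = 0 := by
    intro n
    induction n with
    | zero =>
      intro p hp hpy
      rw [totalDegree_eq_zero_iff_eq_C.1 (Nat.le_zero.1 hp)] at hpy ⊢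
      rw [algHom_C, algebraMap_eq, C_eq_zero] at hpy
      rw [hpy, C_0]
    | succ n ih =>
      intro p hp hpy
      have h1 : (fun i => aeval y (pderiv i p)) = 0 := by
        refine Matrix.eq_zero_of_vecMul_eq_zero hdet (funext fun j => ?_)
        have := pderiv_aeval y j p
        rw [hpy, map_zero] at this
        exact this.symm
      have h2 : ∀ i, pderiv i p = 0 := fun i =>
        ih _ (totalDegree_pderiv_le i p hp) (congrFun h1 i)
      refine ih p ?_ hpy
      have : p = C (coeff 0 p) := by
        ext m
        rw [coeff_C]
        split_ifs with hm
        · rw [hm]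
        · obtain ⟨i, hi⟩ : ∃ i, m i ≠ 0 := by
            by_contra! h0
            exact hm (Finsupp.ext h0).symm
          have h3 := X_mul_pderiv_coeff i m p
          rw [h2, mul_zero, coeff_zero, eq_comm, mul_eq_zero] at h3
          exact h3.resolve_left (by exact_mod_cast hi)
      rw [this, totalDegree_C]
      exact Nat.zero_le _
  exact algebraicIndependent_iff.2 fun p => key _ p le_rfl

/-- The transcendence degree of a domain drops when it is divided by a nonzero prime: a nonzero
element `g` of the prime is transcendental over lifts of elements independent modulo the prime. -/
theorem algebraicIndependent_option_of_lt {P ι : Type*} [CommRing P] [Algebra ℂ P] {p q : Ideal P}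
    [p.IsPrime] [q.IsPrime] (hpq : p ≤ q) {g : P} (hgq : g ∈ q) (hgp : g ∉ p) {x : ι → P}
    (hx : AlgebraicIndependent ℂ fun i => Ideal.Quotient.mkₐ ℂ q (x i)) :
    AlgebraicIndependent ℂ fun o : Option ι => Ideal.Quotient.mkₐ ℂ p (o.elim g x) := by
  let π := Ideal.Quotient.factorₐ ℂ hpq
  have hπ : ∀ a, π (Ideal.Quotient.mkₐ ℂ p a) = Ideal.Quotient.mkₐ ℂ q a := fun a => rfl
  have hxp : AlgebraicIndependent ℂ fun i => Ideal.Quotient.mkₐ ℂ p (x i) :=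
    AlgebraicIndependent.of_comp π (by exact hx)
  have := (hxp.option_iff_transcendental (Ideal.Quotient.mkₐ ℂ p g)).2 ?_
  · convert this using 2 with o
    cases o <;> rfl
  intro halg
  have h0 : Ideal.Quotient.mkₐ ℂ p g ≠ 0 := fun h => hgp (Ideal.Quotient.eq_zero_iff_mem.1 h)
  have hmem : Ideal.Quotient.mkₐ ℂ p g ∈ RingHom.ker π :=
    (Ideal.Quotient.eq_zero_iff_mem (I := q)).2 hgq
  refine Ideal.comap_ne_bot_of_algebraic_mem h0 hmem halg ?_
  rw [eq_bot_iff]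
  rintro ⟨a, ha⟩ hab
  have hab' : π a = 0 := hab
  obtain ⟨r, hra⟩ : ∃ r, aeval (fun i => Ideal.Quotient.mkₐ ℂ p (x i)) r = a := by
    rwa [Algebra.adjoin_range_eq_range_aeval] at ha
  have hr : aeval (fun i => Ideal.Quotient.mkₐ ℂ q (x i)) r = 0 := by
    rw [← hab', ← hra]
    exact congrArg (fun f : MvPolynomial ι ℂ →ₐ[ℂ] P ⧸ q => f r)
      (algHom_ext (g := π.comp (aeval fun i => Ideal.Quotient.mkₐ ℂ p (x i))) fun i => by
        rw [aeval_X, AlgHom.comp_apply, aeval_X, hπ])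
  have hr0 := algebraicIndependent_iff.1 hx r hr
  refine Ideal.mem_bot.2 (Subtype.ext ?_)
  exact hra.symm.trans (by rw [hr0, map_zero]; rfl)

/-! ### The vanishing ideal of the cone over an orbit -/

theorem pullbackForm_add (A : Matrix (Fin 3) (Fin 3) ℂ) (v w : Fin 3 → MvPolynomial (Fin 3) ℂ) :
    pullbackForm A (v + w) = pullbackForm A v + pullbackForm A w := by
  funext j
  simp only [pullbackForm, Pi.add_apply, map_add, mul_add, Finset.sum_add_distrib]

theorem pullbackForm_smul_right (A : Matrix (Fin 3) (Fin 3) ℂ) (c : ℂ)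
    (w : Fin 3 → MvPolynomial (Fin 3) ℂ) : pullbackForm A (c • w) = c • pullbackForm A w := by
  funext j
  simp only [pullbackForm, Pi.smul_apply, map_smul, mul_smul_comm, Finset.smul_sum]

/-- The pullback by `A`, as an endomorphism of the space of forms. -/
noncomputable def pullbackHom (d : ℕ) (A : Matrix (Fin 3) (Fin 3) ℂ) :
    OneForms d →ₗ[ℂ] OneForms d where
  toFun w := ⟨pullbackForm A w, pullbackForm_mem A w.2⟩
  map_add' v w := Subtype.ext (pullbackForm_add A v w)
  map_smul' c w := Subtype.ext (pullbackForm_smul_right A c w)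

@[simp]
theorem coe_pullbackHom {d : ℕ} (A : Matrix (Fin 3) (Fin 3) ℂ) (w : OneForms d) :
    (pullbackHom d A w : Fin 3 → MvPolynomial (Fin 3) ℂ) = pullbackForm A w := rfl

theorem pullbackHom_pullbackHom {d : ℕ} (A B : Matrix (Fin 3) (Fin 3) ℂ) (w : OneForms d) :
    pullbackHom d B (pullbackHom d A w) = pullbackHom d (A * B) w :=
  Subtype.ext (pullbackForm_pullbackForm A B w)

theorem pullbackHom_one {d : ℕ} (w : OneForms d) : pullbackHom d 1 w = w :=
  Subtype.ext (pullbackForm_one w)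

theorem subst_smul_one {f : MvPolynomial (Fin 3) ℂ} {n : ℕ} (hf : f.IsHomogeneous n) (c : ℂ) :
    subst (c • 1) f = c ^ n • f := by
  refine MvPolynomial.funext fun v => ?_
  have h : ∀ g, eval v (subst (c • 1) g) = eval (c • v) g := fun g => by
    have : (aeval v).comp (subst (c • 1)) = aeval (c • v) :=
      algHom_ext fun i => by simp [subst, Matrix.one_apply]
    exact DFunLike.congr_fun this g
  rw [h, eval_smul_of_isHomogeneous hf, smul_eval]

theorem pullbackHom_smul_one {d : ℕ} (c : ℂ) (w : OneForms d) :
    pullbackHom d (c • 1) w = c ^ (d + 2) • w := by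
  refine Subtype.ext (funext fun j => ?_)
  simp only [coe_pullbackHom, pullbackForm, subst_smul_one (w.2.1 _), Submodule.coe_smul,
    Pi.smul_apply, Matrix.smul_apply, Matrix.one_apply, smul_eq_mul, mul_ite, mul_one, mul_zero,
    apply_ite C, C_0, ite_mul, zero_mul, Finset.sum_ite_eq', Finset.mem_univ, if_true]
  rw [C_mul', smul_smul]
  ring_nf

theorem pullbackHom_smul {d : ℕ} (a : ℂ) (A : Matrix (Fin 3) (Fin 3) ℂ) (w : OneForms d) :
    pullbackHom d (a • A) w = a ^ (d + 2) • pullbackHom d A w := by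
  rw [← mul_one (a • A), smul_mul_assoc, ← mul_smul_comm, ← pullbackHom_pullbackHom,
    pullbackHom_smul_one]

/-- Since scalar matrices multiply a form by arbitrary constants, the forms `A^* w` form a cone. -/
theorem exists_pullbackHom_eq_smul {d : ℕ} (c : ℂ) (A : Matrix (Fin 3) (Fin 3) ℂ) :
    ∃ a : ℂ, ∀ w : OneForms d, pullbackHom d (a • A) w = c • pullbackHom d A w := by
  obtain ⟨a, ha⟩ := IsAlgClosed.exists_pow_nat_eq c (Nat.succ_pos (d + 1))
  exact ⟨a, fun w => by rw [pullbackHom_smul, ← ha]⟩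

theorem lieForm_mem {d : ℕ} (M : Matrix (Fin 3) (Fin 3) ℂ) {w : Fin 3 → MvPolynomial (Fin 3) ℂ}
    (hw : w ∈ OneForms d) : lieForm M w ∈ OneForms d := by
  obtain ⟨h1, h2⟩ := hw
  refine ⟨fun j => ?_, ?_⟩
  · refine IsHomogeneous.add ?_ (IsHomogeneous.sum _ _ _ fun i _ => ?_)
    · rw [linDeriv_apply]
      refine IsHomogeneous.sum _ _ _ fun i _ => ?_
      have h3 : (∑ j, C (M i j) * X j : MvPolynomial (Fin 3) ℂ).IsHomogeneous 1 :=
        IsHomogeneous.sum _ _ _ fun j _ => by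
          simpa using (isHomogeneous_C (Fin 3) (M i j)).mul (isHomogeneous_X ℂ j)
      simpa [add_comm] using h3.mul ((h1 j).pderiv (i := i))
    · simpa using (isHomogeneous_C (Fin 3) (M i j)).mul (h1 i)
  · have h3 := congrArg (linDeriv M) h2
    simp only [Fin.sum_univ_three, map_add, map_zero, linDeriv_mul, linDeriv_X] at h3
    simp only [lieForm, Fin.sum_univ_three]
    linear_combination h3

theorem exists_formProj (d : ℕ) : ∃ π : (Fin 3 → MvPolynomial (Fin 3) ℂ) →ₗ[ℂ] OneForms d,
    π ∘ₗ (OneForms d).subtype = LinearMap.id :=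
  LinearMap.exists_leftInverse_of_injective _ (Submodule.ker_subtype _)

/-- A linear projection of the space of all triples of polynomials onto the space of forms, chosen
arbitrarily; it extends the linear forms on `OneForms d` to all triples. -/
noncomputable def formProj (d : ℕ) : (Fin 3 → MvPolynomial (Fin 3) ℂ) →ₗ[ℂ] OneForms d :=
  (exists_formProj d).choose

@[simp]
theorem formProj_coe {d : ℕ} (w : OneForms d) : formProj d w = w :=
  DFunLike.congr_fun (exists_formProj d).choose_spec w

/-- The comorphism of the orbit map `A ↦ A^* w`, defined on all matrices. Its kernel is the ideal of
the cone over the orbit. -/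
noncomputable def orbitMap {d : ℕ} (w : OneForms d) :
    MvPolynomial (Module.Dual ℂ (OneForms d)) ℂ →ₐ[ℂ] MvPolynomial (Fin 3 × Fin 3) ℂ :=
  aeval fun l => orbitPoly w (l ∘ₗ formProj d)

theorem eval_orbitMap {d : ℕ} (w : OneForms d) (A : Matrix (Fin 3) (Fin 3) ℂ)
    (P : MvPolynomial (Module.Dual ℂ (OneForms d)) ℂ) :
    eval (fun p => A p.1 p.2) (orbitMap w P) = evalForm P (pullbackHom d A w) := by
  have h : (aeval fun p : Fin 3 × Fin 3 => A p.1 p.2).comp (orbitMap w) =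
      aeval (fun l : Module.Dual ℂ (OneForms d) => l (pullbackHom d A w)) := by
    refine algHom_ext fun l => ?_
    simp only [AlgHom.comp_apply, orbitMap, aeval_X, aeval_eq_eval]
    refine (eval_orbitPoly A w _).trans ?_
    rw [LinearMap.comp_apply, ← coe_pullbackHom, formProj_coe]
  exact DFunLike.congr_fun h P

theorem matDeriv_orbitMap_X {d : ℕ} (w : OneForms d) (M : Matrix (Fin 3) (Fin 3) ℂ)
    (l : Module.Dual ℂ (OneForms d)) :
    matDeriv M (orbitMap w (X l)) = orbitMap ⟨lieForm M w, lieForm_mem M w.2⟩ (X l) := by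
  simp only [orbitMap, aeval_X, matDeriv_orbitPoly]

theorem matDeriv_orbitMap_of_mem_isotropy {d : ℕ} {w : OneForms d}
    {M : Matrix (Fin 3) (Fin 3) ℂ} (hM : M ∈ isotropy (w : Fin 3 → MvPolynomial (Fin 3) ℂ))
    (P : MvPolynomial (Module.Dual ℂ (OneForms d)) ℂ) : matDeriv M (orbitMap w P) = 0 := by
  induction P using MvPolynomial.induction_on with
  | C a => simp [orbitMap]
  | add p q hp hq => simp only [map_add, hp, hq, add_zero]
  | mul_X p l hp =>
    have h0 : matDeriv M (orbitMap w (X l)) = 0 := by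
      refine MvPolynomial.funext fun v => ?_
      rw [matDeriv_orbitMap_X, map_zero]
      refine (eval_orbitMap _ (Matrix.of fun i j => v (i, j)) (X l)).trans ?_
      have : (⟨lieForm M w, lieForm_mem M w.2⟩ : OneForms d) = 0 := Subtype.ext hM
      rw [this, map_zero, evalForm, eval_X, map_zero]
    rw [map_mul, Derivation.leibniz, hp, h0, smul_zero, smul_zero, add_zero]

/-- The vector fields `A ↦ M * A` are independent over the polynomial functions, because the generic
matrix is invertible. -/
theorem linearIndependent_matDeriv {κ : Type*} [Fintype κ] {M : κ → Matrix (Fin 3) (Fin 3) ℂ}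
    (hM : LinearIndependent ℂ M) :
    LinearIndependent (MvPolynomial (Fin 3 × Fin 3) ℂ) fun k => matDeriv (M k) := by
  rw [Fintype.linearIndependent_iff] at hM ⊢
  intro c hc
  let G := Matrix.mvPolynomialX (Fin 3) (Fin 3) ℂ
  let N : Matrix (Fin 3) (Fin 3) (MvPolynomial (Fin 3 × Fin 3) ℂ) :=
    Matrix.of fun i j => ∑ k, c k * C (M k i j)
  have hNG : N * G = 0 := by
    ext1 i j
    have h := DFunLike.congr_fun hc (X (i, j))
    rw [← Derivation.coeFnAddMonoidHom_apply, map_sum] at h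
    simp only [Derivation.coeFnAddMonoidHom_apply, Finset.sum_apply, Derivation.smul_apply,
      matDeriv_X, smul_eq_mul, Derivation.zero_apply, Finset.mul_sum] at h
    rw [Matrix.mul_apply, Matrix.zero_apply, ← h, Finset.sum_comm]
    refine Finset.sum_congr rfl fun k _ => ?_
    simp only [N, G, Matrix.of_apply, Matrix.mvPolynomialX_apply, Finset.sum_mul, mul_assoc]
  have hN : N = 0 := by
    have h1 : G.det • N = 0 := by
      rw [← mul_one (G.det • N), smul_mul_assoc, ← mul_smul_comm, ← Matrix.mul_adjugate,
        ← mul_assoc, hNG, zero_mul]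
    exact (smul_eq_zero.1 h1).resolve_left (Matrix.det_mvPolynomialX_ne_zero _ _)
  have hcoeff : ∀ m k, coeff m (c k) = 0 := fun m => hM (fun k => coeff m (c k)) (by
    ext1 i j
    have h1 := congrArg (coeff m) (congrFun (congrFun hN i) j)
    simp only [N, Matrix.of_apply, coeff_sum, mul_comm (c _), coeff_C_mul, Matrix.zero_apply,
      coeff_zero] at h1
    rw [Matrix.sum_apply]
    simpa [mul_comm] using h1)
  intro k
  ext m
  simpa using hcoeff m k

/-- Algebraic independence modulo the kernel of a homomorphism is algebraic independence of the
images. -/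
theorem algebraicIndependent_mkₐ_ker {P B ι : Type*} [CommRing P] [Algebra ℂ P] [CommRing B]
    [Algebra ℂ B] (φ : P →ₐ[ℂ] B) (x : ι → P) :
    (AlgebraicIndependent ℂ fun i => Ideal.Quotient.mkₐ ℂ (RingHom.ker φ) (x i)) ↔
      AlgebraicIndependent ℂ fun i => φ (x i) := by
  have h1 := comp_aeval x φ
  have h2 := comp_aeval x (Ideal.Quotient.mkₐ ℂ (RingHom.ker φ))
  rw [algebraicIndependent_iff, algebraicIndependent_iff, ← h1, ← h2]
  refine forall_congr' fun p => imp_congr_left ?_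
  exact Ideal.Quotient.eq_zero_iff_mem

/-- The dimension of the cone over an orbit is at most `9` minus the dimension of the isotropy
algebra; the dimension is expressed by algebraically independent functions on the cone. -/
theorem card_add_card_le_of_isotropy {d : ℕ} {w : OneForms d} {ι κ : Type} [Fintype ι] [Fintype κ]
    {M : κ → Matrix (Fin 3) (Fin 3) ℂ} (hM : LinearIndependent ℂ M)
    (hMw : ∀ k, M k ∈ isotropy (w : Fin 3 → MvPolynomial (Fin 3) ℂ))
    {x : ι → MvPolynomial (Module.Dual ℂ (OneForms d)) ℂ}
    (hx : AlgebraicIndependent ℂ fun i => Ideal.Quotient.mkₐ ℂ (RingHom.ker (orbitMap w)) (x i)) :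
    Fintype.card ι + Fintype.card κ ≤ 9 := by
  have hx' : AlgebraicIndependent ℂ fun i => orbitMap w (x i) :=
    (algebraicIndependent_mkₐ_ker (orbitMap w) x).1 hx
  exact (card_add_card_le_of_derivation (linearIndependent_matDeriv hM) hx' fun k i =>
    matDeriv_orbitMap_of_mem_isotropy (hMw k) _).trans (by simp)

/-! ### The orbit map near the identity -/

/-- The restriction of a polynomial function on matrices to the span of a family of matrices. -/
noncomputable def restrictMat {ι : Type*} [Fintype ι] (b : ι → Matrix (Fin 3) (Fin 3) ℂ) :
    MvPolynomial (Fin 3 × Fin 3) ℂ →ₐ[ℂ] MvPolynomial ι ℂ :=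
  aeval fun p => ∑ j, C (b j p.1 p.2) * X j

theorem eval_restrictMat {ι : Type*} [Fintype ι] (b : ι → Matrix (Fin 3) (Fin 3) ℂ) (t : ι → ℂ)
    (g : MvPolynomial (Fin 3 × Fin 3) ℂ) :
    eval t (restrictMat b g) = eval (fun p => (∑ j, t j • b j) p.1 p.2) g := by
  have h : (aeval t).comp (restrictMat b) = aeval fun p => (∑ j, t j • b j) p.1 p.2 := by
    refine algHom_ext fun p => ?_
    simp [restrictMat, Matrix.sum_apply, mul_comm]
  exact DFunLike.congr_fun h g

/-- At the identity, the partial derivative in the direction of `b j` is the derivation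
`matDeriv (b j)`. -/
theorem eval_pderiv_restrictMat {ι : Type*} [Fintype ι] {b : ι → Matrix (Fin 3) (Fin 3) ℂ}
    {t : ι → ℂ} (ht : ∑ j, t j • b j = 1) (j : ι) (g : MvPolynomial (Fin 3 × Fin 3) ℂ) :
    eval t (pderiv j (restrictMat b g)) =
      eval (fun p => (1 : Matrix (Fin 3) (Fin 3) ℂ) p.1 p.2) (matDeriv (b j) g) := by
  classical
  induction g using MvPolynomial.induction_on with
  | C a => simp [restrictMat]
  | add p q hp hq => simp only [map_add, hp, hq]
  | mul_X p i hp =>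
    have hX : eval t (pderiv j (restrictMat b (X i))) =
        eval (fun p => (1 : Matrix (Fin 3) (Fin 3) ℂ) p.1 p.2) (matDeriv (b j) (X i)) := by
      simp [restrictMat, pderiv_X, Pi.single_apply, Matrix.one_apply]
    simp only [map_mul, Derivation.leibniz, smul_eq_mul, map_add, hp, hX]
    rw [eval_restrictMat, eval_restrictMat, ht]

/-- The infinitesimal action on a form, as a linear map in the matrix; it is the differential of the
orbit map at the identity. -/
noncomputable def lieHom {d : ℕ} (w : OneForms d) :
    Matrix (Fin 3) (Fin 3) ℂ →ₗ[ℂ] OneForms d where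
  toFun M := ⟨lieForm M w, lieForm_mem M w.2⟩
  map_add' M N := Subtype.ext (lieForm_add M N w)
  map_smul' c M := Subtype.ext (lieForm_smul c M w)

theorem ker_lieHom {d : ℕ} (w : OneForms d) :
    LinearMap.ker (lieHom w) = isotropy (w : Fin 3 → MvPolynomial (Fin 3) ℂ) := by
  ext M
  rw [LinearMap.mem_ker, mem_isotropy]
  exact Subtype.ext_iff

/-- On a linear space of matrices that contains the identity and is transverse to the isotropy
algebra, the orbit map is generically immersive. -/
theorem exists_algebraicIndependent_restrictMat {d : ℕ} {w : OneForms d} {ι : Type*} [Fintype ι]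
    {b : ι → Matrix (Fin 3) (Fin 3) ℂ} (hb : LinearIndependent ℂ b)
    (h1 : 1 ∈ Submodule.span ℂ (Set.range b))
    (hbw : Disjoint (Submodule.span ℂ (Set.range b))
      (isotropy (w : Fin 3 → MvPolynomial (Fin 3) ℂ))) :
    ∃ x : ι → MvPolynomial (Module.Dual ℂ (OneForms d)) ℂ,
      AlgebraicIndependent ℂ fun i => restrictMat b (orbitMap w (x i)) := by
  classical
  obtain ⟨t, ht⟩ := (Submodule.mem_span_range_iff_exists_fun ℂ).1 h1
  rw [← ker_lieHom] at hbw
  have hv : LinearIndependent ℂ (lieHom w ∘ b) := hb.map hbw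
  obtain ⟨g, hg⟩ := LinearMap.exists_leftInverse_of_injective
    (Fintype.linearCombination ℂ (lieHom w ∘ b)) (by
      rw [LinearMap.ker_eq_bot]
      exact hv.fintypeLinearCombination_injective)
  have hg' : ∀ i j, g (lieHom w (b j)) i = if i = j then 1 else 0 := fun i j => by
    have := congrFun (DFunLike.congr_fun hg (Pi.single j 1)) i
    rw [LinearMap.comp_apply, Fintype.linearCombination_apply_single, one_smul] at this
    exact this.trans (by simp [Pi.single_apply])
  refine ⟨fun i => X (LinearMap.proj i ∘ₗ g), algebraicIndependent_of_pderiv t fun i j => ?_⟩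
  rw [eval_pderiv_restrictMat ht, matDeriv_orbitMap_X, eval_orbitMap, pullbackHom_one, evalForm,
    eval_X]
  exact hg' i j

/-! ### Orbits are open in their closures -/

/-- **Chevalley's theorem**, for points over `ℂ`: the image of the open set `δ ≠ 0` under a morphism
contains a nonempty open subset of the closure of the image. -/
theorem exists_forall_exists_algHom {P B : Type} [CommRing P] [Algebra ℂ P] [CommRing B] [IsDomain B]
    [Algebra ℂ B] [Algebra.FiniteType ℂ B] (φ : P →ₐ[ℂ] B) (hφ : φ.range.FG) {δ : B} (hδ : δ ≠ 0) :
    ∃ h, φ h ≠ 0 ∧ ∀ χ : P →ₐ[ℂ] ℂ, RingHom.ker φ ≤ RingHom.ker χ → χ h ≠ 0 →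
      ∃ ψ : B →ₐ[ℂ] ℂ, ψ δ ≠ 0 ∧ ψ.comp φ = χ := by
  have hA : Algebra.FiniteType ℂ φ.range := Subalgebra.fg_iff_finiteType _ |>.1 hφ
  have hnoeth : IsNoetherianRing φ.range := Algebra.FiniteType.isNoetherianRing ℂ _
  let B' := Localization.Away δ
  have hB'fin : Algebra.FiniteType B B' := IsLocalization.finiteType_of_monoid_fg (.powers δ) _
  have hB' : Algebra.FiniteType ℂ B' := Algebra.FiniteType.trans ‹_› hB'fin
  have hB'A : Algebra.FiniteType φ.range B' :=
    Algebra.FiniteType.of_restrictScalars_finiteType ℂ φ.range B'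
  have hinj : Function.Injective (algebraMap B B') :=
    IsLocalization.injective B' (powers_le_nonZeroDivisors_of_noZeroDivisors hδ)
  have hdom : IsDomain B' :=
    IsLocalization.isDomain_localization (powers_le_nonZeroDivisors_of_noZeroDivisors hδ)
  have hfp : (algebraMap φ.range B').FinitePresentation :=
    RingHom.FinitePresentation.of_finiteType.1 (RingHom.finiteType_algebraMap.2 hB'A)
  obtain ⟨S, hS⟩ := PrimeSpectrum.exists_constructibleSetData_iff.2
    (PrimeSpectrum.isConstructible_range_comap hfp)
  have hinjA : Function.Injective (algebraMap φ.range B') := hinj.comp Subtype.val_injective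
  -- the constructible image contains the generic point, hence a nonempty open set
  have hbot : (⟨⊥, Ideal.isPrime_bot⟩ : PrimeSpectrum φ.range) ∈ S.toSet := by
    rw [hS]
    refine ⟨⟨⊥, Ideal.isPrime_bot⟩, PrimeSpectrum.ext ?_⟩
    exact (RingHom.injective_iff_ker_eq_bot _).1 hinjA
  simp only [PrimeSpectrum.ConstructibleSetData.toSet, Set.mem_iUnion] at hbot
  obtain ⟨D, hDS, hD⟩ := hbot
  have hDf : D.f ≠ 0 := fun h0 => hD.2 (by simp [h0])
  have hDg : ∀ i, D.g i = 0 := fun i => hD.1 (Set.mem_range_self i)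
  obtain ⟨h, hh⟩ := φ.rangeRestrict_surjective D.f
  refine ⟨h, fun h0 => hDf (hh ▸ Subtype.ext h0), fun χ hχ hχh => ?_⟩
  -- the point of the image of `φ` defined by `χ`
  let χ' := RingHom.liftOfSurjective φ.rangeRestrict.toRingHom φ.rangeRestrict_surjective
    ⟨χ.toRingHom, fun a ha => hχ (congrArg Subtype.val ha)⟩
  have hχ' : ∀ a, χ' (φ.rangeRestrict a) = χ a := fun a =>
    RingHom.liftOfSurjective_comp_apply _ _ _ _
  have hmem : (⟨RingHom.ker χ', RingHom.ker_isPrime χ'⟩ : PrimeSpectrum φ.range) ∈ S.toSet := by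
    rw [PrimeSpectrum.ConstructibleSetData.toSet]
    refine Set.mem_biUnion hDS ⟨?_, fun h0 => hχh ?_⟩
    · rintro _ ⟨i, rfl⟩
      rw [hDg i]
      exact map_zero χ'
    · rw [← hχ', hh]
      exact h0 rfl
  rw [hS] at hmem
  obtain ⟨q, hq⟩ := hmem
  obtain ⟨m, hm, hqm⟩ := Ideal.exists_le_maximal q.asIdeal q.isPrime.ne_top
  let _ : Field (B' ⧸ m) := Ideal.Quotient.field m
  have hfin : Module.Finite ℂ (B' ⧸ m) := finite_of_finite_type_of_isJacobsonRing ℂ (B' ⧸ m)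
  have hbij := IsAlgClosed.algebraMap_bijective_of_isIntegral (k := ℂ) (K := B' ⧸ m)
  let e := AlgEquiv.ofBijective (Algebra.ofId ℂ (B' ⧸ m)) hbij
  let ψ' : B' →ₐ[ℂ] ℂ := e.symm.toAlgHom.comp (Ideal.Quotient.mkₐ ℂ m)
  let ψ : B →ₐ[ℂ] ℂ := ψ'.comp (IsScalarTower.toAlgHom ℂ B B')
  refine ⟨ψ, fun h0 => ?_, AlgHom.ext fun a => ?_⟩
  · have hu : IsUnit (algebraMap B B' δ) := IsLocalization.Away.algebraMap_isUnit δ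
    exact (hu.map ψ').ne_zero h0
  · have h1 : φ.rangeRestrict (a - algebraMap ℂ P (χ a)) ∈ RingHom.ker χ' := by
      rw [RingHom.mem_ker, hχ', map_sub, AlgHom.commutes]
      exact sub_self _
    have h2 : φ.rangeRestrict (a - algebraMap ℂ P (χ a)) ∈
        (PrimeSpectrum.comap (algebraMap φ.range B') q).asIdeal := by
      rw [hq]
      exact h1
    have h3 : ψ (φ (a - algebraMap ℂ P (χ a))) = 0 := by
      have h4 : Ideal.Quotient.mkₐ ℂ m (algebraMap B B' (φ (a - algebraMap ℂ P (χ a)))) = 0 :=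
        Ideal.Quotient.eq_zero_iff_mem.2 (hqm h2)
      change e.symm (Ideal.Quotient.mkₐ ℂ m (algebraMap B B' _)) = 0
      rw [h4, map_zero]
    rw [map_sub, map_sub, AlgHom.commutes, AlgHom.commutes, sub_eq_zero] at h3
    exact h3

/-- The ring of functions on the cone over an orbit is finitely generated, although `orbitMap` is
defined on the polynomial ring in all linear forms. -/
theorem range_orbitMap_fg {d : ℕ} (w : OneForms d) : (orbitMap w).range.FG := by
  obtain ⟨s, hs, hsw⟩ := exists_finite_orbitPoly_mem_span (w : Fin 3 → MvPolynomial (Fin 3) ℂ)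
  let r := Set.range fun l : Module.Dual ℂ (OneForms d) => orbitPoly w (l ∘ₗ formProj d)
  have hr : Submodule.span ℂ r ≤ Submodule.span ℂ s := by
    rw [Submodule.span_le]
    rintro _ ⟨l, rfl⟩
    exact hsw _
  have : Module.Finite ℂ (Submodule.span ℂ s) := Module.Finite.span_of_finite ℂ hs
  have : Module.Finite ℂ (Submodule.span ℂ r) := Submodule.finiteDimensional_of_le hr
  obtain ⟨t, ht⟩ : (Submodule.span ℂ r).FG := Module.Finite.iff_fg.1 this
  refine ⟨t, ?_⟩
  rw [← Algebra.adjoin_span, ht, Algebra.adjoin_span, Algebra.adjoin_range_eq_range_aeval]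
  rfl

/-- An orbit contains a nonempty open subset of its closure. -/
theorem exists_forall_exists_eq_pullbackHom {d : ℕ} (w : OneForms d) :
    ∃ h ∉ RingHom.ker (orbitMap w), ∀ v : OneForms d,
      (∀ P ∈ RingHom.ker (orbitMap w), evalForm P v = 0) → evalForm h v ≠ 0 →
      ∃ A : GL (Fin 3) ℂ, pullbackHom d A.1 w = v := by
  obtain ⟨h, hh, H⟩ := exists_forall_exists_algHom (orbitMap w) (range_orbitMap_fg w)
    (Matrix.det_mvPolynomialX_ne_zero (Fin 3) ℂ)
  refine ⟨h, hh, fun v hv hhv => ?_⟩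
  obtain ⟨ψ, hψ, hψw⟩ := H (aeval fun l => l v) hv hhv
  let A : Matrix (Fin 3) (Fin 3) ℂ := Matrix.of fun i j => ψ (X (i, j))
  have hψA : ∀ g, ψ g = eval (fun p => A p.1 p.2) g := fun g => by
    have : ψ = aeval fun p => A p.1 p.2 := algHom_ext fun p => by simp [A]
    exact DFunLike.congr_fun this g
  have hA : IsUnit A := by
    rw [Matrix.isUnit_iff_isUnit_det, isUnit_iff_ne_zero]
    convert hψ
    rw [AlgHom.map_det]
    congr 1
  refine ⟨hA.unit, ?_⟩
  rw [hA.unit_spec, ← sub_eq_zero, ← Module.forall_dual_apply_eq_zero_iff ℂ]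
  intro l
  have h1 := DFunLike.congr_fun hψw (X l)
  rw [AlgHom.comp_apply, hψA, eval_orbitMap, evalForm, eval_X, aeval_X] at h1
  rw [map_sub, h1, sub_self]

/-! ### Closed sets of foliations and orbit closures -/

theorem isClosed_foliation_iff {d : ℕ} {Z : Set (Foliation d)} :
    IsClosed Z ↔ ∃ T : Set (MvPolynomial (Module.Dual ℂ (OneForms d)) ℂ),
      (∀ P ∈ T, ∃ n : ℕ, P.IsHomogeneous n) ∧ ∀ F, F ∈ Z ↔ ∀ P ∈ T, evalForm P F.form = 0 := by
  have hclosed : ∀ S : Set (ℙ ℂ (OneForms d)), @IsClosed _ (zariski (OneForms d)) S ↔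
      ∃ T : Set (MvPolynomial (Module.Dual ℂ (OneForms d)) ℂ),
        (∀ P ∈ T, ∃ n : ℕ, P.IsHomogeneous n) ∧ S = zeroLocus T := fun S => by
    rw [← @isOpen_compl_iff _ _ (zariski (OneForms d))]
    change Sᶜᶜ ∈ _ ↔ _
    rw [compl_compl]
    exact Iff.rfl
  refine (@isClosed_induced_iff _ _ (zariski (OneForms d)) Z Subtype.val).trans ?_
  constructor
  · rintro ⟨S, hS, rfl⟩
    obtain ⟨T, hT, rfl⟩ := (hclosed S).1 hS
    exact ⟨T, hT, fun F => Iff.rfl⟩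
  · rintro ⟨T, hT, hZ⟩
    exact ⟨zeroLocus T, (hclosed _).2 ⟨T, hT, rfl⟩, Set.ext fun F => (hZ F).symm⟩

theorem Foliation.form_ne_zero {d : ℕ} (F : Foliation d) : F.form ≠ 0 := F.1.rep_nonzero

theorem Foliation.exists_form_ofForm {d : ℕ} (w : OneForms d)
    (h : NoCommonFactor (w : Fin 3 → MvPolynomial (Fin 3) ℂ)) :
    ∃ c : ℂ, c ≠ 0 ∧ (ofForm w h).form = c • w := by
  obtain ⟨a, ha⟩ := Projectivization.exists_smul_eq_mk_rep ℂ w h.ne_zero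
  exact ⟨a, a.ne_zero, ha.symm⟩

theorem Foliation.exists_form_pullback {d : ℕ} (A : GL (Fin 3) ℂ) (F : Foliation d) :
    ∃ c : ℂ, c ≠ 0 ∧ (F.pullback A).form = c • pullbackHom d A.1 F.form :=
  exists_form_ofForm _ _

theorem exists_GL_pullbackHom_eq_smul {d : ℕ} {c : ℂ} (hc : c ≠ 0) (A : GL (Fin 3) ℂ) :
    ∃ B : GL (Fin 3) ℂ, ∀ w : OneForms d, pullbackHom d B.1 w = c • pullbackHom d A.1 w := by
  obtain ⟨a, ha⟩ := IsAlgClosed.exists_pow_nat_eq c (Nat.succ_pos (d + 1))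
  have ha0 : a ≠ 0 := by
    rintro rfl
    rw [zero_pow (Nat.succ_ne_zero _)] at ha
    exact hc ha.symm
  refine ⟨⟨a • A.1, a⁻¹ • A.2, ?_, ?_⟩, fun w => ?_⟩
  · rw [smul_mul_smul_comm, A.3, mul_inv_cancel₀ ha0, one_smul]
  · rw [smul_mul_smul_comm, A.4, inv_mul_cancel₀ ha0, one_smul]
  · rw [← ha]
    exact pullbackHom_smul a A.1 w

/-- The form of a foliation is chosen up to a constant, which a scalar matrix can absorb. -/
theorem mem_orbit_iff {d : ℕ} {F G : Foliation d} :
    G ∈ orbit F ↔ ∃ A : GL (Fin 3) ℂ, pullbackHom d A.1 F.form = G.form := by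
  constructor
  · rintro ⟨A, rfl⟩
    obtain ⟨c, hc, h⟩ := F.exists_form_pullback A
    obtain ⟨B, hB⟩ := exists_GL_pullbackHom_eq_smul hc A
    exact ⟨B, by rw [hB]; exact h.symm⟩
  · rintro ⟨A, hA⟩
    refine ⟨A, Subtype.ext ?_⟩
    rw [← Projectivization.mk_rep G.1]
    change Projectivization.mk ℂ (pullbackHom d A.1 F.form) _ = _
    congr 1

theorem mem_orbit_of_pullbackHom_eq_smul {d : ℕ} {F G : Foliation d} {A : GL (Fin 3) ℂ} {c : ℂ}
    (hc : c ≠ 0) (h : pullbackHom d A.1 F.form = c • G.form) : G ∈ orbit F := by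
  obtain ⟨B, hB⟩ := exists_GL_pullbackHom_eq_smul (d := d) (inv_ne_zero hc) A
  exact mem_orbit_iff.2 ⟨B, by rw [hB, h, smul_smul, inv_mul_cancel₀ hc, one_smul]⟩

theorem mem_orbit_symm {d : ℕ} {F G : Foliation d} (h : G ∈ orbit F) : F ∈ orbit G := by
  obtain ⟨A, hA⟩ := mem_orbit_iff.1 h
  refine mem_orbit_iff.2 ⟨A⁻¹, ?_⟩
  rw [← hA, pullbackHom_pullbackHom]
  exact (congrArg (fun B => pullbackHom d B F.form) A.3).trans (pullbackHom_one _)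

theorem orbit_subset_of_mem {d : ℕ} {F G : Foliation d} (h : G ∈ orbit F) :
    orbit G ⊆ orbit F := fun H hH => by
  obtain ⟨A, hA⟩ := mem_orbit_iff.1 h
  obtain ⟨B, hB⟩ := mem_orbit_iff.1 hH
  exact mem_orbit_iff.2 ⟨A * B, by rw [← hB, ← hA, pullbackHom_pullbackHom]; rfl⟩

theorem orbit_eq_of_mem {d : ℕ} {F G : Foliation d} (h : G ∈ orbit F) : orbit G = orbit F :=
  (orbit_subset_of_mem h).antisymm (orbit_subset_of_mem (mem_orbit_symm h))

section EvalForm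

variable {V : Type*} [AddCommGroup V] [Module ℂ V]

/-- The decomposition of a polynomial into its homogeneous components, along a line. -/
theorem evalForm_smul_eq_sum (P : MvPolynomial (Module.Dual ℂ V) ℂ) (c : ℂ) (v : V) :
    evalForm P (c • v) =
      ∑ n ∈ Finset.range (P.totalDegree + 1), c ^ n * evalForm (homogeneousComponent n P) v := by
  conv_lhs => rw [← sum_homogeneousComponent P]
  simp only [← evalForm_smul (homogeneousComponent_isHomogeneous _ P)]
  exact map_sum (eval _) _ _

theorem evalForm_homogeneousComponent_eq_zero {P : MvPolynomial (Module.Dual ℂ V) ℂ} {v : V}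
    (h : ∀ c : ℂ, evalForm P (c • v) = 0) (n : ℕ) :
    evalForm (homogeneousComponent n P) v = 0 := by
  rcases lt_or_ge P.totalDegree n with hn | hn
  · rw [homogeneousComponent_eq_zero _ _ hn]
    exact map_zero (eval _)
  · have h0 : ∑ n ∈ Finset.range (P.totalDegree + 1),
        Polynomial.C (evalForm (homogeneousComponent n P) v) * Polynomial.X ^ n = 0 := by
      refine Polynomial.funext fun c => ?_
      rw [Polynomial.eval_finsetSum, Polynomial.eval_zero, ← h c, evalForm_smul_eq_sum]
      refine Finset.sum_congr rfl fun n _ => ?_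
      rw [Polynomial.eval_mul, Polynomial.eval_C, Polynomial.eval_pow, Polynomial.eval_X, mul_comm]
    have h1 := congrArg (Polynomial.coeff · n) h0
    simpa [Polynomial.finsetSum_coeff, Polynomial.coeff_C_mul, Polynomial.coeff_X_pow,
      Nat.lt_succ_of_le hn] using h1

theorem evalForm_eq_zero_of_homogeneousComponent {P : MvPolynomial (Module.Dual ℂ V) ℂ} {v : V}
    (h : ∀ n, evalForm (homogeneousComponent n P) v = 0) (c : ℂ) : evalForm P (c • v) = 0 := by
  rw [evalForm_smul_eq_sum]
  exact Finset.sum_eq_zero fun n _ => by rw [h, mul_zero]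

theorem evalForm_rename (φ : V →ₗ[ℂ] V) (P : MvPolynomial (Module.Dual ℂ V) ℂ) (v : V) :
    evalForm (rename (fun l => l ∘ₗ φ) P) v = evalForm P (φ v) := by
  rw [evalForm, eval_rename]
  rfl

end EvalForm

theorem mem_ker_orbitMap_iff {d : ℕ} {w : OneForms d}
    {P : MvPolynomial (Module.Dual ℂ (OneForms d)) ℂ} :
    P ∈ RingHom.ker (orbitMap w) ↔ ∀ A : GL (Fin 3) ℂ, evalForm P (pullbackHom d A.1 w) = 0 := by
  constructor
  · intro h A
    rw [← eval_orbitMap, (RingHom.mem_ker).1 h, map_zero]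
  · intro h
    have h0 : (Matrix.mvPolynomialX (Fin 3) (Fin 3) ℂ).det * orbitMap w P = 0 := by
      refine MvPolynomial.funext fun v => ?_
      let A : Matrix (Fin 3) (Fin 3) ℂ := Matrix.of fun i j => v (i, j)
      have hv : v = fun p => A p.1 p.2 := rfl
      rw [map_mul, map_zero, mul_eq_zero, or_iff_not_imp_left]
      intro hdet
      have hA : IsUnit A := by
        rw [Matrix.isUnit_iff_isUnit_det, isUnit_iff_ne_zero]
        convert hdet
        rw [RingHom.map_det]
        congr 1
        ext i j
        simp [A]
      rw [hv, eval_orbitMap]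
      exact h hA.unit
    exact (mul_eq_zero.1 h0).resolve_left (Matrix.det_mvPolynomialX_ne_zero _ _)

theorem homogeneousComponent_mem_ker_orbitMap {d : ℕ} {w : OneForms d}
    {P : MvPolynomial (Module.Dual ℂ (OneForms d)) ℂ} (h : P ∈ RingHom.ker (orbitMap w)) (n : ℕ) :
    homogeneousComponent n P ∈ RingHom.ker (orbitMap w) := by
  refine mem_ker_orbitMap_iff.2 fun A => evalForm_homogeneousComponent_eq_zero (fun c => ?_) n
  obtain ⟨a, ha⟩ := exists_pullbackHom_eq_smul (d := d) c A.1
  rw [← ha, ← eval_orbitMap, (RingHom.mem_ker).1 h, map_zero]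

/-- The closure of an orbit is the zero set of the kernel of the orbit map. -/
theorem mem_closure_orbit_iff {d : ℕ} {F G : Foliation d} :
    G ∈ closure (orbit F) ↔ ∀ P ∈ RingHom.ker (orbitMap F.form), evalForm P G.form = 0 := by
  constructor
  · intro hG P hP
    let Z : Set (Foliation d) := {H | ∀ Q ∈ {Q | Q ∈ RingHom.ker (orbitMap F.form) ∧
      ∃ n : ℕ, Q.IsHomogeneous n}, evalForm Q H.form = 0}
    have hZ : IsClosed Z := isClosed_foliation_iff.2 ⟨_, fun Q hQ => hQ.2, fun H => Iff.rfl⟩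
    have hFZ : orbit F ⊆ Z := fun H hH Q hQ => by
      obtain ⟨A, hA⟩ := mem_orbit_iff.1 hH
      rw [← hA]
      exact mem_ker_orbitMap_iff.1 hQ.1 A
    have hGZ := closure_minimal hFZ hZ hG
    rw [← one_smul ℂ G.form]
    exact evalForm_eq_zero_of_homogeneousComponent (fun n => hGZ _
      ⟨homogeneousComponent_mem_ker_orbitMap hP n, n, homogeneousComponent_isHomogeneous n P⟩) 1
  · intro h
    refine Set.mem_sInter.2 fun Z hZ => ?_
    obtain ⟨T, hT, hZT⟩ := isClosed_foliation_iff.1 hZ.1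
    refine (hZT G).2 fun P hP => h P (mem_ker_orbitMap_iff.2 fun A => ?_)
    obtain ⟨n, hn⟩ := hT P hP
    obtain ⟨c, hc, hcA⟩ := F.exists_form_pullback A
    have h1 := (hZT _).1 (hZ.2 ⟨A, rfl⟩) P hP
    rw [hcA, evalForm_smul hn, mul_eq_zero] at h1
    exact h1.resolve_left (pow_ne_zero _ hc)

theorem ker_orbitMap_le_of_mem_closure {d : ℕ} {F G : Foliation d} (hG : G ∈ closure (orbit F)) :
    RingHom.ker (orbitMap F.form) ≤ RingHom.ker (orbitMap G.form) := fun P hP => by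
  refine mem_ker_orbitMap_iff.2 fun A => ?_
  rw [← evalForm_rename]
  refine mem_closure_orbit_iff.1 hG _ (mem_ker_orbitMap_iff.2 fun B => ?_)
  rw [evalForm_rename, pullbackHom_pullbackHom]
  exact mem_ker_orbitMap_iff.1 hP (B * A)

theorem orbit_subset_closure_of_mem_closure {d : ℕ} {F G : Foliation d}
    (hG : G ∈ closure (orbit F)) : orbit G ⊆ closure (orbit F) := fun H hH => by
  obtain ⟨A, hA⟩ := mem_orbit_iff.1 hH
  refine mem_closure_orbit_iff.2 fun P hP => ?_
  rw [← hA]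
  exact mem_ker_orbitMap_iff.1 (ker_orbitMap_le_of_mem_closure hG hP) A

/-- The ideal of the cone over an orbit in the boundary is strictly larger: otherwise
both orbits would have the same closure, and the open subset of it that lies in the first orbit would
meet the second. -/
theorem exists_mem_ker_orbitMap_of_mem_closure {d : ℕ} {F G : Foliation d}
    (hG : G ∈ closure (orbit F)) (hGF : G ∉ orbit F) :
    ∃ P ∈ RingHom.ker (orbitMap G.form), P ∉ RingHom.ker (orbitMap F.form) := by
  by_contra! hle
  obtain ⟨h, hhF, H⟩ := exists_forall_exists_eq_pullbackHom F.form
  have hhG := fun h1 => hhF (hle h h1)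
  obtain ⟨A, hA⟩ := not_forall.1 (mt mem_ker_orbitMap_iff.2 hhG)
  obtain ⟨B, hB⟩ := H _
    (fun P hP => mem_ker_orbitMap_iff.1 (ker_orbitMap_le_of_mem_closure hG hP) A) hA
  refine hGF (mem_orbit_iff.2 ⟨B * A⁻¹, ?_⟩)
  have h1 : pullbackHom d (A⁻¹).1 (pullbackHom d A.1 G.form) = G.form := by
    rw [pullbackHom_pullbackHom]
    exact (congrArg (fun B => pullbackHom d B G.form) A.3).trans (pullbackHom_one _)
  rw [← h1, ← hB, pullbackHom_pullbackHom]
  rfl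

/-! ### The dimension of an orbit from above -/

/-- The ideal of the cone over a set of foliations: the polynomials, homogeneous or not, that vanish
on all multiples of their forms. -/
noncomputable def coneIdeal {d : ℕ} (Z : Set (Foliation d)) :
    Ideal (MvPolynomial (Module.Dual ℂ (OneForms d)) ℂ) where
  carrier := {P | ∀ F ∈ Z, ∀ c : ℂ, evalForm P (c • F.form) = 0}
  zero_mem' := fun _ _ _ => map_zero (eval _)
  add_mem' := fun {P Q} hP hQ F hF c =>
    (map_add (eval _) P Q).trans (by
      rw [show eval _ P = 0 from hP F hF c, show eval _ Q = 0 from hQ F hF c, add_zero])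
  smul_mem' := fun P Q hQ F hF c =>
    (map_mul (eval _) P Q).trans (by rw [show eval _ Q = 0 from hQ F hF c, mul_zero])

theorem mem_coneIdeal {d : ℕ} {Z : Set (Foliation d)}
    {P : MvPolynomial (Module.Dual ℂ (OneForms d)) ℂ} :
    P ∈ coneIdeal Z ↔ ∀ F ∈ Z, ∀ c : ℂ, evalForm P (c • F.form) = 0 := Iff.rfl

theorem isOpen_setOf_exists_evalForm_smul_ne_zero {d : ℕ}
    (P : MvPolynomial (Module.Dual ℂ (OneForms d)) ℂ) :
    IsOpen {F : Foliation d | ∃ c : ℂ, evalForm P (c • F.form) ≠ 0} := by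
  rw [← isClosed_compl_iff, isClosed_foliation_iff]
  refine ⟨Set.range fun n => homogeneousComponent n P, ?_, fun F => ?_⟩
  · rintro _ ⟨n, rfl⟩
    exact ⟨n, homogeneousComponent_isHomogeneous n P⟩
  · simp only [Set.mem_compl_iff, Set.mem_ofPred_eq, not_exists, not_not, Set.forall_mem_range]
    exact ⟨evalForm_homogeneousComponent_eq_zero, evalForm_eq_zero_of_homogeneousComponent⟩

theorem coneIdeal_isPrime {d : ℕ} {Z : Set (Foliation d)} (hZ : IsIrreducible Z) :
    (coneIdeal Z).IsPrime := by
  refine ⟨fun h => ?_, fun {P Q} hPQ => ?_⟩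
  · obtain ⟨F, hF⟩ := hZ.nonempty
    have h1 := (Ideal.eq_top_iff_one _).1 h F hF 1
    rw [evalForm, map_one] at h1
    exact one_ne_zero h1
  · by_contra! hne
    simp only [mem_coneIdeal, not_forall] at hne
    obtain ⟨⟨F, hF, hFP⟩, G, hG, hGQ⟩ := hne
    obtain ⟨H, hH, ⟨a, ha⟩, b, hb⟩ := hZ.2 _ _ (isOpen_setOf_exists_evalForm_smul_ne_zero P)
      (isOpen_setOf_exists_evalForm_smul_ne_zero Q) ⟨F, hF, hFP⟩ ⟨G, hG, hGQ⟩
    -- restriction to the line of the cone over the foliation `H`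
    let ρ : MvPolynomial (Module.Dual ℂ (OneForms d)) ℂ →ₐ[ℂ] Polynomial ℂ :=
      aeval fun l => Polynomial.C (l H.form) * Polynomial.X
    have hρ : ∀ R c, (ρ R).eval c = evalForm R (c • H.form) := fun R c => by
      have : (Polynomial.aeval c).comp ρ =
          aeval (fun l : Module.Dual ℂ (OneForms d) => l (c • H.form)) :=
        algHom_ext fun l => by
          rw [AlgHom.comp_apply, aeval_X, aeval_X, map_mul, Polynomial.aeval_C, Polynomial.aeval_X,
            map_smul, smul_eq_mul, mul_comm, Algebra.algebraMap_self_apply]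
      exact DFunLike.congr_fun this R
    have h0 : ρ P * ρ Q = 0 := by
      rw [← map_mul]
      refine Polynomial.funext fun c => ?_
      rw [hρ, Polynomial.eval_zero]
      exact hPQ H hH c
    rcases mul_eq_zero.1 h0 with h0 | h0
    · exact ha (by rw [← hρ, h0, Polynomial.eval_zero])
    · exact hb (by rw [← hρ, h0, Polynomial.eval_zero])

theorem exists_evalForm_of_isClosed_subtype {d : ℕ} {T : Set (Foliation d)} {Z : Set T}
    (hZ : IsClosed Z) {F : T} (hF : F ∉ Z) :
    ∃ (P : MvPolynomial (Module.Dual ℂ (OneForms d)) ℂ) (n : ℕ), P.IsHomogeneous n ∧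
      evalForm P F.1.form ≠ 0 ∧ ∀ G ∈ Z, evalForm P G.1.form = 0 := by
  obtain ⟨C, hC, rfl⟩ := isClosed_induced_iff.1 hZ
  obtain ⟨S, hS, hSC⟩ := isClosed_foliation_iff.1 hC
  have h1 : ¬∀ P ∈ S, evalForm P F.1.form = 0 := mt (hSC F.1).2 hF
  push Not at h1
  obtain ⟨P, hP, hPF⟩ := h1
  obtain ⟨n, hn⟩ := hS P hP
  exact ⟨P, n, hn, hPF, fun G hG => (hSC G.1).1 hG P hP⟩

theorem exists_mem_coneIdeal_of_lt {d : ℕ} {T : Set (Foliation d)}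
    {Z Z' : TopologicalSpace.IrreducibleCloseds T} (h : Z < Z') :
    ∃ P ∈ coneIdeal (Subtype.val '' (Z : Set T)), P ∉ coneIdeal (Subtype.val '' (Z' : Set T)) := by
  obtain ⟨F, hF, hFZ⟩ := Set.exists_of_ssubset (show (Z : Set T) ⊂ Z' from h)
  obtain ⟨P, n, hn, hPF, hPZ⟩ := exists_evalForm_of_isClosed_subtype Z.isClosed' hFZ
  refine ⟨P, ?_, fun hP => hPF ?_⟩
  · rintro _ ⟨G, hG, rfl⟩ c
    rw [evalForm_smul hn, hPZ G hG, mul_zero]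
  · simpa using hP F.1 ⟨F, hF, rfl⟩ 1

theorem isIrreducible_image_val {d : ℕ} {T : Set (Foliation d)}
    (Z : TopologicalSpace.IrreducibleCloseds T) :
    IsIrreducible (Subtype.val '' (Z : Set T)) :=
  Z.isIrreducible'.image _ continuous_subtype_val.continuousOn

/-- A chain of irreducible closed sets yields algebraically independent functions on the cone over
its largest member; the vertex of the cone accounts for one function more than the length. -/
theorem exists_algebraicIndependent_of_LTSeries {d : ℕ} {T : Set (Foliation d)}
    (s : LTSeries (TopologicalSpace.IrreducibleCloseds T)) (i : ℕ) (hi : i < s.length + 1) :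
    ∃ (ι : Type) (_ : Fintype ι) (x : ι → MvPolynomial (Module.Dual ℂ (OneForms d)) ℂ),
      Fintype.card ι = i + 1 ∧ AlgebraicIndependent ℂ fun j =>
        Ideal.Quotient.mkₐ ℂ (coneIdeal (Subtype.val '' (s ⟨i, hi⟩ : Set T))) (x j) := by
  induction i with
  | zero =>
    have hp := coneIdeal_isPrime (isIrreducible_image_val (s ⟨0, hi⟩))
    obtain ⟨F, hF⟩ := (isIrreducible_image_val (s ⟨0, hi⟩)).nonempty
    let e := (aeval fun l : Module.Dual ℂ (OneForms d) => l 0 :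
      MvPolynomial (Module.Dual ℂ (OneForms d)) ℂ →ₐ[ℂ] ℂ)
    have hq : (RingHom.ker e).IsPrime := RingHom.ker_isPrime e
    obtain ⟨l, hl⟩ : ∃ l : Module.Dual ℂ (OneForms d), l F.form ≠ 0 := by
      by_contra! h
      exact F.form_ne_zero ((Module.forall_dual_apply_eq_zero_iff ℂ _).1 h)
    refine ⟨Option Empty, inferInstance, _, by simp, algebraicIndependent_option_of_lt
      (q := RingHom.ker e) (g := X l) (x := Empty.elim) (fun P hP => ?_) ?_ (fun h => hl ?_) ?_⟩
    · have := hP F hF 0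
      rw [zero_smul] at this
      exact this
    · rw [RingHom.mem_ker, aeval_X, map_zero]
    · have := h F hF 1
      rwa [one_smul, evalForm, eval_X] at this
    · rw [algebraicIndependent_empty_type_iff]
      exact (algebraMap ℂ _).injective
  | succ i ih =>
    obtain ⟨ι, hι, x, hcard, hx⟩ := ih (by omega)
    have hlt : s ⟨i, by omega⟩ < s ⟨i + 1, hi⟩ := s.strictMono (Fin.mk_lt_mk.2 (Nat.lt_succ_self i))
    have hp := coneIdeal_isPrime (isIrreducible_image_val (s ⟨i + 1, hi⟩))
    have hq := coneIdeal_isPrime (isIrreducible_image_val (s ⟨i, by omega⟩))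
    obtain ⟨P, hP, hP'⟩ := exists_mem_coneIdeal_of_lt hlt
    have hle : coneIdeal (Subtype.val '' (s ⟨i + 1, hi⟩ : Set T)) ≤
        coneIdeal (Subtype.val '' (s ⟨i, by omega⟩ : Set T)) :=
      fun Q hQ F hF => hQ F (Set.image_mono hlt.le hF)
    exact ⟨Option ι, inferInstance, _, by simp [hcard],
      algebraicIndependent_option_of_lt hle hP hP' hx⟩

/-- The dimension of an orbit is at most `8` minus the dimension of the isotropy algebra. The
subtraction is truncated, but an isotropy algebra has dimension at most eight. -/
theorem topologicalKrullDim_orbit_le {d : ℕ} {F : Foliation d} {κ : Type} [Fintype κ]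
    {M : κ → Matrix (Fin 3) (Fin 3) ℂ} (hM : LinearIndependent ℂ M)
    (hMF : ∀ k, M k ∈ isotropy (F.form : Fin 3 → MvPolynomial (Fin 3) ℂ)) :
    topologicalKrullDim (orbit F) ≤ (8 - Fintype.card κ : ℕ) := by
  refine iSup_le fun s => ?_
  obtain ⟨ι, _, x, hcard, hx⟩ := exists_algebraicIndependent_of_LTSeries s s.length
    (Nat.lt_succ_self _)
  have hle : RingHom.ker (orbitMap F.form) ≤
      coneIdeal (Subtype.val '' (s ⟨s.length, Nat.lt_succ_self _⟩ : Set (orbit F))) := by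
    rintro P hP _ ⟨G, -, rfl⟩ c
    obtain ⟨A, hA⟩ := mem_orbit_iff.1 G.2
    obtain ⟨a, ha⟩ := exists_pullbackHom_eq_smul (d := d) c A.1
    rw [← hA, ← ha, ← eval_orbitMap, RingHom.mem_ker.1 hP, map_zero]
  have hx' : AlgebraicIndependent ℂ fun i =>
      Ideal.Quotient.mkₐ ℂ (RingHom.ker (orbitMap F.form)) (x i) :=
    AlgebraicIndependent.of_comp (Ideal.Quotient.factorₐ ℂ hle) hx
  have := card_add_card_le_of_isotropy hM hMF hx'
  exact_mod_cast (show s.length ≤ 8 - Fintype.card κ by omega)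

/-! ### The dimension of an orbit from below -/

/-- The point `A^* F` of the orbit of `F`. -/
noncomputable def orbitPoint {d : ℕ} (F : Foliation d) (A : GL (Fin 3) ℂ) : orbit F :=
  ⟨F.pullback A, Set.mem_range_self A⟩

/-- The foliations `A^* F`, where `A` is an invertible matrix in the span of the family `b`, as a
subset of the orbit of `F`. -/
def spanOrbit {d : ℕ} (F : Foliation d) {ι : Type*} [Fintype ι]
    (b : ι → Matrix (Fin 3) (Fin 3) ℂ) : Set (orbit F) :=
  {H | ∃ (t : ι → ℂ) (A : GL (Fin 3) ℂ), A.1 = ∑ j, t j • b j ∧ orbitPoint F A = H}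

theorem restrictMat_det_ne_zero {ι : Type*} [Fintype ι] {b : ι → Matrix (Fin 3) (Fin 3) ℂ}
    (h1 : 1 ∈ Submodule.span ℂ (Set.range b)) :
    restrictMat b (Matrix.mvPolynomialX (Fin 3) (Fin 3) ℂ).det ≠ 0 := fun h0 => by
  obtain ⟨t, ht⟩ := (Submodule.mem_span_range_iff_exists_fun ℂ).1 h1
  have h := congrArg (eval t) h0
  rw [eval_restrictMat, ht, map_zero, Matrix.eval_det_mvPolynomialX] at h
  exact one_ne_zero (Matrix.det_one.symm.trans h)

/-- A polynomial that does not vanish identically on the span of a family of matrices does not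
vanish at some invertible matrix of the span. -/
theorem exists_GL_of_restrictMat_ne_zero {ι : Type*} [Fintype ι]
    {b : ι → Matrix (Fin 3) (Fin 3) ℂ} (h1 : 1 ∈ Submodule.span ℂ (Set.range b))
    {g : MvPolynomial (Fin 3 × Fin 3) ℂ} (hg : restrictMat b g ≠ 0) :
    ∃ (t : ι → ℂ) (A : GL (Fin 3) ℂ), A.1 = ∑ j, t j • b j ∧ eval (fun p => A.1 p.1 p.2) g ≠ 0 := by
  by_contra! h
  refine mul_ne_zero hg (restrictMat_det_ne_zero h1) (MvPolynomial.funext fun t => ?_)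
  rw [map_mul, map_zero, mul_eq_zero, or_iff_not_imp_right, eval_restrictMat, eval_restrictMat,
    Matrix.eval_det_mvPolynomialX]
  intro hdet
  have hA : IsUnit (∑ j, t j • b j) := by
    rw [Matrix.isUnit_iff_isUnit_det, isUnit_iff_ne_zero]
    exact hdet
  exact h t hA.unit rfl

theorem evalForm_pullback_form_eq_zero_iff {d : ℕ} {F : Foliation d}
    {P : MvPolynomial (Module.Dual ℂ (OneForms d)) ℂ} {n : ℕ} (hP : P.IsHomogeneous n)
    (A : GL (Fin 3) ℂ) :
    evalForm P (orbitPoint F A).1.form = 0 ↔ eval (fun p => A.1 p.1 p.2) (orbitMap F.form P) = 0 := by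
  obtain ⟨c, hc, h⟩ := F.exists_form_pullback A
  rw [orbitPoint, h, evalForm_smul hP, eval_orbitMap, mul_eq_zero, or_iff_right (pow_ne_zero _ hc)]

/-- The image of a linear space of matrices is irreducible, because a product of two nonzero
polynomials on that space is nonzero. -/
theorem isIrreducible_spanOrbit {d : ℕ} (F : Foliation d) {ι : Type*} [Fintype ι]
    {b : ι → Matrix (Fin 3) (Fin 3) ℂ} (h1 : 1 ∈ Submodule.span ℂ (Set.range b)) :
    IsIrreducible (spanOrbit F b) := by
  refine ⟨?_, ?_⟩
  · obtain ⟨t, ht⟩ := (Submodule.mem_span_range_iff_exists_fun ℂ).1 h1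
    exact ⟨orbitPoint F 1, t, 1, ht.symm, rfl⟩
  · have key : ∀ u : Set (orbit F), IsOpen u → (spanOrbit F b ∩ u).Nonempty →
        ∃ g, restrictMat b g ≠ 0 ∧ ∀ A : GL (Fin 3) ℂ, eval (fun p => A.1 p.1 p.2) g ≠ 0 →
          orbitPoint F A ∈ u := by
      rintro u hu ⟨_, ⟨t, A, hA, rfl⟩, hHu⟩
      obtain ⟨P, n, hn, hP, hPu⟩ := exists_evalForm_of_isClosed_subtype hu.isClosed_compl
        (F := orbitPoint F A) (fun h => h hHu)
      refine ⟨orbitMap F.form P, fun h0 => ?_, fun B hB => ?_⟩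
      · rw [Ne, evalForm_pullback_form_eq_zero_iff hn, hA, ← eval_restrictMat, h0, map_zero] at hP
        exact hP rfl
      · by_contra hBu
        exact hB ((evalForm_pullback_form_eq_zero_iff hn B).1
          (hPu (orbitPoint F B) (Set.mem_compl hBu)))
    intro u v hu hv hu' hv'
    obtain ⟨g, hg, hgu⟩ := key u hu hu'
    obtain ⟨g', hg', hgv⟩ := key v hv hv'
    obtain ⟨t, A, hA, hgA⟩ := exists_GL_of_restrictMat_ne_zero h1 (g := g * g')
      (by rw [map_mul]; exact mul_ne_zero hg hg')
    rw [map_mul] at hgA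
    exact ⟨orbitPoint F A, ⟨t, A, hA, rfl⟩, hgu A (left_ne_zero_of_mul hgA),
      hgv A (right_ne_zero_of_mul hgA)⟩

/-- The closure of `spanOrbit F b` determines the ideal of the cone over it. -/
theorem ker_restrictMat_le_of_closure_le {d : ℕ} {F : Foliation d} {ι ι' : Type*} [Fintype ι]
    [Fintype ι'] {b : ι → Matrix (Fin 3) (Fin 3) ℂ} {b' : ι' → Matrix (Fin 3) (Fin 3) ℂ}
    (h1 : 1 ∈ Submodule.span ℂ (Set.range b'))
    (h : closure (spanOrbit F b') ⊆ closure (spanOrbit F b)) :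
    RingHom.ker ((restrictMat b).comp (orbitMap F.form)) ≤
      RingHom.ker ((restrictMat b').comp (orbitMap F.form)) := by
  intro P hP
  have hPn : ∀ n, restrictMat b' (orbitMap F.form (homogeneousComponent n P)) = 0 := fun n => by
    by_contra hne
    obtain ⟨t, A, hA, hPA⟩ := exists_GL_of_restrictMat_ne_zero h1 hne
    have hn := homogeneousComponent_isHomogeneous n P
    have hmem : orbitPoint F A ∈ closure (spanOrbit F b) :=
      h (subset_closure ⟨t, A, hA, rfl⟩)
    have hcl : IsClosed {H : Foliation d | evalForm (homogeneousComponent n P) H.form = 0} :=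
      isClosed_foliation_iff.2 ⟨{homogeneousComponent n P},
        fun Q hQ => ⟨n, Set.mem_singleton_iff.1 hQ ▸ hn⟩, fun H => by
          rw [Set.mem_ofPred_eq]
          exact ⟨fun h Q hQ => Set.mem_singleton_iff.1 hQ ▸ h, fun h => h _ rfl⟩⟩
    suffices hsub : spanOrbit F b ⊆ Subtype.val ⁻¹'
        {H : Foliation d | evalForm (homogeneousComponent n P) H.form = 0} by
      have h2 := closure_minimal hsub (hcl.preimage continuous_subtype_val) hmem
      rw [Set.mem_preimage, Set.mem_ofPred_eq] at h2
      exact hPA ((evalForm_pullback_form_eq_zero_iff hn A).1 h2)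
    rintro _ ⟨t, B, hB, rfl⟩
    rw [Set.mem_preimage, Set.mem_ofPred_eq]
    refine (evalForm_pullback_form_eq_zero_iff hn B).2 ?_
    rw [eval_orbitMap]
    refine evalForm_homogeneousComponent_eq_zero (fun c => ?_) n
    obtain ⟨a, ha⟩ := exists_pullbackHom_eq_smul (d := d) c B.1
    have hB' : a • B.1 = ∑ j, (a • t) j • b j := by
      simp only [hB, Finset.smul_sum, Pi.smul_apply, smul_eq_mul, mul_smul]
    have hP' : restrictMat b (orbitMap F.form P) = 0 := hP
    rw [← ha, ← eval_orbitMap, hB', ← eval_restrictMat, hP', map_zero]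
  rw [RingHom.mem_ker, ← sum_homogeneousComponent P, map_sum]
  exact Finset.sum_eq_zero fun n _ => hPn n

/-- When the isotropy algebra vanishes, the cone over `spanOrbit F b'` has as many algebraically
independent functions as `b'` has members, so it is not contained in the closure of a smaller one. -/
theorem card_le_of_closure_spanOrbit_le {d : ℕ} {F : Foliation d} {ι ι' : Type} [Fintype ι]
    [Fintype ι'] {b : ι → Matrix (Fin 3) (Fin 3) ℂ} {b' : ι' → Matrix (Fin 3) (Fin 3) ℂ}
    (hb' : LinearIndependent ℂ b') (h1 : 1 ∈ Submodule.span ℂ (Set.range b'))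
    (hF : isotropy (F.form : Fin 3 → MvPolynomial (Fin 3) ℂ) = ⊥)
    (h : closure (spanOrbit F b') ⊆ closure (spanOrbit F b)) :
    Fintype.card ι' ≤ Fintype.card ι := by
  obtain ⟨x, hx⟩ := exists_algebraicIndependent_restrictMat (w := F.form) hb' h1
    (by rw [hF]; exact disjoint_bot_right)
  have h2 := (algebraicIndependent_mkₐ_ker ((restrictMat b').comp (orbitMap F.form)) x).2 hx
  have h3 := (algebraicIndependent_mkₐ_ker ((restrictMat b).comp (orbitMap F.form)) x).1
    (AlgebraicIndependent.of_comp
      (Ideal.Quotient.factorₐ ℂ (ker_restrictMat_le_of_closure_le h1 h)) h2)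
  have h4 := h3.lift_cardinalMk_le_trdeg
  rw [MvPolynomial.trdeg_of_isDomain] at h4
  simpa using h4

theorem exists_linearIndependent_matrix_zero_eq_one :
    ∃ b : Fin 9 → Matrix (Fin 3) (Fin 3) ℂ, LinearIndependent ℂ b ∧ b 0 = 1 := by
  have h : ∀ n ≤ 8, ∃ b : Fin (n + 1) → Matrix (Fin 3) (Fin 3) ℂ,
      LinearIndependent ℂ b ∧ b 0 = 1 := by
    intro n
    induction n with
    | zero =>
      intro _
      change ∃ b : Fin 1 → Matrix (Fin 3) (Fin 3) ℂ, LinearIndependent ℂ b ∧ b 0 = 1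
      exact ⟨fun _ => 1, LinearIndependent.of_subsingleton 0 one_ne_zero, rfl⟩
    | succ n ih =>
      intro hn
      obtain ⟨b, hb, hb0⟩ := ih (by omega)
      obtain ⟨M, hM⟩ := exists_linearIndependent_snoc_of_lt_finrank hb (by
        rw [Module.finrank_matrix]
        simp
        omega)
      refine ⟨_, hM, ?_⟩
      rw [← hb0]
      exact Fin.snoc_castSucc (α := fun _ => Matrix (Fin 3) (Fin 3) ℂ) M b 0
  exact h 8 le_rfl

/-- An orbit with a trivial isotropy algebra has dimension at least eight: the images of a complete
flag of linear spaces of matrices, whose line contains the identity, form a chain. -/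
theorem le_topologicalKrullDim_orbit {d : ℕ} {F : Foliation d}
    (hF : isotropy (F.form : Fin 3 → MvPolynomial (Fin 3) ℂ) = ⊥) :
    8 ≤ topologicalKrullDim (orbit F) := by
  obtain ⟨b, hb, hb0⟩ := exists_linearIndependent_matrix_zero_eq_one
  let c : ∀ i : Fin 9, Fin (i + 1) → Matrix (Fin 3) (Fin 3) ℂ := fun i =>
    b ∘ Fin.castLE (Nat.succ_le_of_lt i.2)
  have hc : ∀ i, LinearIndependent ℂ (c i) := fun i =>
    hb.comp _ (Fin.castLE_injective _)
  have h1 : ∀ i, 1 ∈ Submodule.span ℂ (Set.range (c i)) := fun i =>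
    Submodule.subset_span ⟨0, hb0⟩
  let Z : Fin 9 → TopologicalSpace.IrreducibleCloseds (orbit F) := fun i =>
    ⟨closure (spanOrbit F (c i)), (isIrreducible_spanOrbit F (h1 i)).closure, isClosed_closure⟩
  have hZ : StrictMono Z := fun i j hij => by
    refine lt_of_le_not_ge ?_ fun hle => ?_
    · refine closure_mono ?_
      rintro H ⟨t, A, hA, hAH⟩
      have hmem : A.1 ∈ Submodule.span ℂ (Set.range (c j)) := by
        rw [hA]
        refine Submodule.sum_mem _ fun k _ => Submodule.smul_mem _ _ (Submodule.subset_span ?_)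
        exact ⟨Fin.castLE (by have := Fin.lt_def.1 hij; omega) k, rfl⟩
      obtain ⟨t', ht'⟩ := (Submodule.mem_span_range_iff_exists_fun ℂ).1 hmem
      exact ⟨t', A, ht'.symm, hAH⟩
    · have := card_le_of_closure_spanOrbit_le (hc j) (h1 j) hF hle
      rw [Fintype.card_fin, Fintype.card_fin] at this
      exact absurd (Fin.lt_def.1 hij) (by omega)
  exact Order.LTSeries.length_le_krullDim (LTSeries.mk 8 Z hZ)

/-! ### The two exceptional orbits -/

theorem transvection_mem_isotropy_form₁ (d : ℕ) :
    !![0, 0, 0; 0, 0, 0; 1, 0, 0] ∈ isotropy (form₁ d) := by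
  rw [mem_isotropy]
  funext j
  fin_cases j <;>
    simp [lieForm, form₁, Fin.sum_univ_three, Derivation.leibniz, Derivation.leibniz_pow]
  ring

theorem transvection_mem_isotropy_form₂ (d : ℕ) :
    !![0, 0, 0; 0, 0, 0; 1, 0, 0] ∈ isotropy (form₂ d) := by
  rw [mem_isotropy]
  funext j
  fin_cases j <;>
    simp [lieForm, form₂, Fin.sum_univ_three, Derivation.leibniz, Derivation.leibniz_pow]
  ring

theorem diagonal_mem_isotropy_form₁ {d : ℕ} (hd : d ≠ 0) :
    Matrix.diagonal ![1, -((d : ℂ) + 1), (d : ℂ) * (d + 1) - 1] ∈ isotropy (form₁ d) := by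
  obtain ⟨e, rfl⟩ := Nat.exists_eq_succ_of_ne_zero hd
  rw [mem_isotropy]
  funext j
  fin_cases j <;>
    simp [lieForm, form₁, Fin.sum_univ_three, Derivation.leibniz, Derivation.leibniz_pow,
      Matrix.diagonal] <;>
    ring

theorem diagonal_mem_isotropy_form₂ {d : ℕ} (hd : d ≠ 0) :
    Matrix.diagonal ![-((d : ℂ) + 1), 1, ((d : ℂ) + 1) ^ 2] ∈ isotropy (form₂ d) := by
  obtain ⟨e, rfl⟩ := Nat.exists_eq_succ_of_ne_zero hd
  rw [mem_isotropy]
  funext j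
  fin_cases j <;>
    simp [lieForm, form₂, Fin.sum_univ_three, Derivation.leibniz, Derivation.leibniz_pow,
      Matrix.diagonal] <;>
    ring

theorem isotropy_smul {w : Fin 3 → MvPolynomial (Fin 3) ℂ} {c : ℂ} {M : Matrix (Fin 3) (Fin 3) ℂ}
    (hM : M ∈ isotropy w) : M ∈ isotropy (c • w) := by
  rw [mem_isotropy] at *
  rw [lieForm_smul_right, hM, smul_zero]

/-- Two independent elements of the isotropy algebra bound the dimension by six. -/
theorem topologicalKrullDim_orbit_le_six {d : ℕ} {F : Foliation d} {t : Fin 3 → ℂ} (ht : t ≠ 0)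
    (h1 : !![0, 0, 0; 0, 0, 0; 1, 0, 0] ∈ isotropy (F.form : Fin 3 → MvPolynomial (Fin 3) ℂ))
    (h2 : Matrix.diagonal t ∈ isotropy (F.form : Fin 3 → MvPolynomial (Fin 3) ℂ)) :
    topologicalKrullDim (orbit F) ≤ 6 := by
  have hli : LinearIndependent ℂ
      ![(!![0, 0, 0; 0, 0, 0; 1, 0, 0] : Matrix (Fin 3) (Fin 3) ℂ), Matrix.diagonal t] := by
    rw [LinearIndependent.pair_iff]
    intro a b hab
    have hb : b = 0 := by
      by_contra hb
      refine ht (funext fun i => ?_)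
      have := congrFun (congrFun hab i) i
      fin_cases i <;> simpa [hb] using this
    have ha := congrFun (congrFun hab 2) 0
    exact ⟨by simpa using ha, hb⟩
  exact topologicalKrullDim_orbit_le hli (by
    intro k
    fin_cases k
    · exact h1
    · exact h2)

theorem topologicalKrullDim_orbit_F₁_le {d : ℕ} (hd : d ≠ 0) :
    topologicalKrullDim (orbit (F₁ d)) ≤ 6 := by
  obtain ⟨c, -, hc⟩ := Foliation.exists_form_ofForm ⟨form₁ d, form₁_mem d⟩
    (form₁_noCommonFactor d)
  have hc' : ((F₁ d).form : Fin 3 → MvPolynomial (Fin 3) ℂ) = c • form₁ d :=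
    congrArg Subtype.val hc
  refine topologicalKrullDim_orbit_le_six (fun h => ?_)
    (hc' ▸ isotropy_smul (transvection_mem_isotropy_form₁ d))
    (hc' ▸ isotropy_smul (diagonal_mem_isotropy_form₁ hd))
  exact one_ne_zero (congrFun h 0)

theorem topologicalKrullDim_orbit_F₂_le {d : ℕ} (hd : d ≠ 0) :
    topologicalKrullDim (orbit (F₂ d)) ≤ 6 := by
  obtain ⟨c, -, hc⟩ := Foliation.exists_form_ofForm ⟨form₂ d, form₂_mem d⟩
    (form₂_noCommonFactor d)
  have hc' : ((F₂ d).form : Fin 3 → MvPolynomial (Fin 3) ℂ) = c • form₂ d :=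
    congrArg Subtype.val hc
  refine topologicalKrullDim_orbit_le_six (fun h => ?_)
    (hc' ▸ isotropy_smul (transvection_mem_isotropy_form₂ d))
    (hc' ▸ isotropy_smul (diagonal_mem_isotropy_form₂ hd))
  exact one_ne_zero (congrFun h 1)

theorem mem_orbit_ofForm {d : ℕ} {w : OneForms d}
    (h : NoCommonFactor (w : Fin 3 → MvPolynomial (Fin 3) ℂ)) {G : Foliation d}
    {A : GL (Fin 3) ℂ} (hA : pullbackForm A.1 w = G.form) : G ∈ orbit (Foliation.ofForm w h) := by
  obtain ⟨c, hc0, hc⟩ := Foliation.exists_form_ofForm w h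
  refine mem_orbit_of_pullbackHom_eq_smul (A := A) hc0 ?_
  rw [hc, map_smul]
  exact congrArg (c • ·) (Subtype.ext hA)

theorem IsStandard.mem_orbit {d : ℕ} {G : Foliation d} (h : IsStandard d G.form) :
    G ∈ orbit (F₁ d) ∪ orbit (F₂ d) := by
  obtain ⟨A, hA | hA⟩ := h
  · exact Or.inl (mem_orbit_ofForm (form₁_noCommonFactor d) (w := ⟨form₁ d, form₁_mem d⟩) hA)
  · exact Or.inr (mem_orbit_ofForm (form₂_noCommonFactor d) (w := ⟨form₂ d, form₂_mem d⟩) hA)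

/-! ### Degenerations of orbits of dimension at most seven -/

/-- A foliation in the boundary of an orbit of dimension at most seven has an isotropy algebra of
dimension at least two. Otherwise the cone over its orbit has dimension at least eight, so the cone
over the orbit of `F` has dimension nine, the isotropy algebra of `F` vanishes and its orbit has
dimension eight. -/
theorem exists_mem_isotropy_of_mem_closure {d : ℕ} {F G : Foliation d}
    (hF : topologicalKrullDim (orbit F) ≤ 7) (hG : G ∈ closure (orbit F)) (hGF : G ∉ orbit F)
    (N : Matrix (Fin 3) (Fin 3) ℂ) :
    ∃ T ∈ isotropy (G.form : Fin 3 → MvPolynomial (Fin 3) ℂ), ∀ c : ℂ, T ≠ c • N := by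
  by_contra! hN
  set K := isotropy (G.form : Fin 3 → MvPolynomial (Fin 3) ℂ) with hK
  have hG0 : (G.form : Fin 3 → MvPolynomial (Fin 3) ℂ) ≠ 0 := fun h =>
    G.form_ne_zero (Subtype.ext h)
  have hdisj : Disjoint (Submodule.span ℂ {(1 : Matrix (Fin 3) (Fin 3) ℂ)}) K := by
    rw [Submodule.disjoint_def]
    intro T hT hTK
    obtain ⟨c, rfl⟩ := Submodule.mem_span_singleton.1 hT
    rw [smul_one_mem_isotropy G.form.2 hG0 hTK, zero_smul]
  -- a complement of the isotropy algebra that contains the identity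
  obtain ⟨L, h1L, hLK⟩ := hdisj.exists_isCompl
  have hKdim : Module.finrank ℂ K ≤ 1 := by
    have hle : K ≤ Submodule.span ℂ {N} := fun T hT => by
      obtain ⟨c, rfl⟩ := hN T hT
      exact Submodule.smul_mem _ _ (Submodule.mem_span_singleton_self N)
    refine (Submodule.finrank_mono hle).trans ((finrank_span_le_card _).trans ?_)
    simp
  have hLdim : 8 ≤ Module.finrank ℂ L := by
    have := Submodule.finrank_add_eq_of_isCompl hLK
    rw [Module.finrank_matrix] at this
    simp at this
    omega
  let β := Module.finBasis ℂ L
  let b : Fin (Module.finrank ℂ L) → Matrix (Fin 3) (Fin 3) ℂ := fun j => β j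
  have hb : LinearIndependent ℂ b := β.linearIndependent.map' L.subtype (Submodule.ker_subtype L)
  have hspan : Submodule.span ℂ (Set.range b) = L := by
    have : Set.range b = L.subtype '' Set.range β := by
      rw [← Set.range_comp]
      rfl
    rw [this, Submodule.span_image, β.span_eq, Submodule.map_top, Submodule.range_subtype]
  obtain ⟨x, hx⟩ := exists_algebraicIndependent_restrictMat (w := G.form) hb
    (by rw [hspan]; exact h1L (Submodule.mem_span_singleton_self 1))
    (by rw [hspan]; exact hLK.disjoint)
  have hxG := (algebraicIndependent_mkₐ_ker (orbitMap G.form) x).2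
    (AlgebraicIndependent.of_comp (restrictMat b) hx)
  obtain ⟨P, hP, hPF⟩ := exists_mem_ker_orbitMap_of_mem_closure hG hGF
  have hp : (RingHom.ker (orbitMap F.form)).IsPrime := RingHom.ker_isPrime _
  have hq : (RingHom.ker (orbitMap G.form)).IsPrime := RingHom.ker_isPrime _
  have hxF := algebraicIndependent_option_of_lt (ker_orbitMap_le_of_mem_closure hG) hP hPF hxG
  have hiso : isotropy (F.form : Fin 3 → MvPolynomial (Fin 3) ℂ) = ⊥ := by
    rw [Submodule.eq_bot_iff]
    intro M hM
    by_contra hM0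
    have := card_add_card_le_of_isotropy (κ := Unit) (M := fun _ => M)
      (LinearIndependent.of_subsingleton () hM0) (fun _ => hM) hxF
    simp at this
    omega
  have h8 := (le_topologicalKrullDim_orbit hiso).trans hF
  exact absurd h8 (by decide)

theorem closure_orbit_subset {d : ℕ} (hd : 2 ≤ d) {F : Foliation d}
    (hF : topologicalKrullDim (orbit F) ≤ 7) :
    closure (orbit F) ⊆ orbit F ∪ orbit (F₁ d) ∪ orbit (F₂ d) := fun G hG => by
  rw [Set.union_assoc]
  by_cases hGF : G ∈ orbit F
  · exact Or.inl hGF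
  · exact Or.inr (isStandard_of_isotropy hd G.form.2 G.2
      (exists_mem_isotropy_of_mem_closure hF hG hGF)).mem_orbit

end PlaneFoliation

theorem corollaryB (d : ℕ) (hd : 2 ≤ d) (F : PlaneFoliation.Foliation d) :
    (topologicalKrullDim (PlaneFoliation.orbit F) ≤ 7 →
      closure (PlaneFoliation.orbit F) ⊆
        PlaneFoliation.orbit F ∪ PlaneFoliation.orbit (PlaneFoliation.F₁ d) ∪
          PlaneFoliation.orbit (PlaneFoliation.F₂ d)) ∧
    (topologicalKrullDim (PlaneFoliation.orbit F) = 7 →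
      (IsClosed (PlaneFoliation.orbit F) ↔
        PlaneFoliation.F₁ d ∉ closure (PlaneFoliation.orbit F) ∧
          PlaneFoliation.F₂ d ∉ closure (PlaneFoliation.orbit F))) := by
  open PlaneFoliation in
  refine ⟨closure_orbit_subset hd, fun h7 => ⟨fun hcl => ?_, fun ⟨h1, h2⟩ => ?_⟩⟩
  · have hd0 : d ≠ 0 := by omega
    rw [hcl.closure_eq]
    constructor
    · intro h
      have := topologicalKrullDim_orbit_F₁_le hd0
      rw [orbit_eq_of_mem h, h7] at this
      exact absurd this (by decide)
    · intro h
      have := topologicalKrullDim_orbit_F₂_le hd0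
      rw [orbit_eq_of_mem h, h7] at this
      exact absurd this (by decide)
  · refine closure_subset_iff_isClosed.1 fun G hG => ?_
    rcases closure_orbit_subset hd h7.le hG with (hG' | hG') | hG'
    · exact hG'
    · exact absurd (orbit_subset_closure_of_mem_closure hG (mem_orbit_symm hG')) h1
    · exact absurd (orbit_subset_closure_of_mem_closure hG (mem_orbit_symm hG')) h2
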